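/- There are a randomized word-RAM program $\mathcal A$ and constants $K,W>0$ such that for every $c\in\mathbb N$ there is a constant $C>0$ for which the following holds. Let $\varepsilon\in(0,1)$ and $n,\Delta\in\mathbb N$ satisfy $$\Delta\ \ge\ C\,\max\left\{\frac{\log n}{\varepsilon},\ \left(\frac1\varepsilon\log\frac1\varepsilon\right)^2\right\},$$ and let $G$ be an $n$-vertex simple graph with $m$ edges and maximum degree $\Delta$. Run $\mathcal A$ on a word RAM with words of $w$ bits, for any $w\ge W\lfloor\log_2 n\rfloor$, with memory initially zero apart from the input. Given $n$, $m$, the number of colors $q=\lfloor(1+\varepsilon)\Delta\rfloor$ and a list of the edges of $G$ (in any order), $\mathcal A$ always halts within $K\,m\,(\log\Delta)^3/\varepsilon^2$ steps, and with probability at least $1-n^{-c}$ it outputs a proper $q$-edge-coloring of $G$, i.e. a function $\varphi:E(G)\to\{1,\dots,q\}$ with $\varphi(e)\ne\varphi(f)$ whenever $e\neq f$ share an endpoint. Here one step is one word instruction: addition, truncated subtraction, multiplication or integer division of words, reading or writing a memory cell, loading a constant, a zero test or other control step, or drawing a uniformly random word below a given bound. -/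

import Mathlib

/-! ### Edge colorings -/

/-- `φ` is a proper `q`-edge-coloring of `G`: the edges of `G` get colors from `{1, …, q}`, and two
distinct edges that share an endpoint get different colors. (Values of `φ` off the edges of `G` are
irrelevant.) -/
def IsProperEdgeColoring {V : Type*} (G : SimpleGraph V) (q : ℕ) (φ : Sym2 V → ℕ) : Prop :=
  (∀ e ∈ G.edgeSet, 1 ≤ φ e ∧ φ e ≤ q) ∧
    ∀ e ∈ G.edgeSet, ∀ f ∈ G.edgeSet, e ≠ f → (∃ v, v ∈ e ∧ v ∈ f) → φ e ≠ φ f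

/-- `ends` lists the edges of `G`: each edge of `G` occurs for exactly one index, with its two
endpoints in either order. -/
def IsEdgeListing {V : Type*} (G : SimpleGraph V) {m : ℕ} (ends : Fin m → V × V) : Prop :=
  Function.Injective (fun i => s((ends i).1, (ends i).2)) ∧
    Set.range (fun i => s((ends i).1, (ends i).2)) = G.edgeSet

/-- The length of an edge list is the number of edges. -/
theorem IsEdgeListing.ncard_edgeSet {V : Type*} {G : SimpleGraph V} {m : ℕ} {ends : Fin m → V × V}
    (h : IsEdgeListing G ends) : G.edgeSet.ncard = m := by
  rw [← h.2, ← Set.image_univ, Set.ncard_image_of_injective _ h.1, Set.ncard_univ]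
  simp

/-! ### The randomized word RAM

A machine with words of `w` bits: finitely many registers named in the program, a random access
memory addressed by words, unit-cost arithmetic on words, and a unit-cost instruction that draws a
uniformly random word below a given bound. A program is a finite piece of syntax; it does not
depend on the input or on `w`. -/

namespace WordRAM

/-- Programs: word instructions on registers `x`, `y`, `z`, and structured control flow. -/
inductive Program : Type
  /-- do nothing -/
  | skip : Program
  /-- `x := c` -/
  | const (x c : ℕ) : Program
  /-- `x := y + z` -/
  | add (x y z : ℕ) : Program
  /-- `x := max (y - z) 0` -/
  | sub (x y z : ℕ) : Program
  /-- `x := y * z` -/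
  | mul (x y z : ℕ) : Program
  /-- `x := ⌊y / z⌋`, and `0` if `z = 0` -/
  | div (x y z : ℕ) : Program
  /-- `x := memory[y]` -/
  | load (x y : ℕ) : Program
  /-- `memory[x] := y` -/
  | store (x y : ℕ) : Program
  /-- `x :=` a uniformly random element of `{0, …, y - 1}`, and `0` if `y = 0` -/
  | rand (x y : ℕ) : Program
  /-- run the first program, then the second one -/
  | seq (P Q : Program) : Program
  /-- run the first program if `x ≠ 0`, and the second one otherwise -/
  | ifNonzero (x : ℕ) (P Q : Program) : Program
  /-- while `x ≠ 0`, run the program -/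
  | whileNonzero (x : ℕ) (P : Program) : Program

/-- Contents of the registers and of the memory. -/
structure Store : Type where
  reg : ℕ → ℕ
  mem : ℕ → ℕ

/-- Write the word `v mod 2 ^ w` into register `x`. -/
def Store.setReg (w : ℕ) (σ : Store) (x v : ℕ) : Store :=
  { σ with reg := Function.update σ.reg x (v % 2 ^ w) }

/-- Write the word `v mod 2 ^ w` into memory cell `a`. -/
def Store.setMem (w : ℕ) (σ : Store) (a v : ℕ) : Store :=
  { σ with mem := Function.update σ.mem a (v % 2 ^ w) }

/-- A configuration: the pieces of program still to be executed, in order, and the store. -/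
structure Config : Type where
  todo : List Program
  store : Store

/-- The machine has halted when nothing is left to be executed. -/
def Config.Halted (s : Config) : Prop := s.todo = []

/-- The uniform distribution on `{0, …, k - 1}` (the point mass at `0` if `k = 0`). -/
noncomputable def uniformBelow (k : ℕ) : PMF ℕ :=
  if h : 0 < k then PMF.uniformOfFinset (Finset.range k) (Finset.nonempty_range_iff.mpr h.ne')
  else PMF.pure 0

/-- One step of the machine with `w`-bit words. Each instruction, each test of a condition and each
unfolding of a sequential composition is one step. Halted configurations do not change. -/
noncomputable def step (w : ℕ) : Config → PMF Config
  | ⟨[], σ⟩ => PMF.pure ⟨[], σ⟩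
  | ⟨.skip :: k, σ⟩ => PMF.pure ⟨k, σ⟩
  | ⟨.const x c :: k, σ⟩ => PMF.pure ⟨k, σ.setReg w x c⟩
  | ⟨.add x y z :: k, σ⟩ => PMF.pure ⟨k, σ.setReg w x (σ.reg y + σ.reg z)⟩
  | ⟨.sub x y z :: k, σ⟩ => PMF.pure ⟨k, σ.setReg w x (σ.reg y - σ.reg z)⟩
  | ⟨.mul x y z :: k, σ⟩ => PMF.pure ⟨k, σ.setReg w x (σ.reg y * σ.reg z)⟩
  | ⟨.div x y z :: k, σ⟩ => PMF.pure ⟨k, σ.setReg w x (σ.reg y / σ.reg z)⟩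
  | ⟨.load x y :: k, σ⟩ => PMF.pure ⟨k, σ.setReg w x (σ.mem (σ.reg y))⟩
  | ⟨.store x y :: k, σ⟩ => PMF.pure ⟨k, σ.setMem w (σ.reg x) (σ.reg y)⟩
  | ⟨.rand x y :: k, σ⟩ => (uniformBelow (σ.reg y)).map fun v => ⟨k, σ.setReg w x v⟩
  | ⟨.seq P Q :: k, σ⟩ => PMF.pure ⟨P :: Q :: k, σ⟩
  | ⟨.ifNonzero x P Q :: k, σ⟩ => PMF.pure ⟨(if σ.reg x ≠ 0 then P else Q) :: k, σ⟩
  | ⟨.whileNonzero x P :: k, σ⟩ =>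
      PMF.pure ⟨if σ.reg x ≠ 0 then P :: .whileNonzero x P :: k else k, σ⟩

/-- The distribution of the configuration after `t` steps; the random draws are independent. -/
noncomputable def run (w : ℕ) : ℕ → Config → PMF Config
  | 0, s => PMF.pure s
  | t + 1, s => (step w s).bind (run w t)

/-- The input: registers `0`, `1`, `2` hold the number `n` of vertices, the number `m` of edges and
the number `q` of colors, memory cells `2 i` and `2 i + 1` hold the endpoints of the `i`-th edge for
`i < m`, and everything else is `0`. -/
def inputStore {n m : ℕ} (q : ℕ) (ends : Fin m → Fin n × Fin n) : Store where
  reg := fun r => if r = 0 then n else if r = 1 then m else if r = 2 then q else 0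
  mem := fun a =>
    if h : a / 2 < m then
      if a % 2 = 0 then ((ends ⟨a / 2, h⟩).1 : ℕ) else ((ends ⟨a / 2, h⟩).2 : ℕ)
    else 0

/-- The initial configuration of the program `P`. -/
def initConfig (P : Program) {n m : ℕ} (q : ℕ) (ends : Fin m → Fin n × Fin n) : Config where
  todo := [P]
  store := inputStore q ends

/-- The output is a proper `q`-edge-coloring of `G`: memory cell `2 m + i` (the cells right after the
edge list) holds the color of the `i`-th edge, for `i < m`. -/
def OutputsColoring {n m : ℕ} (G : SimpleGraph (Fin n)) (q : ℕ) (ends : Fin m → Fin n × Fin n)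
    (s : Config) : Prop :=
  ∃ φ : Sym2 (Fin n) → ℕ, IsProperEdgeColoring G q φ ∧
    ∀ i : Fin m, s.store.mem (2 * m + i) = φ s((ends i).1, (ends i).2)

end WordRAM

/-!
The program `main` maintains a proper partial coloring, in the output array, and a table that tells,
for a vertex and a color, the edge at that vertex with that color. There are `Δ + e` colors with
`e ≈ ε Δ`; those up to `κ = Δ + e / 2` are used in a random phase and the others are reserved.

In the random phase, uncolored edges wait in a queue, and each round takes a uniformly random edge
out of it. A round draws a palette of `s` random colors and a random number `cnt < ℓ`, builds a Vizing
fan at the edge in which all missing colors come from the palette, flips the alternating path that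
the fan asks for, and shifts the colors of the fan. The path is cut off after `cnt` edges, the next
edge of it losing its color. So the round costs `O(s ^ 2 + ℓ)` steps, which is
`O((log Δ) ^ 2 / ε ^ 2)`, and it can go wrong in two ways only (`process_spec`, `Outcome`): some vertex
near the edge is missing no color of the palette, or the path was cut off. A path that starts at a
given vertex with given colors is cut off at a given edge for few values of `cnt`, and a palette
has no color missing at a given vertex with probability at most `Δ⁻⁴` (`Params.pow_le`), because
uncolored edges leave many colors missing; `s` grows while the queue shrinks.

The uncolored edges at a vertex `v` that are not in the queue form its excess, and a failed round
raises the excess of few vertices by one. Hence the sum over all `v` of `2 ^ excess v`, with a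
deterministic correction, does not grow on average (`EdgeList.core`). The number of queue edges at a
vertex is controlled by exponential moments as well, which are supermartingales because drawing is
without replacement (`EdgeList.tail`). The sum of both, cut off at `1`, is the potential of the phase
(`Params.round_le`, `randomPhase_expect`); its initial value is exponentially small in `e`, and as long
as it is less than `1`, every vertex has at most `e / 8` uncolored edges when the queue has shrunk to
`e m / (100 Δ)` edges (`Phase.fewLeft`). The final phase then gives random reserved colors to the
remaining edges: each attempt succeeds with probability at least `1 / 2`, and `8 m` attempts
suffice up to a probability exponentially small in `m` (`finalPhase_expect`).

Running time and failure probability are treated together by `risk`, the expectation of a loss that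
is `⊤` for configurations that have not halted. The triples `Det` and `Expect` reason about
programs on structured states `HState`, with variables and arrays, that a store represents (`Repr`);
in the rule for random loops, a potential takes the place of the invariant.
-/

open scoped ENNReal

namespace WordRAM

/-! ### Expected loss of a run -/

/-- The loss of a configuration: `F` of the store if the machine has halted, and `⊤` otherwise. -/
noncomputable def loss (F : Store → ℝ≥0∞) : Config → ℝ≥0∞
  | ⟨[], σ⟩ => F σ
  | ⟨_ :: _, _⟩ => ⊤

/-- The expected loss after `t` steps. A finite value says that every run halts within `t` steps, so
that running time and failure probability are bounded by one number. -/
noncomputable def risk (w : ℕ) (F : Store → ℝ≥0∞) (t : ℕ) (s : Config) : ℝ≥0∞ :=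
  ∑' s', run w t s s' * loss F s'

theorem tsum_bind_mul {α β : Type*} (p : PMF α) (f : α → PMF β) (g : β → ℝ≥0∞) :
    ∑' b, (p.bind f) b * g b = ∑' a, p a * ∑' b, f a b * g b := by
  simp only [PMF.bind_apply, ← ENNReal.tsum_mul_right, ← ENNReal.tsum_mul_left]
  rw [ENNReal.tsum_comm]
  simp only [mul_assoc]

theorem tsum_pure_mul {α : Type*} (a : α) (g : α → ℝ≥0∞) : ∑' b, (PMF.pure a) b * g b = g a := by
  rw [tsum_eq_single a]
  · simp
  · intro b hb
    simp [PMF.pure_apply, hb]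

theorem risk_zero (w : ℕ) (F : Store → ℝ≥0∞) (s : Config) : risk w F 0 s = loss F s :=
  tsum_pure_mul _ _

theorem risk_succ (w : ℕ) (F : Store → ℝ≥0∞) (t : ℕ) (s : Config) :
    risk w F (t + 1) s = ∑' s', step w s s' * risk w F t s' :=
  tsum_bind_mul _ _ _

theorem risk_succ_of_pure {w : ℕ} {F : Store → ℝ≥0∞} {t : ℕ} {s s' : Config}
    (h : step w s = PMF.pure s') : risk w F (t + 1) s = risk w F t s' := by
  rw [risk_succ, h, tsum_pure_mul]

theorem risk_halted (w : ℕ) (F : Store → ℝ≥0∞) (t : ℕ) (σ : Store) :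
    risk w F t ⟨[], σ⟩ = F σ := by
  induction t with
  | zero => exact risk_zero _ _ _
  | succ t ih => rw [risk_succ_of_pure (s' := ⟨[], σ⟩) (by simp [step]), ih]

theorem risk_succ_le (w : ℕ) (F : Store → ℝ≥0∞) (t : ℕ) (s : Config) :
    risk w F (t + 1) s ≤ risk w F t s := by
  induction t generalizing s with
  | zero =>
    obtain ⟨k, σ⟩ := s
    cases k with
    | nil => simp [risk_halted]
    | cons => rw [risk_zero]; exact le_top
  | succ t ih =>
    rw [risk_succ, risk_succ w F t]
    exact ENNReal.tsum_le_tsum fun s' => mul_le_mul_right (ih s') _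

theorem risk_anti {w : ℕ} {F : Store → ℝ≥0∞} {t t' : ℕ} (h : t ≤ t') (s : Config) :
    risk w F t' s ≤ risk w F t s := by
  induction h with
  | refl => exact le_rfl
  | step _ ih => exact (risk_succ_le _ _ _ _).trans ih

/-- From store `σ`, the program `P` surely ends in store `σ'` after at most `t` steps. -/
def Leads (w : ℕ) (P : Program) (t : ℕ) (σ σ' : Store) : Prop :=
  ∀ F k t', risk w F (t + t') ⟨P :: k, σ⟩ ≤ risk w F t' ⟨k, σ'⟩

theorem Leads.of_step {w : ℕ} {P : Program} {σ σ' : Store}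
    (h : ∀ k, step w ⟨P :: k, σ⟩ = PMF.pure ⟨k, σ'⟩) : Leads w P 1 σ σ' := by
  intro F k t'
  rw [add_comm, risk_succ_of_pure (h k)]

theorem Leads.seq {w : ℕ} {P Q : Program} {t₁ t₂ : ℕ} {σ₁ σ₂ σ₃ : Store}
    (h₁ : Leads w P t₁ σ₁ σ₂) (h₂ : Leads w Q t₂ σ₂ σ₃) :
    Leads w (.seq P Q) (t₁ + t₂ + 1) σ₁ σ₃ := by
  intro F k t'
  rw [show t₁ + t₂ + 1 + t' = (t₁ + (t₂ + t')) + 1 by ring,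
    risk_succ_of_pure (s' := ⟨P :: Q :: k, σ₁⟩) (by simp [step])]
  exact (h₁ F _ _).trans (h₂ F _ _)

theorem Leads.mono {w : ℕ} {P : Program} {t₁ t₂ : ℕ} {σ σ' : Store} (h : Leads w P t₁ σ σ')
    (ht : t₁ ≤ t₂) : Leads w P t₂ σ σ' := fun F k t' =>
  (risk_anti (by omega) _).trans (h F k t')

/-- A bound for the number of steps of a loop-free program. -/
def Program.size : Program → ℕ
  | .seq P Q => P.size + Q.size + 1
  | .ifNonzero _ P Q => P.size + Q.size + 1
  | .whileNonzero _ P => P.size + 1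
  | _ => 1

/-! ### Structured states and expressions -/

/-- A structured view of a store: variables `v i` for `i < 90`, and arrays `a t` for `t < 16`. -/
structure HState : Type where
  v : ℕ → ℕ
  a : ℕ → ℕ → ℕ

/-- Assignment to a variable. -/
def HState.setV (S : HState) (x y : ℕ) : HState := { S with v := Function.update S.v x y }

/-- Assignment to an array entry. -/
def HState.setA (S : HState) (t i y : ℕ) : HState :=
  { S with a := Function.update S.a t (Function.update (S.a t) i y) }

@[simp] theorem HState.setV_v (S : HState) (x y z : ℕ) :
    (S.setV x y).v z = if z = x then y else S.v z := by
  simp [HState.setV, Function.update_apply]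

@[simp] theorem HState.setV_a (S : HState) (x y : ℕ) : (S.setV x y).a = S.a := rfl

@[simp] theorem HState.setA_v (S : HState) (t i y : ℕ) : (S.setA t i y).v = S.v := rfl

theorem HState.setA_a (S : HState) (t i y t' : ℕ) :
    (S.setA t i y).a t' = if t' = t then Function.update (S.a t) i y else S.a t' := by
  by_cases h : t' = t
  · subst h; simp [HState.setA]
  · simp [HState.setA, h]

@[simp] theorem HState.setA_a_same (S : HState) (t i y : ℕ) :
    (S.setA t i y).a t = Function.update (S.a t) i y := by
  simp [HState.setA_a]

theorem HState.setA_a_ne (S : HState) {t t' : ℕ} (i y : ℕ) (h : t' ≠ t) :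
    (S.setA t i y).a t' = S.a t' := by
  simp [HState.setA_a, h]

/-- The address of entry `i` of array `t`. Arrays `0` and `1` are the two halves of the edge list,
array `2` is the output, and the other arrays are interleaved behind the output, so that no bound on
their lengths is needed to keep them apart. -/
def addr (m t i : ℕ) : ℕ :=
  if t = 0 then 2 * i else if t = 1 then 2 * i + 1 else if t = 2 then 2 * m + i
  else 3 * m + 16 * i + t

theorem addr_inj {m t t' i i' : ℕ} (ht : t < 16) (ht' : t' < 16) (hi : t < 3 → i < m)
    (hi' : t' < 3 → i' < m) (h : addr m t i = addr m t' i') : t = t' ∧ i = i' := by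
  unfold addr at h
  split_ifs at h <;> omega

/-- The store `σ` represents the structured state `S`. Registers `91`, `92`, `93` hold constants for
address computations, and registers from `100` on are scratch space. -/
structure Repr (w m : ℕ) (σ : Store) (S : HState) : Prop where
  reg : ∀ i < 90, σ.reg i = S.v i
  zero : σ.reg 91 = 0
  base : σ.reg 92 = 3 * m
  out : σ.reg 93 = 2 * m
  mem : ∀ t < 16, ∀ i, (t < 3 → i < m) → σ.mem (addr m t i) = S.a t i
  word_v : ∀ i < 90, S.v i < 2 ^ w
  word_a : ∀ t < 16, ∀ i, (t < 3 → i < m) → S.a t i < 2 ^ w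

/-- Expressions over variables and arrays. -/
inductive Expr : Type
  | var : ℕ → Expr
  | lit : ℕ → Expr
  | add : Expr → Expr → Expr
  | sub : Expr → Expr → Expr
  | mul : Expr → Expr → Expr
  | div : Expr → Expr → Expr
  | get : ℕ → Expr → Expr

/-- The value of an expression. -/
@[simp] def Expr.eval (S : HState) : Expr → ℕ
  | .var i => S.v i
  | .lit c => c
  | .add e f => e.eval S + f.eval S
  | .sub e f => e.eval S - f.eval S
  | .mul e f => e.eval S * f.eval S
  | .div e f => e.eval S / f.eval S
  | .get t e => S.a t (e.eval S)

/-- The evaluation of the expression does not overflow. -/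
@[simp] def Expr.ok (w m : ℕ) (S : HState) : Expr → Prop
  | .var i => i < 90
  | .lit c => c < 2 ^ w
  | .add e f => e.ok w m S ∧ f.ok w m S ∧ e.eval S + f.eval S < 2 ^ w
  | .sub e f => e.ok w m S ∧ f.ok w m S
  | .mul e f => e.ok w m S ∧ f.ok w m S ∧ e.eval S * f.eval S < 2 ^ w
  | .div e f => e.ok w m S ∧ f.ok w m S
  | .get t e => e.ok w m S ∧ t < 16 ∧ (t < 3 → e.eval S < m) ∧ addr m t (e.eval S) < 2 ^ w

theorem Expr.eval_lt {w m : ℕ} {σ : Store} {S : HState} (hR : Repr w m σ S) :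
    ∀ {e : Expr}, e.ok w m S → e.eval S < 2 ^ w
  | .var i, h => hR.word_v i h
  | .lit _, h => h
  | .add _ _, h => h.2.2
  | .sub e _, h => (Nat.sub_le _ _).trans_lt (Expr.eval_lt hR (e := e) h.1)
  | .mul _ _, h => h.2.2
  | .div e _, h => (Nat.div_le_self _ _).trans_lt (Expr.eval_lt hR (e := e) h.1)
  | .get t _, h => hR.word_a t h.2.1 _ h.2.2.1

/-- Replaces the index in register `d` by the address of that entry of array `t`. -/
def compAddr (t d : ℕ) : Program :=
  if t = 0 then .seq (.const (d + 1) 2) (.mul d d (d + 1))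
  else if t = 1 then
    .seq (.const (d + 1) 2) (.seq (.mul d d (d + 1)) (.seq (.const (d + 1) 1) (.add d d (d + 1))))
  else if t = 2 then .add d d 93
  else .seq (.const (d + 1) 16) (.seq (.mul d d (d + 1)) (.seq (.const (d + 1) t)
    (.seq (.add d d (d + 1)) (.add d d 92))))

/-- Code that evaluates an expression into register `d`, with the registers above `d` as scratch
space. -/
def Expr.comp : Expr → ℕ → Program
  | .var i, d => .add d i 91
  | .lit c, d => .const d c
  | .add e f, d => .seq (e.comp d) (.seq (f.comp (d + 1)) (.add d d (d + 1)))
  | .sub e f, d => .seq (e.comp d) (.seq (f.comp (d + 1)) (.sub d d (d + 1)))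
  | .mul e f, d => .seq (e.comp d) (.seq (f.comp (d + 1)) (.mul d d (d + 1)))
  | .div e f, d => .seq (e.comp d) (.seq (f.comp (d + 1)) (.div d d (d + 1)))
  | .get t e, d => .seq (e.comp d) (.seq (compAddr t d) (.load d d))

/-- `P` puts `y` into register `d` and changes no register below `d` and no memory cell. -/
def Computes (w : ℕ) (P : Program) (d : ℕ) (σ : Store) (y : ℕ) : Prop :=
  ∃ σ', Leads w P P.size σ σ' ∧ σ'.reg d = y ∧ σ'.mem = σ.mem ∧ ∀ i < d, σ'.reg i = σ.reg i

theorem Repr.of_scratch {w m : ℕ} {σ σ' : Store} {S : HState} (hR : Repr w m σ S) {d : ℕ}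
    (hd : 100 ≤ d) (hm : σ'.mem = σ.mem) (hr : ∀ i < d, σ'.reg i = σ.reg i) : Repr w m σ' S where
  reg i hi := by rw [hr i (by omega), hR.reg i hi]
  zero := by rw [hr _ (by omega), hR.zero]
  base := by rw [hr _ (by omega), hR.base]
  out := by rw [hr _ (by omega), hR.out]
  mem := by rw [hm]; exact hR.mem
  word_v := hR.word_v
  word_a := hR.word_a

theorem compAddr_computes {w m : ℕ} {σ : Store} {S : HState} (hR : Repr w m σ S)
    {t d i : ℕ} (hd : 100 ≤ d) (hi : σ.reg d = i) (ha : addr m t i < 2 ^ w) :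
    Computes w (compAddr t d) d σ (addr m t i) := by
  have h0 := hR.out
  have h1 := hR.base
  unfold compAddr
  unfold addr at ha ⊢
  split_ifs at ha ⊢ with c0 c1 c2
  · refine ⟨_, Leads.seq (Leads.of_step fun k => rfl) (Leads.of_step fun k => rfl), ?_, rfl, ?_⟩
    · simp [Store.setReg, hi]
      rw [mul_comm, Nat.mod_eq_of_lt ha]
    · intro j hj
      simp [Store.setReg, show j ≠ d by omega, show j ≠ d + 1 by omega]
  · refine ⟨_, Leads.seq (Leads.of_step fun k => rfl) (Leads.seq (Leads.of_step fun k => rfl)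
      (Leads.seq (Leads.of_step fun k => rfl) (Leads.of_step fun k => rfl))), ?_, rfl, ?_⟩
    · simp [Store.setReg, hi]
      rw [mul_comm, Nat.mod_eq_of_lt ha]
    · intro j hj
      simp [Store.setReg, show j ≠ d by omega, show j ≠ d + 1 by omega]
  · refine ⟨_, Leads.of_step fun k => rfl, ?_, rfl, ?_⟩
    · simp [Store.setReg, hi, h0]
      rw [add_comm, Nat.mod_eq_of_lt ha]
    · intro j hj
      simp [Store.setReg, show j ≠ d by omega]
  · refine ⟨_, Leads.seq (Leads.of_step fun k => rfl) (Leads.seq (Leads.of_step fun k => rfl)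
      (Leads.seq (Leads.of_step fun k => rfl) (Leads.seq (Leads.of_step fun k => rfl)
      (Leads.of_step fun k => rfl)))), ?_, rfl, ?_⟩
    · have e1 : 92 ≠ d := by omega
      have e2 : 92 ≠ d + 1 := by omega
      simp [Store.setReg, hi, h1, Function.update_of_ne e1, Function.update_of_ne e2]
      rw [show i * 16 + t + 3 * m = 3 * m + 16 * i + t by ring, Nat.mod_eq_of_lt ha]
    · intro j hj
      simp [Store.setReg, show j ≠ d by omega, show j ≠ d + 1 by omega]

theorem computes_binop {w : ℕ} {P Q : Program} {d : ℕ} {σ : Store} {y z : ℕ} {op : Program}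
    {f : ℕ → ℕ → ℕ}
    (hP : Computes w P d σ y)
    (hQ : ∀ σ', σ'.mem = σ.mem → (∀ i < d, σ'.reg i = σ.reg i) → Computes w Q (d + 1) σ' z)
    (hop : ∀ σ k, step w ⟨op :: k, σ⟩ =
      PMF.pure ⟨k, σ.setReg w d (f (σ.reg d) (σ.reg (d + 1)))⟩)
    (hs : op.size = 1) (hlt : f y z < 2 ^ w) :
    Computes w (.seq P (.seq Q op)) d σ (f y z) := by
  obtain ⟨σ₁, h₁, hy, hm₁, hr₁⟩ := hP
  obtain ⟨σ₂, h₂, hz, hm₂, hr₂⟩ := hQ σ₁ hm₁ hr₁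
  have hl : Leads w op op.size σ₂ (σ₂.setReg w d (f (σ₂.reg d) (σ₂.reg (d + 1)))) := by
    rw [hs]; exact Leads.of_step fun k => hop _ _
  refine ⟨_, h₁.seq (h₂.seq hl), ?_, ?_, ?_⟩
  · simp [Store.setReg, hr₂ d (by omega), hy, hz, Nat.mod_eq_of_lt hlt]
  · simp [Store.setReg, hm₁, hm₂]
  · intro i hi
    simp [Store.setReg, hi.ne, hr₂ i (by omega), hr₁ i hi]

theorem Expr.comp_computes {w m : ℕ} (hw : 16 < 2 ^ w) {S : HState} :
    ∀ (e : Expr) {σ : Store} (_ : Repr w m σ S) (_ : e.ok w m S) (d : ℕ) (_ : 100 ≤ d),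
      Computes w (e.comp d) d σ (e.eval S)
  | .var i, σ, hR, h, d, hd => by
    refine ⟨_, Leads.of_step fun k => rfl, ?_, rfl, ?_⟩
    · simp [Store.setReg, hR.zero, hR.reg i h, Nat.mod_eq_of_lt (hR.word_v i h)]
    · intro j hj
      simp [Store.setReg, hj.ne]
  | .lit c, σ, hR, h, d, hd => by
    refine ⟨_, Leads.of_step fun k => rfl, ?_, rfl, ?_⟩
    · simp [Store.setReg, Nat.mod_eq_of_lt (show c < 2 ^ w from h)]
    · intro j hj
      simp [Store.setReg, hj.ne]
  | .add e f, σ, hR, h, d, hd =>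
    computes_binop (f := fun y z => y + z) (comp_computes hw e hR h.1 d hd)
      (fun _ hm hr => comp_computes hw f (hR.of_scratch hd hm hr) h.2.1 _ (by omega))
      (fun _ _ => rfl) rfl h.2.2
  | .sub e f, σ, hR, h, d, hd =>
    computes_binop (f := fun y z => y - z) (comp_computes hw e hR h.1 d hd)
      (fun _ hm hr => comp_computes hw f (hR.of_scratch hd hm hr) h.2 _ (by omega))
      (fun _ _ => rfl) rfl (Expr.eval_lt hR (e := .sub e f) h)
  | .mul e f, σ, hR, h, d, hd =>
    computes_binop (f := fun y z => y * z) (comp_computes hw e hR h.1 d hd)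
      (fun _ hm hr => comp_computes hw f (hR.of_scratch hd hm hr) h.2.1 _ (by omega))
      (fun _ _ => rfl) rfl h.2.2
  | .div e f, σ, hR, h, d, hd =>
    computes_binop (f := fun y z => y / z) (comp_computes hw e hR h.1 d hd)
      (fun _ hm hr => comp_computes hw f (hR.of_scratch hd hm hr) h.2 _ (by omega))
      (fun _ _ => rfl) rfl (Expr.eval_lt hR (e := .div e f) h)
  | .get t e, σ, hR, h, d, hd => by
    obtain ⟨σ₁, h₁, hy, hm₁, hr₁⟩ := comp_computes hw e hR h.1 d hd
    obtain ⟨σ₂, h₂, hz, hm₂, hr₂⟩ := compAddr_computes (hR.of_scratch hd hm₁ hr₁) hd hy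
      h.2.2.2
    refine ⟨_, h₁.seq (h₂.seq (Leads.of_step fun k => rfl)), ?_, ?_, ?_⟩
    · have := hR.mem t h.2.1 _ h.2.2.1
      simp [Store.setReg, hz, hm₂, hm₁, this,
        Nat.mod_eq_of_lt (hR.word_a t h.2.1 _ h.2.2.1)]
    · simp [Store.setReg, hm₁, hm₂]
    · intro i hi
      simp [Store.setReg, hi.ne, hr₂ i hi, hr₁ i hi]

/-! ### Statements and their rules -/

/-- `x := e` -/
def assign (x : ℕ) (e : Expr) : Program := .seq (e.comp 100) (.add x 100 91)

/-- `a t [e] := f` -/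
def write (t : ℕ) (e f : Expr) : Program :=
  .seq (e.comp 100) (.seq (compAddr t 100) (.seq (f.comp 101) (.store 100 101)))

/-- `if e ≠ 0 then P else Q` -/
def ifE (e : Expr) (P Q : Program) : Program := .seq (e.comp 100) (.ifNonzero 100 P Q)

/-- `while e ≠ 0 do P` -/
def whileE (e : Expr) (P : Program) : Program :=
  .seq (e.comp 100) (.whileNonzero 100 (.seq P (e.comp 100)))

/-- `x :=` a uniformly random number below `e` -/
def randE (x : ℕ) (e : Expr) : Program := .seq (e.comp 100) (.rand x 100)

/-- Started in a store that represents `S`, the program `P` surely reaches, within `t` steps, a store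
that represents a state with property `Q`, the same state for all such stores. -/
def Det (w m : ℕ) (P : Program) (t : ℕ) (S : HState) (Q : HState → Prop) : Prop :=
  ∃ S', Q S' ∧ ∀ σ, Repr w m σ S → ∃ σ', Repr w m σ' S' ∧ Leads w P t σ σ'

/-- Started in a store that represents `S`, the program `P` takes at most `t` steps, and the expected
value of `h` at its final state is at most `x`. -/
def Expect (w m : ℕ) (P : Program) (t : ℕ) (S : HState) (h : HState → ℝ≥0∞) (x : ℝ≥0∞) : Prop :=
  ∀ F k t', (∀ S' σ', Repr w m σ' S' → risk w F t' ⟨k, σ'⟩ ≤ h S') →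
    ∀ σ, Repr w m σ S → risk w F (t + t') ⟨P :: k, σ⟩ ≤ x

theorem Repr.setReg {w m : ℕ} {σ : Store} {S : HState} (hR : Repr w m σ S) {x y : ℕ} (hx : x < 90)
    (hy : y < 2 ^ w) : Repr w m (σ.setReg w x y) (S.setV x y) where
  reg i hi := by
    simp only [Store.setReg, HState.setV_v, Function.update_apply, hR.reg i hi, Nat.mod_eq_of_lt hy]
  zero := by simp [Store.setReg, hR.zero, show 91 ≠ x by omega]
  base := by simp [Store.setReg, hR.base, show 92 ≠ x by omega]
  out := by simp [Store.setReg, hR.out, show 93 ≠ x by omega]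
  mem := hR.mem
  word_v i hi := by
    rw [HState.setV_v]
    split_ifs
    exacts [hy, hR.word_v i hi]
  word_a := hR.word_a

theorem Repr.setMem {w m : ℕ} {σ : Store} {S : HState} (hR : Repr w m σ S) {t i y : ℕ} (ht : t < 16)
    (hi : t < 3 → i < m) (hy : y < 2 ^ w) :
    Repr w m (σ.setMem w (addr m t i) y) (S.setA t i y) where
  reg := hR.reg
  zero := hR.zero
  base := hR.base
  out := hR.out
  mem t' ht' i' hi' := by
    simp only [Store.setMem, Function.update_apply, HState.setA_a]
    by_cases h : t' = t
    · subst h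
      by_cases hii : i' = i
      · subst hii; simp [Nat.mod_eq_of_lt hy]
      · rw [if_neg fun hc => hii (addr_inj ht' ht hi' hi hc).2, if_pos rfl,
          Function.update_of_ne hii, hR.mem _ ht' _ hi']
    · rw [if_neg fun hc => h (addr_inj ht' ht hi' hi hc).1, if_neg h, hR.mem _ ht' _ hi']
  word_v := hR.word_v
  word_a t' ht' i' hi' := by
    rw [HState.setA_a]
    split_ifs with h
    · subst h
      rw [Function.update_apply]
      split_ifs
      exacts [hy, hR.word_a _ ht' _ hi']
    · exact hR.word_a _ ht' _ hi'

section rules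

variable {w m : ℕ}

theorem Det.mono {P : Program} {t t' : ℕ} {S : HState} {Q Q' : HState → Prop}
    (h : Det w m P t S Q) (ht : t ≤ t') (hQ : ∀ S', Q S' → Q' S') : Det w m P t' S Q' := by
  obtain ⟨S', h', H⟩ := h
  refine ⟨S', hQ _ h', fun σ hσ => ?_⟩
  obtain ⟨σ', hσ', hl⟩ := H σ hσ
  exact ⟨σ', hσ', hl.mono ht⟩

theorem Det.skip {S : HState} {Q : HState → Prop} (h : Q S) : Det w m .skip 1 S Q :=
  ⟨S, h, fun σ hσ => ⟨σ, hσ, Leads.of_step fun _ => rfl⟩⟩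

theorem Det.seq {P P' : Program} {t t' : ℕ} {S : HState} {Q Q' : HState → Prop}
    (h : Det w m P t S Q) (h' : ∀ S', Q S' → Det w m P' t' S' Q') :
    Det w m (.seq P P') (t + t' + 1) S Q' := by
  obtain ⟨S₁, h₁, H₁⟩ := h
  obtain ⟨S₂, h₂, H₂⟩ := h' S₁ h₁
  refine ⟨S₂, h₂, fun σ hσ => ?_⟩
  obtain ⟨σ₁, hσ₁, hl₁⟩ := H₁ σ hσ
  obtain ⟨σ₂, hσ₂, hl₂⟩ := H₂ σ₁ hσ₁
  exact ⟨σ₂, hσ₂, hl₁.seq hl₂⟩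

theorem Repr.eval {σ : Store} {S : HState} (hR : Repr w m σ S) (hw : 16 < 2 ^ w) {e : Expr}
    (he : e.ok w m S) : ∃ σ', Repr w m σ' S ∧ Leads w (e.comp 100) (e.comp 100).size σ σ' ∧
      σ'.reg 100 = e.eval S := by
  obtain ⟨σ', hl, hy, hm, hr⟩ := e.comp_computes hw hR he 100 le_rfl
  exact ⟨σ', hR.of_scratch le_rfl hm hr, hl, hy⟩

theorem Det.of_assign (hw : 16 < 2 ^ w) {x : ℕ} {e : Expr} {S : HState} {Q : HState → Prop}
    (hx : x < 90) (he : e.ok w m S) (h : Q (S.setV x (e.eval S))) :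
    Det w m (assign x e) (assign x e).size S Q := by
  refine ⟨_, h, fun σ hσ => ?_⟩
  obtain ⟨σ₁, h₁, hl, hy⟩ := hσ.eval hw he
  refine ⟨_, h₁.setReg hx (Expr.eval_lt hσ he), hl.seq (Leads.of_step fun k => ?_)⟩
  simp [step, hy, h₁.zero]

theorem Det.of_write (hw : 16 < 2 ^ w) {t : ℕ} {e f : Expr} {S : HState} {Q : HState → Prop}
    (he : (Expr.get t e).ok w m S) (hf : f.ok w m S) (h : Q (S.setA t (e.eval S) (f.eval S))) :
    Det w m (write t e f) (write t e f).size S Q := by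
  refine ⟨_, h, fun σ hσ => ?_⟩
  obtain ⟨σ₁, hl₁, hy₁, hm₁, hr₁⟩ := e.comp_computes hw hσ he.1 100 le_rfl
  have h₁ := hσ.of_scratch le_rfl hm₁ hr₁
  obtain ⟨σ₂, hl₂, hy₂, hm₂, hr₂⟩ := compAddr_computes h₁ (t := t) le_rfl hy₁ he.2.2.2
  have h₂ := h₁.of_scratch le_rfl hm₂ hr₂
  obtain ⟨σ₃, hl₃, hy₃, hm₃, hr₃⟩ := f.comp_computes hw h₂ hf 101 (by omega)
  have h₃ := h₂.of_scratch (d := 101) (by omega) hm₃ hr₃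
  refine ⟨_, h₃.setMem he.2.1 he.2.2.1 (Expr.eval_lt hσ hf),
    hl₁.seq (hl₂.seq (hl₃.seq (Leads.of_step fun k => ?_)))⟩
  simp [step, hy₃, hr₃ 100 (by omega), hy₂]

theorem Leads.ite {P Q : Program} {t : ℕ} {σ σ' : Store} {x : ℕ}
    (h : Leads w (if σ.reg x ≠ 0 then P else Q) t σ σ') :
    Leads w (.ifNonzero x P Q) (t + 1) σ σ' := by
  intro F k t'
  rw [show t + 1 + t' = t + t' + 1 by ring, risk_succ_of_pure (s' := ⟨_ :: k, σ⟩) rfl]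
  exact h F k t'

theorem Det.of_ifE (hw : 16 < 2 ^ w) {e : Expr} {P P' : Program} {t : ℕ} {S : HState}
    {Q : HState → Prop} (he : e.ok w m S) (h : e.eval S ≠ 0 → Det w m P t S Q)
    (h' : e.eval S = 0 → Det w m P' t S Q) :
    Det w m (ifE e P P') ((e.comp 100).size + t + 2) S Q := by
  by_cases hc : e.eval S = 0
  · obtain ⟨S', hS', H⟩ := h' hc
    refine ⟨S', hS', fun σ hσ => ?_⟩
    obtain ⟨σ₁, h₁, hl, hy⟩ := hσ.eval hw he
    obtain ⟨σ₂, h₂, hl₂⟩ := H σ₁ h₁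
    refine ⟨σ₂, h₂, hl.seq (Leads.ite ?_)⟩
    rwa [hy, if_neg (by simpa using hc)]
  · obtain ⟨S', hS', H⟩ := h hc
    refine ⟨S', hS', fun σ hσ => ?_⟩
    obtain ⟨σ₁, h₁, hl, hy⟩ := hσ.eval hw he
    obtain ⟨σ₂, h₂, hl₂⟩ := H σ₁ h₁
    refine ⟨σ₂, h₂, hl.seq (Leads.ite ?_)⟩
    rwa [hy, if_pos hc]

/-- The conditional, for loop-free branches. -/
theorem Det.of_ifE_size (hw : 16 < 2 ^ w) {e : Expr} {P P' : Program} {S : HState}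
    {Q : HState → Prop} (he : e.ok w m S) (h : e.eval S ≠ 0 → Det w m P P.size S Q)
    (h' : e.eval S = 0 → Det w m P' P'.size S Q) :
    Det w m (ifE e P P') (ifE e P P').size S Q := by
  refine (Det.of_ifE hw he (t := P.size + P'.size) (fun c => (h c).mono (by omega) fun _ => id)
    (fun c => (h' c).mono (by omega) fun _ => id)).mono ?_ fun _ => id
  simp only [ifE, Program.size]
  omega

/-- A bound for the time of a loop with at most `k` rounds of time at most `t` each. -/
def loopTime (e : Expr) (t k : ℕ) : ℕ :=
  (k + 1) * (t + (e.comp 100).size + 2) + ((e.comp 100).size + 1)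

theorem Det.of_whileE (hw : 16 < 2 ^ w) {e : Expr} {P : Program} {t : ℕ} (I : HState → Prop)
    (μ : HState → ℕ) (he : ∀ S, I S → e.ok w m S)
    (hP : ∀ S, I S → e.eval S ≠ 0 → Det w m P t S fun S' => I S' ∧ μ S' < μ S) {S : HState}
    (hS : I S) {Q : HState → Prop} (hQ : ∀ S', I S' → e.eval S' = 0 → Q S') :
    Det w m (whileE e P) (loopTime e t (μ S)) S Q := by
  have key : ∀ N S, I S → μ S ≤ N → ∃ S', Q S' ∧ ∀ σ, Repr w m σ S → σ.reg 100 = e.eval S →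
      ∃ σ', Repr w m σ' S' ∧ Leads w (.whileNonzero 100 (.seq P (e.comp 100)))
        (N * (t + (e.comp 100).size + 2) + 1) σ σ' := by
    have halt : ∀ N S, I S → e.eval S = 0 → ∃ S', Q S' ∧ ∀ σ, Repr w m σ S →
        σ.reg 100 = e.eval S →
        ∃ σ', Repr w m σ' S' ∧ Leads w (.whileNonzero 100 (.seq P (e.comp 100)))
          (N * (t + (e.comp 100).size + 2) + 1) σ σ' := by
      intro N S hI h0
      refine ⟨S, hQ S hI h0, fun σ hσ hr => ⟨σ, hσ, ?_⟩⟩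
      refine Leads.mono (t₁ := 1) (Leads.of_step fun k => ?_) (by omega)
      simp [step, hr, h0]
    intro N
    induction N with
    | zero =>
      intro S hI hN
      by_cases h0 : e.eval S = 0
      · exact halt _ S hI h0
      · obtain ⟨S', ⟨-, h⟩, -⟩ := hP S hI h0
        omega
    | succ N ih =>
      intro S hI hN
      by_cases h0 : e.eval S = 0
      · exact halt _ S hI h0
      · obtain ⟨S₁, ⟨hI₁, hμ⟩, H₁⟩ := hP S hI h0
        obtain ⟨S₂, hQ₂, H₂⟩ := ih S₁ hI₁ (by omega)
        refine ⟨S₂, hQ₂, fun σ hσ hr => ?_⟩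
        obtain ⟨σ₁, hσ₁, hl₁⟩ := H₁ σ hσ
        obtain ⟨σ₂, hσ₂, hl₂, hr₂⟩ := hσ₁.eval hw (he _ hI₁)
        obtain ⟨σ₃, hσ₃, hl₃⟩ := H₂ σ₂ hσ₂ hr₂
        refine ⟨σ₃, hσ₃, fun F k t' => ?_⟩
        rw [show (N + 1) * (t + (e.comp 100).size + 2) + 1 + t' = (t + (e.comp 100).size + 1) +
          ((N * (t + (e.comp 100).size + 2) + 1) + t') + 1 by ring,
          risk_succ_of_pure (s' := ⟨.seq P (e.comp 100) ::
            .whileNonzero 100 (.seq P (e.comp 100)) :: k, σ⟩) (by simp [step, hr, h0])]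
        exact ((hl₁.seq hl₂) F _ _).trans (hl₃ F _ _)
  obtain ⟨S', hQ', H⟩ := key (μ S) S hS le_rfl
  refine ⟨S', hQ', fun σ hσ => ?_⟩
  obtain ⟨σ₁, h₁, hl, hy⟩ := hσ.eval hw (he S hS)
  obtain ⟨σ₂, h₂, hl₂⟩ := H σ₁ h₁ hy
  refine ⟨σ₂, h₂, (hl.seq hl₂).mono ?_⟩
  unfold loopTime
  rw [add_mul]
  omega

theorem Expect.mono {P : Program} {t t' : ℕ} {S : HState} {h h' : HState → ℝ≥0∞} {x x' : ℝ≥0∞}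
    (H : Expect w m P t S h x) (ht : t ≤ t') (hh : ∀ S', h' S' ≤ h S') (hx : x ≤ x') :
    Expect w m P t' S h' x' := fun F k t₀ h₀ σ hσ =>
  (risk_anti (by omega) _).trans
    ((H F k t₀ (fun S' σ' hσ' => (h₀ S' σ' hσ').trans (hh S')) σ hσ).trans hx)

theorem Expect.seq {P P' : Program} {t t' : ℕ} {S : HState} {h h' : HState → ℝ≥0∞} {x : ℝ≥0∞}
    (H : Expect w m P t S h x) (H' : ∀ S', h S' ≠ ⊤ → Expect w m P' t' S' h' (h S')) :
    Expect w m (.seq P P') (t + t' + 1) S h' x := by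
  intro F k t₀ h₀ σ hσ
  rw [show t + t' + 1 + t₀ = t + (t' + t₀) + 1 by ring,
    risk_succ_of_pure (s' := ⟨P :: P' :: k, σ⟩) rfl]
  refine H F (P' :: k) (t' + t₀) (fun S' σ' hσ' => ?_) σ hσ
  by_cases hc : h S' = ⊤
  · rw [hc]; exact le_top
  · exact H' S' hc F k t₀ h₀ σ' hσ'

theorem Det.expect {P : Program} {t : ℕ} {S : HState} {Q : HState → Prop} {h : HState → ℝ≥0∞}
    {x : ℝ≥0∞} (H : Det w m P t S Q) (hx : ∀ S', Q S' → h S' ≤ x) : Expect w m P t S h x := by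
  obtain ⟨S', hQ, H⟩ := H
  intro F k t₀ h₀ σ hσ
  obtain ⟨σ', hσ', hl⟩ := H σ hσ
  exact (hl F k t₀).trans ((h₀ S' σ' hσ').trans (hx S' hQ))

theorem Det.seq_expect {P P' : Program} {t t' : ℕ} {S : HState} {Q : HState → Prop}
    {h : HState → ℝ≥0∞} {x : ℝ≥0∞}
    (H : Det w m P t S Q) (H' : ∀ S', Q S' → Expect w m P' t' S' h x) :
    Expect w m (.seq P P') (t + t' + 1) S h x := by
  classical
  refine Expect.seq (h := fun S' => if Q S' then x else ⊤) (H.expect fun S' hS' => by simp [hS'])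
    fun S' hS' => ?_
  have : Q S' := by by_contra hc; simp [hc] at hS'
  simpa [this] using H' S' this

theorem Expect.of_ifE (hw : 16 < 2 ^ w) {e : Expr} {P P' : Program} {t : ℕ} {S : HState}
    {h : HState → ℝ≥0∞} {x : ℝ≥0∞} (he : e.ok w m S) (H : e.eval S ≠ 0 → Expect w m P t S h x)
    (H' : e.eval S = 0 → Expect w m P' t S h x) :
    Expect w m (ifE e P P') ((e.comp 100).size + t + 2) S h x := by
  intro F k t₀ h₀ σ hσ
  obtain ⟨σ₁, h₁, hl, hy⟩ := hσ.eval hw he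
  rw [show (e.comp 100).size + t + 2 + t₀ = (e.comp 100).size + (t + t₀ + 1) + 1 by ring,
    ifE, risk_succ_of_pure (s' := ⟨e.comp 100 :: .ifNonzero 100 P P' :: k, σ⟩) rfl]
  refine (hl F _ _).trans ?_
  rw [risk_succ_of_pure (s' := ⟨_ :: k, σ₁⟩) rfl, hy]
  split_ifs with hc
  · exact H hc F k t₀ h₀ σ₁ h₁
  · exact H' (by simpa using hc) F k t₀ h₀ σ₁ h₁

theorem Expect.of_randE (hw : 16 < 2 ^ w) {e : Expr} {x : ℕ} {S : HState} {h : HState → ℝ≥0∞}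
    (hx : x < 90) (he : e.ok w m S) (hpos : 0 < e.eval S) :
    Expect w m (randE x e) (randE x e).size S h
      ((∑ y ∈ Finset.range (e.eval S), h (S.setV x y)) / (e.eval S : ℝ≥0∞)) := by
  intro F k t₀ h₀ σ hσ
  obtain ⟨σ₁, h₁, hl, hy⟩ := hσ.eval hw he
  have hlt := Expr.eval_lt hσ he
  rw [show (randE x e).size + t₀ = (e.comp 100).size + (t₀ + 1) + 1 by
    simp only [randE, Program.size]; ring,
    randE, risk_succ_of_pure (s' := ⟨e.comp 100 :: .rand x 100 :: k, σ⟩) rfl]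
  refine (hl F _ _).trans ?_
  rw [risk_succ]
  have hstep : step w ⟨.rand x 100 :: k, σ₁⟩ =
      (uniformBelow (e.eval S)).bind fun v => PMF.pure ⟨k, σ₁.setReg w x v⟩ := by
    rw [step, hy]; rfl
  rw [hstep, tsum_bind_mul, uniformBelow, dif_pos hpos]
  simp only [tsum_pure_mul, PMF.uniformOfFinset_apply]
  rw [tsum_eq_sum (s := Finset.range (e.eval S)) (by intro y hy; simp [hy]), div_eq_mul_inv,
    Finset.sum_mul]
  refine Finset.sum_le_sum fun y hy' => ?_
  rw [if_pos hy', mul_comm, Finset.card_range]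
  exact mul_le_mul_left (h₀ _ _ (h₁.setReg hx ((Finset.mem_range.1 hy').trans hlt))) _

/-- The rule for loops: the potential `g` does not increase in expectation. -/
theorem Expect.of_whileE (hw : 16 < 2 ^ w) {e : Expr} {P : Program} {t : ℕ} (I : HState → Prop)
    (μ : HState → ℕ) (g : HState → ℝ≥0∞) (he : ∀ S, I S → e.ok w m S)
    (hP : ∀ S, I S → e.eval S ≠ 0 → ∀ h : HState → ℝ≥0∞,
      (∀ S', I S' → μ S' < μ S → h S' ≤ g S') → Expect w m P t S h (g S))
    {S : HState} (hS : I S) {h : HState → ℝ≥0∞}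
    (hQ : ∀ S', I S' → e.eval S' = 0 → h S' ≤ g S') :
    Expect w m (whileE e P) (loopTime e t (μ S)) S h (g S) := by
  classical
  intro F k t₀ h₀ σ hσ
  have key : ∀ N S, I S → μ S < N → ∀ σ, Repr w m σ S → σ.reg 100 = e.eval S →
      risk w F (N * (t + (e.comp 100).size + 2) + t₀)
        ⟨.whileNonzero 100 (.seq P (e.comp 100)) :: k, σ⟩ ≤ g S := by
    intro N
    induction N with
    | zero => intro S _ hN; omega
    | succ N ih =>
      intro S hI hN σ hσ hr
      by_cases h0 : e.eval S = 0
      · refine (risk_anti (t := 1 + t₀) (by rw [add_mul]; omega) _).trans ?_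
        refine (Leads.of_step (σ' := σ) (fun k => ?_) F k t₀).trans
          ((h₀ S σ hσ).trans (hQ S hI h0))
        simp [step, hr, h0]
      · rw [show (N + 1) * (t + (e.comp 100).size + 2) + t₀ = (t + ((e.comp 100).size +
          (N * (t + (e.comp 100).size + 2) + t₀)) + 1) + 1 by ring,
          risk_succ_of_pure (s' := ⟨.seq P (e.comp 100) ::
            .whileNonzero 100 (.seq P (e.comp 100)) :: k, σ⟩) (by simp [step, hr, h0]),
          risk_succ_of_pure (s' := ⟨P :: e.comp 100 ::
            .whileNonzero 100 (.seq P (e.comp 100)) :: k, σ⟩) rfl]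
        refine hP S hI h0 (fun S' => if I S' ∧ μ S' < μ S then g S' else ⊤)
          (fun S' h1 h2 => by rw [if_pos ⟨h1, h2⟩]) F _ _ (fun S' σ' hσ' => ?_) σ hσ
        by_cases hc : I S' ∧ μ S' < μ S
        · simp only [if_pos hc]
          obtain ⟨σ₂, hσ₂, hl₂, hr₂⟩ := hσ'.eval hw (he _ hc.1)
          exact (hl₂ F _ _).trans (ih S' hc.1 (by omega) σ₂ hσ₂ hr₂)
        · simp only [if_neg hc]
          exact le_top
  obtain ⟨σ₁, h₁, hl, hy⟩ := hσ.eval hw (he S hS)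
  unfold loopTime whileE
  refine (risk_anti (t := ((e.comp 100).size +
    ((μ S + 1) * (t + (e.comp 100).size + 2) + t₀)) + 1) ?_ _).trans ?_
  · omega
  rw [risk_succ_of_pure (s' := ⟨e.comp 100 :: .whileNonzero 100 (.seq P (e.comp 100)) :: k, σ⟩) rfl]
  exact (hl F _ _).trans (key _ S hS (by omega) σ₁ h₁ hy)

end rules

end WordRAM

/-! ### Partial edge colorings of an edge list -/

/-- A simple graph on `{0, …, n - 1}`, given by the list of its edges `{U i, V i}`, `i < m`. -/
structure EdgeList where
  n : ℕ
  m : ℕ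
  U : ℕ → ℕ
  V : ℕ → ℕ
  U_lt : ∀ i < m, U i < n
  V_lt : ∀ i < m, V i < n
  loopless : ∀ i < m, U i ≠ V i
  simple : ∀ i < m, ∀ j < m, (U i = U j ∧ V i = V j) ∨ (U i = V j ∧ V i = U j) → i = j

namespace EdgeList

open Function

variable (E : EdgeList)

/-- Edge `i` is incident to `v`. -/
def Inc (i v : ℕ) : Prop := E.U i = v ∨ E.V i = v

instance (i v : ℕ) : Decidable (E.Inc i v) := inferInstanceAs (Decidable (_ ∨ _))

/-- The endpoint of edge `i` other than `v`. -/
def other (i v : ℕ) : ℕ := E.U i + E.V i - v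

/-- Color `0` means uncolored; edges of the same nonzero color do not meet. -/
def Proper (col : ℕ → ℕ) : Prop :=
  ∀ i < E.m, ∀ j < E.m, ∀ v, E.Inc i v → E.Inc j v → col i = col j → col i ≠ 0 → i = j

open Classical in
/-- `i + 1` for the edge `i` at `v` of color `c`, and `0` if `c` is missing at `v`. -/
noncomputable def nbr (col : ℕ → ℕ) (v c : ℕ) : ℕ :=
  if h : ∃ i, i < E.m ∧ E.Inc i v ∧ col i = c then Nat.find h + 1 else 0

variable {E}

theorem Inc.other {i v : ℕ} (h : E.Inc i v) : E.Inc i (E.other i v) := by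
  unfold Inc EdgeList.other at *; omega

theorem other_other {i v : ℕ} (h : E.Inc i v) : E.other i (E.other i v) = v := by
  unfold Inc EdgeList.other at *; omega

theorem Inc.lt {i v : ℕ} (hi : i < E.m) (h : E.Inc i v) : v < E.n := by
  rcases h with h | h
  · exact h ▸ E.U_lt i hi
  · exact h ▸ E.V_lt i hi

theorem other_ne {i v : ℕ} (hi : i < E.m) (h : E.Inc i v) : E.other i v ≠ v := by
  have := E.loopless i hi
  unfold Inc EdgeList.other at *; omega

theorem Inc.eq_or_eq_other {i v z : ℕ} (h : E.Inc i v) (hz : E.Inc i z) :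
    z = v ∨ z = E.other i v := by
  unfold Inc EdgeList.other at *; omega

theorem eq_of_inc {i j v z : ℕ} (hi : i < E.m) (hj : j < E.m) (hvz : v ≠ z) (h₁ : E.Inc i v)
    (h₂ : E.Inc i z) (h₃ : E.Inc j v) (h₄ : E.Inc j z) : i = j := by
  apply E.simple i hi j hj
  unfold Inc at *; omega

theorem nbr_eq_zero {col : ℕ → ℕ} {v c : ℕ} :
    E.nbr col v c = 0 ↔ ∀ i < E.m, E.Inc i v → col i ≠ c := by
  unfold nbr
  split_ifs with h
  · obtain ⟨i, h1, h2, h3⟩ := h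
    simp only [false_iff]
    push Not
    exact ⟨i, h1, h2, h3⟩
  · push Not at h
    simpa using h

theorem nbr_eq_succ {col : ℕ → ℕ} (hp : E.Proper col) {v c i : ℕ} (hc : c ≠ 0) :
    E.nbr col v c = i + 1 ↔ i < E.m ∧ E.Inc i v ∧ col i = c := by
  classical
  unfold nbr
  split_ifs with h
  · have hs := Nat.find_spec h
    constructor
    · intro hi
      have : Nat.find h = i := by omega
      rwa [← this]
    · rintro ⟨h1, h2, h3⟩
      rw [hp _ hs.1 i h1 v hs.2.1 h2 (hs.2.2.trans h3.symm)
        (by rw [hs.2.2]; exact hc)]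
  · constructor
    · intro hi; exact (nomatch hi)
    · intro hi; exact absurd ⟨i, hi⟩ h

theorem nbr_spec {col : ℕ → ℕ} (hp : E.Proper col) {v c : ℕ} (hc : c ≠ 0)
    (h : E.nbr col v c ≠ 0) : E.nbr col v c - 1 < E.m ∧ E.Inc (E.nbr col v c - 1) v ∧
      col (E.nbr col v c - 1) = c :=
  (nbr_eq_succ hp hc).1 (by omega)

theorem nbr_congr {col col' : ℕ → ℕ} {v c : ℕ}
    (h : ∀ i < E.m, E.Inc i v → (col i = c ↔ col' i = c)) : E.nbr col v c = E.nbr col' v c := by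
  unfold nbr
  have : (fun i => i < E.m ∧ E.Inc i v ∧ col i = c) =
      fun i => i < E.m ∧ E.Inc i v ∧ col' i = c := by
    funext i
    simp only [eq_iff_iff]
    constructor <;> rintro ⟨h1, h2, h3⟩
    · exact ⟨h1, h2, (h i h1 h2).1 h3⟩
    · exact ⟨h1, h2, (h i h1 h2).2 h3⟩
  simp only [this]

theorem Proper.uncolor {col : ℕ → ℕ} (hp : E.Proper col) (h : ℕ) :
    E.Proper (update col h 0) := by
  intro i hi j hj v hiv hjv hij h0
  simp only [update_apply] at hij h0
  split_ifs at hij h0 with h1 h2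
  · exact absurd rfl h0
  · exact absurd rfl h0
  · exact absurd hij h0
  · exact hp i hi j hj v hiv hjv hij h0

theorem nbr_uncolor {col : ℕ → ℕ} (hp : E.Proper col) {h v c : ℕ} (hh : h < E.m) (hc : c ≠ 0) :
    E.nbr (update col h 0) v c = if E.Inc h v ∧ col h = c then 0 else E.nbr col v c := by
  split_ifs with hif
  · rw [nbr_eq_zero]
    intro i hi hiv
    rw [update_apply]
    split_ifs with hih
    · exact hc.symm
    · intro hic
      exact hih (hp i hi h hh v hiv hif.1 (hic.trans hif.2.symm) (hic ▸ hc))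
  · refine nbr_congr fun i hi hiv => ?_
    rw [update_apply]
    split_ifs with hih
    · subst hih
      exact ⟨fun h => absurd h.symm hc, fun h => absurd ⟨hiv, h⟩ hif⟩
    · rfl

theorem Proper.color {col : ℕ → ℕ} (hp : E.Proper col) {g c : ℕ}
    (hm : ∀ v, E.Inc g v → E.nbr col v c = 0) :
    E.Proper (update col g c) := by
  intro i hi j hj v hiv hjv hij h0
  simp only [update_apply] at hij h0
  by_cases hig : i = g <;> by_cases hjg : j = g
  · rw [hig, hjg]
  · subst hig
    simp only [if_true, if_neg hjg] at hij
    exact absurd hij.symm (nbr_eq_zero.1 (hm v hiv) j hj hjv)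
  · subst hjg
    simp only [if_true, if_neg hig] at hij
    exact absurd hij (nbr_eq_zero.1 (hm v hjv) i hi hiv)
  · simp only [if_neg hig, if_neg hjg] at hij h0
    exact hp i hi j hj v hiv hjv hij h0

theorem nbr_color {col : ℕ → ℕ} (hp : E.Proper col) {g c v c' : ℕ} (hg : g < E.m)
    (hc' : c' ≠ 0) (h0 : col g = 0) (hm : ∀ v, E.Inc g v → E.nbr col v c = 0) :
    E.nbr (update col g c) v c' = if E.Inc g v ∧ c' = c then g + 1 else E.nbr col v c' := by
  split_ifs with hif
  · rw [nbr_eq_succ (hp.color hm) hc']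
    simp [hg, hif.1, hif.2]
  · refine nbr_congr fun i hi hiv => ?_
    rw [update_apply]
    split_ifs with hih
    · subst hih
      rw [h0]
      exact ⟨fun h => absurd ⟨hiv, h.symm⟩ hif, fun h => absurd h.symm hc'⟩
    · rfl

/-! ### Alternating paths -/

/-- The colors along an alternating path: `b, a, b, a, …` -/
def altColor (a b i : ℕ) : ℕ := if i % 2 = 0 then b else a

variable (E) in
/-- The vertices of the alternating path that starts at `u` with color `b`; the values behind the end
of the path are meaningless. -/
noncomputable def vtx (col : ℕ → ℕ) (a b u : ℕ) : ℕ → ℕ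
  | 0 => u
  | i + 1 => E.other (E.nbr col (vtx col a b u i) (altColor a b i) - 1) (vtx col a b u i)

variable (E) in
/-- The edges of the alternating path that starts at `u` with color `b`. -/
noncomputable def pathEdge (col : ℕ → ℕ) (a b u i : ℕ) : ℕ :=
  E.nbr col (E.vtx col a b u i) (altColor a b i) - 1

variable (E) in
/-- The alternating path has at least `p` edges. -/
def Valid (col : ℕ → ℕ) (a b u p : ℕ) : Prop :=
  ∀ i < p, E.nbr col (E.vtx col a b u i) (altColor a b i) ≠ 0

variable (E) in
/-- The coloring in which the first `p` edges of the alternating path have exchanged their colors. -/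
noncomputable def flip (col : ℕ → ℕ) (a b u p : ℕ) : ℕ → ℕ := by
  classical
  exact fun e => if ∃ i < p, E.pathEdge col a b u i = e then (if col e = a then b else a) else col e

theorem Valid.mono {col : ℕ → ℕ} {a b u p p' : ℕ} (h : E.Valid col a b u p) (hp : p' ≤ p) :
    E.Valid col a b u p' := fun i hi => h i (by omega)

theorem altColor_succ_ne {a b : ℕ} (hab : a ≠ b) (i : ℕ) :
    altColor a b (i + 1) ≠ altColor a b i := by
  unfold altColor
  split_ifs <;> omega

theorem altColor_congr {a b i j : ℕ} (h : i % 2 = j % 2) : altColor a b i = altColor a b j := by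
  unfold altColor; rw [h]

theorem altColor_ne_zero {a b : ℕ} (ha : a ≠ 0) (hb : b ≠ 0) (i : ℕ) : altColor a b i ≠ 0 := by
  unfold altColor; split_ifs <;> assumption

theorem altColor_eq_or (a b i : ℕ) : altColor a b i = b ∨ altColor a b i = a := by
  unfold altColor; split_ifs <;> simp

section path

variable {col : ℕ → ℕ} {a b u p : ℕ}

theorem Valid.succ (h : E.Valid col a b u p)
    (h0 : E.nbr col (E.vtx col a b u p) (altColor a b p) ≠ 0) : E.Valid col a b u (p + 1) := by
  intro i hi
  rcases Nat.lt_succ_iff_lt_or_eq.1 hi with h1 | h1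
  · exact h i h1
  · rw [h1]; exact h0

theorem Valid.edge (hp : E.Proper col) (ha : a ≠ 0) (hb : b ≠ 0) (h : E.Valid col a b u p) {i : ℕ}
    (hi : i < p) : E.pathEdge col a b u i < E.m ∧
      E.Inc (E.pathEdge col a b u i) (E.vtx col a b u i) ∧
      E.Inc (E.pathEdge col a b u i) (E.vtx col a b u (i + 1)) ∧
      col (E.pathEdge col a b u i) = altColor a b i := by
  obtain ⟨h1, h2, h3⟩ := nbr_spec hp (altColor_ne_zero ha hb i) (h i hi)
  exact ⟨h1, h2, h2.other, h3⟩

theorem Valid.other_succ (hp : E.Proper col) (ha : a ≠ 0) (hb : b ≠ 0) (h : E.Valid col a b u p)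
    {i : ℕ} (hi : i < p) :
    E.other (E.pathEdge col a b u i) (E.vtx col a b u (i + 1)) = E.vtx col a b u i := by
  conv_lhs => rw [vtx]
  exact other_other (h.edge hp ha hb hi).2.1

/-- Alternating paths can be traced back: the position of a vertex on the path determines the start of
the path, up to the parity of the position, because `a` is missing at the start. -/
theorem Valid.unique (hp : E.Proper col) (ha : a ≠ 0) (hb : b ≠ 0) {u' p' : ℕ}
    (hu : E.nbr col u a = 0) (hu' : E.nbr col u' a = 0) (h : E.Valid col a b u p)
    (h' : E.Valid col a b u' p') (he : E.vtx col a b u p = E.vtx col a b u' p')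
    (hpar : p % 2 = p' % 2) : u = u' ∧ p = p' := by
  have start : ∀ {u u' p : ℕ}, E.nbr col u a = 0 → E.Valid col a b u' (p + 1) →
      u = E.vtx col a b u' (p + 1) → (p + 1) % 2 = 0 → False := by
    intro u u' p hu h he hpar
    obtain ⟨h1, -, h2, h3⟩ := h.edge hp ha hb (Nat.lt_succ_self p)
    rw [← he] at h2
    refine nbr_eq_zero.1 hu _ h1 h2 (h3.trans ?_)
    unfold altColor
    rw [if_neg (by omega)]
  induction p generalizing p' with
  | zero =>
    cases p' with
    | zero => exact ⟨he, rfl⟩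
    | succ p' => exact (start hu h' he hpar.symm).elim
  | succ p ih =>
    cases p' with
    | zero => exact (start hu' h he.symm hpar).elim
    | succ p' =>
      obtain ⟨h1, -, h2, h3⟩ := h.edge hp ha hb (Nat.lt_succ_self p)
      obtain ⟨h1', -, h2', h3'⟩ := h'.edge hp ha hb (Nat.lt_succ_self p')
      rw [he] at h2
      have hc : altColor a b p = altColor a b p' := altColor_congr (by omega)
      have heq := hp _ h1 _ h1' _ h2 h2' (by rw [h3, h3', hc])
        (by rw [h3]; exact altColor_ne_zero ha hb _)
      have := ih (p' := p') (h.mono (by omega)) (h'.mono (by omega))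
        (by rw [← h.other_succ hp ha hb (Nat.lt_succ_self p), heq, he,
          h'.other_succ hp ha hb (Nat.lt_succ_self p')]) (by omega)
      exact ⟨this.1, by omega⟩

theorem Valid.vtx_ne (hp : E.Proper col) (ha : a ≠ 0) (hb : b ≠ 0) (hu : E.nbr col u a = 0)
    (h : E.Valid col a b u p) {i j : ℕ} (hij : i < j) (hj : j ≤ p) :
    E.vtx col a b u i ≠ E.vtx col a b u j := by
  intro he
  by_cases hpar : i % 2 = j % 2
  · have := (Valid.unique hp ha hb hu hu (h.mono (by omega : i ≤ p)) (h.mono hj) he hpar).2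
    omega
  · obtain ⟨d, hd⟩ : ∃ d, j = i + 1 + 2 * d := ⟨(j - i) / 2, by omega⟩
    induction d generalizing i j with
    | zero =>
      obtain rfl : j = i + 1 := by omega
      obtain ⟨h1, h2, -, -⟩ := h.edge hp ha hb (show i < p by omega)
      exact other_ne h1 h2 he.symm
    | succ d ih =>
      obtain ⟨j, rfl⟩ : ∃ j', j = j' + 1 := ⟨j - 1, by omega⟩
      obtain ⟨h1, h2, -, h3⟩ := h.edge hp ha hb (show i < p by omega)
      obtain ⟨h1', -, h2', h3'⟩ := h.edge hp ha hb (show j < p by omega)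
      rw [← he] at h2'
      have hc : altColor a b i = altColor a b j := altColor_congr (by omega)
      have heq := hp _ h1 _ h1' _ h2 h2' (by rw [h3, h3', hc])
        (by rw [h3]; exact altColor_ne_zero ha hb _)
      refine ih (i := i + 1) (j := j) (by omega) (by omega) ?_ (by omega) (by omega)
      rw [← h.other_succ hp ha hb (show j < p by omega), ← he, ← heq]
      rfl

theorem flip_edge (hp : E.Proper col) (ha : a ≠ 0) (hb : b ≠ 0)
    (h : E.Valid col a b u p) {i : ℕ} (hi : i < p) :
    E.flip col a b u p (E.pathEdge col a b u i) = altColor a b (i + 1) := by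
  have h3 := (h.edge hp ha hb hi).2.2.2
  unfold flip
  rw [if_pos ⟨i, hi, rfl⟩, h3]
  unfold altColor
  split_ifs <;> first | rfl | omega

theorem flip_of_ne {e : ℕ} (he : ∀ i < p, E.pathEdge col a b u i ≠ e) :
    E.flip col a b u p e = col e := by
  unfold flip
  rw [if_neg]
  rintro ⟨i, hi, h⟩
  exact he i hi h

theorem flip_zero : E.flip col a b u 0 = col := by
  funext e
  exact flip_of_ne fun i hi => by omega

/-- The search for the next edge sees the same edge before and after the flip of the part of the path
up to there. -/
theorem Valid.nbr_flip (hp : E.Proper col) (ha : a ≠ 0) (hb : b ≠ 0) (hab : a ≠ b)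
    (hu : E.nbr col u a = 0) (h : E.Valid col a b u (p + 1)) :
    E.nbr (update (E.flip col a b u p) (E.pathEdge col a b u p) 0) (E.vtx col a b u (p + 1))
      (altColor a b (p + 1)) = E.nbr col (E.vtx col a b u (p + 1)) (altColor a b (p + 1)) := by
  refine nbr_congr fun e he hinc => ?_
  rw [update_apply]
  split_ifs with hep
  · rw [hep, (h.edge hp ha hb (Nat.lt_succ_self p)).2.2.2]
    exact ⟨fun h0 => absurd h0.symm (altColor_ne_zero ha hb _),
      fun h0 => absurd h0.symm (altColor_succ_ne hab p)⟩
  · rw [flip_of_ne]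
    rintro i hi rfl
    obtain ⟨-, h2, -, -⟩ := h.edge hp ha hb (show i < p + 1 by omega)
    rcases h2.eq_or_eq_other hinc with h0 | h0
    · exact h.vtx_ne hp ha hb hu (i := i) (j := p + 1) (by omega) le_rfl h0.symm
    · exact h.vtx_ne hp ha hb hu (i := i + 1) (j := p + 1) (by omega) le_rfl h0.symm

theorem Valid.missing_near (hp : E.Proper col) (ha : a ≠ 0) (hb : b ≠ 0) (hab : a ≠ b)
    (hu : E.nbr col u a = 0) (h : E.Valid col a b u (p + 1)) :
    E.nbr (update (E.flip col a b u p) (E.pathEdge col a b u p) 0) (E.vtx col a b u p)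
      (altColor a b (p + 1)) = 0 := by
  rw [nbr_eq_zero]
  intro e he hinc
  obtain ⟨g1, g2, -, g4⟩ := h.edge hp ha hb (Nat.lt_succ_self p)
  rw [update_apply]
  split_ifs with hep
  · exact (altColor_ne_zero ha hb _).symm
  · by_cases hfl : ∃ i < p, E.pathEdge col a b u i = e
    · obtain ⟨i, hi, rfl⟩ := hfl
      rw [flip_edge hp ha hb (h.mono (Nat.le_succ p)) hi]
      intro hc
      obtain ⟨f1, -, -, f4⟩ := h.edge hp ha hb (show i < p + 1 by omega)
      have : altColor a b i = altColor a b p := by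
        by_contra hne
        have h1 := altColor_succ_ne hab i
        have h2 := altColor_succ_ne hab p
        rcases altColor_eq_or a b i with h | h <;> rcases altColor_eq_or a b p with h' | h' <;>
          rcases altColor_eq_or a b (p + 1) with h'' | h'' <;> simp_all
      exact hep (hp _ f1 _ g1 _ hinc g2 (by rw [f4, g4, this])
        (by rw [f4]; exact altColor_ne_zero ha hb _))
    · push Not at hfl
      rw [flip_of_ne hfl]
      intro hc
      cases p with
      | zero =>
        refine nbr_eq_zero.1 hu e he hinc (hc.trans ?_)
        rfl
      | succ p =>
        obtain ⟨f1, -, f3, f4⟩ := h.edge hp ha hb (show p < p + 1 + 1 by omega)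
        refine hfl p (Nat.lt_succ_self p) (hp _ f1 _ he _ f3 hinc ?_
          (by rw [f4]; exact altColor_ne_zero ha hb _))
        rw [f4, hc]
        exact altColor_congr (by omega)

theorem Valid.flip_succ (hp : E.Proper col) (ha : a ≠ 0) (hb : b ≠ 0)
    (h : E.Valid col a b u (p + 1)) :
    update (update (E.flip col a b u p) (E.pathEdge col a b u p) 0) (E.pathEdge col a b u p)
      (altColor a b (p + 1)) = E.flip col a b u (p + 1) := by
  rw [update_idem]
  funext e
  rw [update_apply]
  split_ifs with he
  · rw [he, flip_edge hp ha hb h (Nat.lt_succ_self p)]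
  · by_cases hfl : ∃ i < p, E.pathEdge col a b u i = e
    · obtain ⟨i, hi, rfl⟩ := hfl
      rw [flip_edge hp ha hb (h.mono (Nat.le_succ p)) hi,
        flip_edge hp ha hb h (by omega)]
    · push Not at hfl
      rw [flip_of_ne hfl, flip_of_ne]
      intro i hi
      rcases Nat.lt_succ_iff_lt_or_eq.1 hi with h1 | h1
      · exact hfl i h1
      · rw [h1]; exact fun h => he h.symm

variable (E) in
/-- The outcome of a flip of the alternating path from `u`: either all of its `p` edges were flipped,
or the path is longer and the edge behind the first `p` ones was uncolored. -/
def Flipped (col : ℕ → ℕ) (a b u p : ℕ) (col' : ℕ → ℕ) : Prop :=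
  E.Valid col a b u p ∧
  ((E.nbr col (E.vtx col a b u p) (altColor a b p) = 0 ∧ col' = E.flip col a b u p) ∨
    (E.nbr col (E.vtx col a b u p) (altColor a b p) ≠ 0 ∧
      col' = update (E.flip col a b u p) (E.pathEdge col a b u p) 0))

variable {col' : ℕ → ℕ}

theorem Flipped.cases (hp : E.Proper col) (ha : a ≠ 0) (hb : b ≠ 0)
    (h : E.Flipped col a b u p col') {e : ℕ} (he : col' e ≠ 0) :
    (col' e = col e ∧ (∀ i < p, E.pathEdge col a b u i ≠ e) ∧
      E.nbr col (E.vtx col a b u p) (altColor a b p) ≠ e + 1) ∨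
    ∃ i < p, E.pathEdge col a b u i = e ∧ col' e = altColor a b (i + 1) := by
  obtain ⟨hv, ⟨h0, rfl⟩ | ⟨h0, rfl⟩⟩ := h
  · by_cases hfl : ∃ i < p, E.pathEdge col a b u i = e
    · obtain ⟨i, hi, rfl⟩ := hfl
      exact Or.inr ⟨i, hi, rfl, flip_edge hp ha hb hv hi⟩
    · push Not at hfl
      exact Or.inl ⟨flip_of_ne hfl, hfl, by omega⟩
  · have hne : e ≠ E.pathEdge col a b u p := by
      rintro rfl; simp at he
    rw [update_of_ne hne] at he ⊢
    by_cases hfl : ∃ i < p, E.pathEdge col a b u i = e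
    · obtain ⟨i, hi, rfl⟩ := hfl
      exact Or.inr ⟨i, hi, rfl, flip_edge hp ha hb hv hi⟩
    · push Not at hfl
      refine Or.inl ⟨flip_of_ne hfl, hfl, fun h1 => hne ?_⟩
      unfold pathEdge
      omega

theorem Flipped.missing_b (hp : E.Proper col) (ha : a ≠ 0) (hb : b ≠ 0) (hab : a ≠ b)
    (h : E.Flipped col a b u p col') {z : ℕ} (hz : E.nbr col z b = 0)
    (hzp : z ≠ E.vtx col a b u p) : E.nbr col' z b = 0 := by
  rw [nbr_eq_zero] at hz ⊢
  intro e he hinc hc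
  rcases h.cases hp ha hb (e := e) (by rw [hc]; exact hb) with ⟨h1, -, -⟩ | ⟨i, hi, rfl, h1⟩
  · exact hz e he hinc (h1 ▸ hc)
  · obtain ⟨-, f2, -, -⟩ := h.1.edge hp ha hb hi
    have hodd : i % 2 = 1 := by
      by_contra hpar
      rw [h1] at hc
      unfold altColor at hc
      rw [if_neg (by omega)] at hc
      exact hab hc
    rcases f2.eq_or_eq_other hinc with h0 | h0
    · obtain ⟨i, rfl⟩ : ∃ i', i = i' + 1 := ⟨i - 1, by omega⟩
      obtain ⟨g1, -, g3, g4⟩ := h.1.edge hp ha hb (show i < p by omega)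
      refine hz _ g1 (h0 ▸ g3) (g4.trans ?_)
      unfold altColor; rw [if_pos (by omega)]
    · have h0' : z = E.vtx col a b u (i + 1) := h0
      by_cases hip : i + 1 = p
      · exact hzp (hip ▸ h0')
      · obtain ⟨g1, g2, -, g4⟩ := h.1.edge hp ha hb (show i + 1 < p by omega)
        refine hz _ g1 (h0' ▸ g2) (g4.trans ?_)
        unfold altColor; rw [if_pos (by omega)]

theorem Flipped.end_missing_a (hp : E.Proper col) (ha : a ≠ 0) (hb : b ≠ 0) (hab : a ≠ b)
    (h : E.Flipped col a b u p col') (hz : E.nbr col (E.vtx col a b u p) b = 0)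
    (hpos : p ≠ 0) : E.nbr col' (E.vtx col a b u p) a = 0 := by
  rw [nbr_eq_zero] at hz ⊢
  intro e he hinc hc
  obtain ⟨p, rfl⟩ : ∃ p', p = p' + 1 := ⟨p - 1, by omega⟩
  obtain ⟨g1, -, g3, g4⟩ := h.1.edge hp ha hb (Nat.lt_succ_self p)
  have hga : altColor a b p = a :=
    (altColor_eq_or a b p).resolve_left fun h0 => hz _ g1 g3 (g4.trans h0)
  rcases h.cases hp ha hb (e := e) (by rw [hc]; exact ha) with ⟨h1, h2, -⟩ | ⟨i, hi, rfl, h1⟩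
  · refine h2 p (Nat.lt_succ_self p) (hp _ g1 _ he _ g3 hinc ?_ (by rw [g4, hga]; exact ha))
    rw [g4, hga, ← h1, hc]
  · refine hz _ he hinc ((h.1.edge hp ha hb hi).2.2.2.trans ?_)
    refine (altColor_eq_or a b i).resolve_right fun h0 => ?_
    exact altColor_succ_ne hab i (by rw [← h1, hc, h0])

theorem Flipped.start_missing_b (hp : E.Proper col) (ha : a ≠ 0) (hb : b ≠ 0) (hab : a ≠ b)
    (hu : E.nbr col u a = 0) (h : E.Flipped col a b u p col') : E.nbr col' u b = 0 := by
  rw [nbr_eq_zero]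
  intro e he hinc hc
  rcases h.cases hp ha hb (e := e) (by rw [hc]; exact hb) with ⟨h1, h2, h3⟩ | ⟨i, hi, rfl, h1⟩
  · have hnb : E.nbr col u b = e + 1 := (nbr_eq_succ hp hb).2 ⟨he, hinc, h1 ▸ hc⟩
    by_cases h0 : p = 0
    · subst h0; exact h3 hnb
    · refine h2 0 (by omega) ?_
      have : E.pathEdge col a b u 0 = E.nbr col u b - 1 := rfl
      omega
  · refine nbr_eq_zero.1 hu _ he hinc ((h.1.edge hp ha hb hi).2.2.2.trans ?_)
    refine (altColor_eq_or a b i).resolve_left fun h0 => ?_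
    exact altColor_succ_ne hab i (by rw [← h1, hc, h0])

theorem Flipped.apply_of_ne (hp : E.Proper col) (ha : a ≠ 0) (hb : b ≠ 0)
    (h : E.Flipped col a b u p col') {e : ℕ} (hea : col e ≠ a) (heb : col e ≠ b) :
    col' e = col e := by
  have key : ∀ p', E.Valid col a b u p' → ∀ i < p', E.pathEdge col a b u i ≠ e := by
    rintro p' hv i hi rfl
    have := (hv.edge hp ha hb hi).2.2.2
    rcases altColor_eq_or a b i with h0 | h0 <;> rw [h0] at this <;> contradiction
  obtain ⟨hv, ⟨h0, rfl⟩ | ⟨h0, rfl⟩⟩ := h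
  · exact flip_of_ne (key p hv)
  · have hv' : E.Valid col a b u (p + 1) := fun i hi => by
      rcases Nat.lt_succ_iff_lt_or_eq.1 hi with h1 | h1
      · exact hv i h1
      · rw [h1]; exact h0
    rw [update_of_ne (key _ hv' p (Nat.lt_succ_self p)).symm, flip_of_ne (key p hv)]

theorem Flipped.missing_of_ne (hp : E.Proper col) (ha : a ≠ 0) (hb : b ≠ 0)
    (h : E.Flipped col a b u p col') {z c : ℕ} (hc0 : c ≠ 0) (hca : c ≠ a) (hcb : c ≠ b)
    (hz : E.nbr col z c = 0) : E.nbr col' z c = 0 := by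
  rw [nbr_eq_zero] at hz ⊢
  intro e he hinc hc
  rcases h.cases hp ha hb (e := e) (by rw [hc]; exact hc0) with ⟨h1, -, -⟩ | ⟨i, hi, rfl, h1⟩
  · exact hz e he hinc (h1 ▸ hc)
  · rcases altColor_eq_or a b (i + 1) with h0 | h0 <;> rw [h0, hc] at h1 <;> contradiction

theorem Flipped.eq_zero (hp : E.Proper col) (ha : a ≠ 0) (hb : b ≠ 0)
    (h : E.Flipped col a b u p col') {e : ℕ} (he : col' e = 0) :
    col e = 0 ∨ (E.nbr col (E.vtx col a b u p) (altColor a b p) ≠ 0 ∧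
      E.pathEdge col a b u p = e) := by
  have key : E.flip col a b u p e = 0 → col e = 0 := by
    intro h0
    by_cases hfl : ∃ i < p, E.pathEdge col a b u i = e
    · obtain ⟨i, hi, rfl⟩ := hfl
      rw [flip_edge hp ha hb h.1 hi] at h0
      exact absurd h0 (altColor_ne_zero ha hb _)
    · push Not at hfl
      rwa [flip_of_ne hfl] at h0
  obtain ⟨hv, ⟨h0, rfl⟩ | ⟨h0, rfl⟩⟩ := h
  · exact Or.inl (key he)
  · rw [update_apply] at he
    split_ifs at he with h1
    · exact Or.inr ⟨h0, h1.symm⟩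
    · exact Or.inl (key he)

end path

/-! ### Vizing fans -/

variable (E) in
/-- A Vizing fan with center `u`: edges `fe 0, …, fe k` at `u`, where `fe 0` is uncolored and the
color `fc i` of `fe (i + 1)` is missing at the leaf of `fe i`. -/
structure IsFan (col : ℕ → ℕ) (u k : ℕ) (fe fc : ℕ → ℕ) : Prop where
  lt_zero : fe 0 < E.m
  inc_zero : E.Inc (fe 0) u
  uncolored : col (fe 0) = 0
  pos : ∀ i < k, fc i ≠ 0
  next : ∀ i < k, E.nbr col u (fc i) = fe (i + 1) + 1
  missing : ∀ i < k, E.nbr col (E.other (fe i) u) (fc i) = 0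
  inj : ∀ i < k, ∀ j < k, fc i = fc j → i = j

section fan

variable {col : ℕ → ℕ} {u k : ℕ} {fe fc : ℕ → ℕ}

theorem IsFan.congr {fe' fc' : ℕ → ℕ} (h : E.IsFan col u k fe fc)
    (he : ∀ i ≤ k, fe' i = fe i) (hc : ∀ i < k, fc' i = fc i) : E.IsFan col u k fe' fc' where
  lt_zero := by rw [he 0 (Nat.zero_le _)]; exact h.lt_zero
  inc_zero := by rw [he 0 (Nat.zero_le _)]; exact h.inc_zero
  uncolored := by rw [he 0 (Nat.zero_le _)]; exact h.uncolored
  pos i hi := by rw [hc i hi]; exact h.pos i hi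
  next i hi := by rw [hc i hi, he (i + 1) hi]; exact h.next i hi
  missing i hi := by rw [hc i hi, he i hi.le]; exact h.missing i hi
  inj i hi j hj := by rw [hc i hi, hc j hj]; exact h.inj i hi j hj

theorem IsFan.edge (hp : E.Proper col) (h : E.IsFan col u k fe fc) {i : ℕ} (hi : i < k) :
    fe (i + 1) < E.m ∧ E.Inc (fe (i + 1)) u ∧ col (fe (i + 1)) = fc i :=
  (nbr_eq_succ hp (h.pos i hi)).1 (h.next i hi)

theorem IsFan.mem (hp : E.Proper col) (h : E.IsFan col u k fe fc) {i : ℕ} (hi : i ≤ k) :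
    fe i < E.m ∧ E.Inc (fe i) u := by
  cases i with
  | zero => exact ⟨h.lt_zero, h.inc_zero⟩
  | succ i => exact ⟨(h.edge hp hi).1, (h.edge hp hi).2.1⟩

theorem IsFan.edge_inj (hp : E.Proper col) (h : E.IsFan col u k fe fc) {i j : ℕ} (hi : i ≤ k)
    (hj : j ≤ k) (he : fe i = fe j) : i = j := by
  cases i with
  | zero =>
    cases j with
    | zero => rfl
    | succ j =>
      have := (h.edge hp hj).2.2
      rw [← he, h.uncolored] at this
      exact absurd this.symm (h.pos j hj)
  | succ i =>
    cases j with
    | zero =>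
      have := (h.edge hp hi).2.2
      rw [he, h.uncolored] at this
      exact absurd this.symm (h.pos i hi)
    | succ j =>
      have h1 := (h.edge hp hi).2.2
      rw [he, (h.edge hp hj).2.2] at h1
      rw [h.inj j hj i hi h1]

theorem IsFan.leaf_inj (hp : E.Proper col) (h : E.IsFan col u k fe fc) {i j : ℕ} (hi : i ≤ k)
    (hj : j ≤ k) (he : E.Inc (fe i) (E.other (fe j) u)) : i = j := by
  obtain ⟨h1, h2⟩ := h.mem hp hi
  obtain ⟨h3, h4⟩ := h.mem hp hj
  exact h.edge_inj hp hi hj (eq_of_inc h1 h3 (other_ne h3 h4) he h2 h4.other h4)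

variable (E) in
/-- The colors of the fan edges up to index `t` can be shifted down by one, so that the edge with index
`t` can receive color `b`. -/
structure Shiftable (col : ℕ → ℕ) (u t b : ℕ) (fe : ℕ → ℕ) : Prop where
  uncolored : col (fe 0) = 0
  colored : ∀ i < t, col (fe (i + 1)) ≠ 0
  missing : ∀ i < t, E.nbr col (E.other (fe i) u) (col (fe (i + 1))) = 0
  leaf : E.nbr col (E.other (fe t) u) b = 0
  center : E.nbr col u b = 0

theorem IsFan.shiftable_self (hp : E.Proper col) (h : E.IsFan col u k fe fc) {b : ℕ}
    (hl : E.nbr col (E.other (fe k) u) b = 0) (hc : E.nbr col u b = 0) :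
    E.Shiftable col u k b fe where
  uncolored := h.uncolored
  colored i hi := by rw [(h.edge hp hi).2.2]; exact h.pos i hi
  missing i hi := by rw [(h.edge hp hi).2.2]; exact h.missing i hi
  leaf := hl
  center := hc

/-- The core of Vizing's argument: two leaves of the fan miss `b`, and the alternating path from the
center ends in at most one of them. -/
theorem IsFan.shiftable (hp : E.Proper col) (h : E.IsFan col u k fe fc) {a b j p : ℕ}
    {col' : ℕ → ℕ}
    (ha : a ≠ 0) (hb : b ≠ 0) (hl : E.nbr col (E.other (fe k) u) b = 0) (hj : j < k)
    (hjb : fc j = b) (hu : E.nbr col u a = 0) (hf : E.Flipped col a b u p col') :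
    E.Shiftable col' u (if E.vtx col a b u p = E.other (fe j) u then k else j) b fe := by
  have hub : E.nbr col u b ≠ 0 := by rw [← hjb, h.next j hj]; omega
  have hab : a ≠ b := by rintro rfl; exact hub hu
  have hfa : ∀ i < k, fc i ≠ a := by
    rintro i hi rfl
    rw [h.next i hi] at hu; omega
  have hfb : ∀ i < k, i ≠ j → fc i ≠ b := by
    intro i hi hij h0
    exact hij (h.inj i hi j hj (h0.trans hjb.symm))
  have hsame : ∀ i < k, i ≠ j → col' (fe (i + 1)) = fc i := by
    intro i hi hij
    have h1 := (h.edge hp hi).2.2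
    rw [hf.apply_of_ne hp ha hb (by rw [h1]; exact hfa i hi) (by rw [h1]; exact hfb i hi hij), h1]
  have h00 : col' (fe 0) = 0 := by
    rw [hf.apply_of_ne hp ha hb (by rw [h.uncolored]; exact ha.symm)
      (by rw [h.uncolored]; exact hb.symm), h.uncolored]
  have hmiss : ∀ i < k, i ≠ j → E.nbr col' (E.other (fe i) u) (col' (fe (i + 1))) = 0 := by
    intro i hi hij
    rw [hsame i hi hij]
    exact hf.missing_of_ne hp ha hb (h.pos i hi) (hfa i hi) (hfb i hi hij) (h.missing i hi)
  have hcen := hf.start_missing_b hp ha hb hab hu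
  have hjm := h.missing j hj
  rw [hjb] at hjm
  split_ifs with hx
  · have hp0 : p ≠ 0 := by
      rintro rfl
      exact other_ne (h.mem hp hj.le).1 (h.mem hp hj.le).2 hx.symm
    have hend := hf.end_missing_a hp ha hb hab (by rw [hx]; exact hjm) hp0
    rw [hx] at hend
    have hcol : col' (fe (j + 1)) = a := by
      have he : E.pathEdge col a b u 0 = fe (j + 1) := by
        have h1 : E.pathEdge col a b u 0 = E.nbr col u b - 1 := rfl
        have h2 := h.next j hj
        rw [hjb] at h2
        omega
      have hlast : altColor a b p = b := by
        obtain ⟨p, rfl⟩ : ∃ p', p = p' + 1 := ⟨p - 1, by omega⟩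
        obtain ⟨g1, -, g3, g4⟩ := hf.1.edge hp ha hb (Nat.lt_succ_self p)
        have hga : altColor a b p = a := (altColor_eq_or a b p).resolve_left fun h0 =>
          nbr_eq_zero.1 hjm _ g1 (hx ▸ g3) (g4.trans h0)
        exact (altColor_eq_or a b (p + 1)).resolve_right fun h0 =>
          altColor_succ_ne hab p (h0.trans hga.symm)
      have hflip : col' = E.flip col a b u p := by
        rcases hf.2 with ⟨-, h1⟩ | ⟨h1, -⟩
        · exact h1
        · rw [hx, hlast] at h1; exact absurd hjm h1
      rw [hflip, ← he, flip_edge hp ha hb hf.1 (by omega)]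
      rfl
    refine ⟨h00, fun i hi => ?_, fun i hi => ?_, ?_, hcen⟩
    · by_cases hij : i = j
      · rw [hij, hcol]; exact ha
      · rw [hsame i hi hij]; exact h.pos i hi
    · by_cases hij : i = j
      · rw [hij, hcol]; exact hend
      · exact hmiss i hi hij
    · refine hf.missing_b hp ha hb hab hl ?_
      rw [hx]
      intro h0
      have := h.leaf_inj hp hj.le le_rfl (i := j) (h0 ▸ (h.mem hp hj.le).2.other)
      omega
  · refine ⟨h00, fun i hi => ?_, fun i hi => hmiss i (by omega) (by omega), ?_, hcen⟩
    · rw [hsame i (by omega) (by omega)]; exact h.pos i (by omega)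
    · exact hf.missing_b hp ha hb hab hjm fun h0 => hx h0.symm

/-- The coloring `C` arises from `col` by shifting the first `i` fan colors down by one. -/
structure IsShift (col : ℕ → ℕ) (fe : ℕ → ℕ) (i : ℕ) (C : ℕ → ℕ) : Prop where
  shifted : ∀ l < i, C (fe l) = col (fe (l + 1))
  hole : C (fe i) = 0
  same : ∀ e, (∀ l ≤ i, fe l ≠ e) → C e = col e

variable {col' C : ℕ → ℕ} {t b : ℕ}

theorem IsShift.missing_leaf (hp : E.Proper col) (h : E.IsFan col u k fe fc)
    {i c : ℕ} (hi : i ≤ k) (hC : IsShift col' fe i C) (hc0 : c ≠ 0)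
    (hc : E.nbr col' (E.other (fe i) u) c = 0) : E.nbr C (E.other (fe i) u) c = 0 := by
  rw [nbr_eq_zero] at hc ⊢
  intro e he hinc h0
  by_cases hl : ∃ l ≤ i, fe l = e
  · obtain ⟨l, hl, rfl⟩ := hl
    rw [h.leaf_inj hp (by omega) hi hinc, hC.hole] at h0
    exact hc0 h0.symm
  · push Not at hl
    rw [hC.same e hl] at h0
    exact hc e he hinc h0

theorem IsShift.step (hp : E.Proper col) (h : E.IsFan col u k fe fc)
    (hs : E.Shiftable col' u t b fe) (htk : t ≤ k) {i : ℕ} (hi : i < t)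
    (hC : IsShift col' fe i C) (hCp : E.Proper C) :
    C (fe (i + 1)) = col' (fe (i + 1)) ∧
    (∀ v, E.Inc (fe i) v →
      E.nbr (update C (fe (i + 1)) 0) v (C (fe (i + 1))) = 0) ∧
    IsShift col' fe (i + 1) (update (update C (fe (i + 1)) 0) (fe i) (C (fe (i + 1)))) := by
  have hinj : ∀ {l l' : ℕ}, l ≤ i + 1 → l' ≤ i + 1 → fe l = fe l' → l = l' :=
    fun h1 h2 => h.edge_inj hp (by omega) (by omega)
  have hval : C (fe (i + 1)) = col' (fe (i + 1)) := hC.same _ fun l hl h0 => by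
    have := hinj (by omega) le_rfl h0; omega
  have hc0 : C (fe (i + 1)) ≠ 0 := by rw [hval]; exact hs.colored i hi
  obtain ⟨m1, m2⟩ := h.mem hp (show i + 1 ≤ k by omega)
  obtain ⟨m3, m4⟩ := h.mem hp (show i ≤ k by omega)
  refine ⟨hval, fun v hv => ?_, ⟨fun l hl => ?_, ?_, fun e he => ?_⟩⟩
  · rw [nbr_uncolor hCp m1 hc0]
    split_ifs with hif
    · rfl
    · rcases m4.eq_or_eq_other hv with rfl | rfl
      · exact absurd ⟨m2, rfl⟩ hif
      · exact hC.missing_leaf hp h (by omega) hc0 (by rw [hval]; exact hs.missing i hi)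
  · by_cases hli : l = i
    · rw [hli, update_self, hval]
    · rw [update_of_ne fun h0 => hli (hinj (by omega) (by omega) h0),
        update_of_ne fun h0 => ?_, hC.shifted l (by omega)]
      have := hinj (by omega) le_rfl h0
      omega
  · rw [update_of_ne fun h0 => ?_, update_self]
    have := hinj le_rfl (by omega) h0
    omega
  · rw [update_of_ne (he i (by omega)).symm, update_of_ne (he (i + 1) le_rfl).symm,
      hC.same e fun l hl => he l (by omega)]

theorem IsShift.finish (hp : E.Proper col) (h : E.IsFan col u k fe fc)
    (hs : E.Shiftable col' u t b fe) (htk : t ≤ k) (hC : IsShift col' fe t C) (hb : b ≠ 0) :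
    (∀ v, E.Inc (fe t) v → E.nbr C v b = 0) ∧
      ∀ e, update C (fe t) b e = 0 ↔ col' e = 0 ∧ e ≠ fe 0 := by
  constructor
  · intro v hv
    rcases (h.mem hp htk).2.eq_or_eq_other hv with rfl | rfl
    · have hcen := hs.center
      rw [nbr_eq_zero] at hcen ⊢
      intro e he hinc h0
      by_cases hl : ∃ l ≤ t, fe l = e
      · obtain ⟨l, hl, rfl⟩ := hl
        rcases hl.lt_or_eq with hl | rfl
        · rw [hC.shifted l hl] at h0
          obtain ⟨m1, m2⟩ := h.mem hp (show l + 1 ≤ k by omega)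
          exact hcen _ m1 m2 h0
        · rw [hC.hole] at h0; exact hb h0.symm
      · push Not at hl
        rw [hC.same e hl] at h0
        exact hcen e he hinc h0
    · exact hC.missing_leaf hp h htk hb hs.leaf
  · intro e
    constructor
    swap
    · rintro ⟨he, h0⟩
      have hne : ∀ l ≤ t, fe l ≠ e := by
        rintro l hl rfl
        cases l with
        | zero => exact h0 rfl
        | succ l => exact hs.colored l hl he
      rw [update_of_ne (hne t le_rfl).symm, hC.same e hne, he]
    intro he
    rw [update_apply] at he
    split_ifs at he with h1
    · exact absurd he hb
    · by_cases hl : ∃ l ≤ t, fe l = e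
      · obtain ⟨l, hl, rfl⟩ := hl
        rcases hl.lt_or_eq with hl | rfl
        · rw [hC.shifted l hl] at he
          exact absurd he (hs.colored l hl)
        · exact absurd rfl h1
      · push Not at hl
        exact ⟨hC.same e hl ▸ he, (hl 0 (Nat.zero_le _)).symm⟩

end fan

end EdgeList

/-! ### Recoloring a single edge on the word RAM

Variables `0` to `13` hold, in this order: `n`, `m`, the number of colors, `Δ`, `e`, the number `κ` of
colors of the random phase, the row length of the table, `L`, `ℓ`, the length of the queue, the length
of the palette, the remaining length of the path, a queue position, and the edge to be colored.
Arrays `0` to `8` hold: the two halves of the edge list, the coloring, the palette, the edges and the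
missing colors of the fan, the degrees, the queue, and the table. Edges in the table are shifted by
one, so that `0` can stand for a missing color. -/

namespace WordRAM

open Function EdgeList

variable {w : ℕ}

theorem Det.assign_seq {m : ℕ} (hw : 16 < 2 ^ w) {x v t : ℕ} {e : Expr} {P : Program} {S : HState}
    {Q : HState → Prop} (hx : x < 90) (he : e.ok w m S) (hv : e.eval S = v)
    (h : Det w m P t (S.setV x v) Q) :
    Det w m (.seq (assign x e) P) ((assign x e).size + t + 1) S Q := by
  subst hv
  refine Det.seq (Q := fun S' => S' = S.setV x (e.eval S)) (Det.of_assign hw hx he rfl) ?_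
  rintro _ rfl
  exact h

theorem Det.write_seq {m : ℕ} (hw : 16 < 2 ^ w) {a i v t : ℕ} {e f : Expr} {P : Program}
    {S : HState} {Q : HState → Prop} (he : (Expr.get a e).ok w m S) (hf : f.ok w m S)
    (hi : e.eval S = i) (hv : f.eval S = v) (h : Det w m P t (S.setA a i v) Q) :
    Det w m (.seq (write a e f) P) ((write a e f).size + t + 1) S Q := by
  subst hi hv
  refine Det.seq (Q := fun S' => S' = S.setA a (e.eval S) (f.eval S)) (Det.of_write hw he hf rfl) ?_
  rintro _ rfl
  exact h

/-- Word length requirements: the color table, and the arrays of length `s`, are addressable. -/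
structure Fits (w : ℕ) (E : EdgeList) (q s ℓ : ℕ) : Prop where
  word : 16 < 2 ^ w
  table : 16 * (E.n * (q + 1)) + 19 * E.m + 16 * s + 100 < 2 ^ w
  product : E.m * ℓ < 2 ^ w

/-- The state holds the edge list `E`, the proper partial coloring `col` with colors up to `κ`, and
the table that tells, for a vertex and a color, the edge at the vertex with that color. -/
structure Holds (E : EdgeList) (q κ : ℕ) (col : ℕ → ℕ) (S : HState) : Prop where
  stride : S.v 6 = q + 1
  U : S.a 0 = E.U
  V : S.a 1 = E.V
  output : S.a 2 = col
  proper : E.Proper col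
  table : ∀ v < E.n, ∀ c, 1 ≤ c → c ≤ q → S.a 8 (v * (q + 1) + c) = E.nbr col v c
  le : ∀ i < E.m, col i ≤ κ
  le' : κ ≤ q

theorem tableIndex_inj {q v v' c c' : ℕ} (hc : c ≤ q) (hc' : c' ≤ q) :
    v * (q + 1) + c = v' * (q + 1) + c' ↔ v = v' ∧ c = c' := by
  constructor
  · intro h
    have h1 : v = v' := by
      have := congrArg (· / (q + 1)) h
      simpa [Nat.add_div_of_dvd_right, Nat.mul_add_div, mul_comm _ (q + 1),
        Nat.div_eq_of_lt (show c < q + 1 by omega), Nat.div_eq_of_lt (show c' < q + 1 by omega)]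
        using this
    subst h1
    exact ⟨rfl, by omega⟩
  · rintro ⟨rfl, rfl⟩; rfl

theorem tableIndex_lt {n q v c : ℕ} (hv : v < n) (hc : c ≤ q) :
    v * (q + 1) + c < n * (q + 1) := by
  have : (v + 1) * (q + 1) ≤ n * (q + 1) := Nat.mul_le_mul_right _ hv
  rw [add_mul] at this
  omega

/-- The table entry for a vertex and a color. -/
def cell (e f : Expr) : Expr := .get 8 (.add (.mul e (.var 6)) f)

/-- The first endpoint of an edge. -/
def fstEnd (x : ℕ) : Expr := .get 0 (.var x)

/-- The second endpoint of an edge. -/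
def sndEnd (x : ℕ) : Expr := .get 1 (.var x)

/-- The endpoint of edge `x` other than vertex `y`. -/
def otherEnd (x y : ℕ) : Expr := .sub (.add (fstEnd x) (sndEnd x)) (.var y)

section

variable {E : EdgeList} {q κ s ℓ : ℕ} {col : ℕ → ℕ} {S S' : HState}

theorem Fits.cell_ok (hF : Fits w E q s ℓ) (hS : S.v 6 = q + 1) {e f : Expr} {v c : ℕ}
    (he : e.ok w E.m S) (hf : f.ok w E.m S) (hev : e.eval S = v) (hfv : f.eval S = c)
    (hv : v < E.n) (hc : c ≤ q) : (cell e f).ok w E.m S := by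
  subst hev hfv
  have h := hF.table
  have h2 := tableIndex_lt hv hc
  simp only [cell, Expr.ok, Expr.eval, he, hf, hS, addr]
  generalize e.eval S * (q + 1) = z at *
  norm_num
  omega

theorem fstEnd_ok (hF : Fits w E q s ℓ) {x i : ℕ} (hx : x < 90) (hi : S.v x = i) (hm : i < E.m) :
    (fstEnd x).ok w E.m S := by
  have h := hF.table
  simp [fstEnd, hx, hi, hm, addr]
  omega

theorem sndEnd_ok (hF : Fits w E q s ℓ) {x i : ℕ} (hx : x < 90) (hi : S.v x = i) (hm : i < E.m) :
    (sndEnd x).ok w E.m S := by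
  have h := hF.table
  simp [sndEnd, hx, hi, hm, addr]
  omega

theorem Holds.fstEnd_eval (hH : Holds E q κ col S) {x i : ℕ} (hi : S.v x = i) :
    (fstEnd x).eval S = E.U i := by
  simp [fstEnd, hi, hH.U]

theorem Holds.sndEnd_eval (hH : Holds E q κ col S) {x i : ℕ} (hi : S.v x = i) :
    (sndEnd x).eval S = E.V i := by
  simp [sndEnd, hi, hH.V]

theorem Holds.cell_eval (hH : Holds E q κ col S) {e f : Expr} {v c : ℕ} (hev : e.eval S = v)
    (hfv : f.eval S = c) (hv : v < E.n) (hc1 : 1 ≤ c) (hc : c ≤ q) :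
    (cell e f).eval S = E.nbr col v c := by
  simp [cell, hev, hfv, hH.stride, hH.table v hv c hc1 hc]

theorem Fits.n_lt (hF : Fits w E q s ℓ) : 16 * E.n < 2 ^ w := by
  have h := hF.table
  rw [mul_add] at h
  omega

theorem Holds.otherEnd_ok (hF : Fits w E q s ℓ) (hH : Holds E q κ col S) {x y i : ℕ} (hx : x < 90)
    (hy : y < 90) (hi : S.v x = i) (hm : i < E.m) : (otherEnd x y).ok w E.m S := by
  have h := hF.n_lt
  have h1 := E.U_lt i hm
  have h2 := E.V_lt i hm
  refine ⟨⟨fstEnd_ok hF hx hi hm, sndEnd_ok hF hx hi hm, ?_⟩, hy⟩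
  rw [hH.fstEnd_eval hi, hH.sndEnd_eval hi]
  omega

theorem Holds.otherEnd_eval (hH : Holds E q κ col S) {x y i v : ℕ} (hi : S.v x = i)
    (hv : S.v y = v) : (otherEnd x y).eval S = E.other i v := by
  have h1 := hH.fstEnd_eval hi
  have h2 := hH.sndEnd_eval hi
  simp only [otherEnd, Expr.eval, h1, h2, hv, EdgeList.other]

/-- The state is only changed at variables not used by the tables, and at other arrays. -/
theorem Holds.frame (hH : Holds E q κ col S) (h6 : S'.v 6 = S.v 6) (h0 : S'.a 0 = S.a 0)
    (h1 : S'.a 1 = S.a 1) (h2 : S'.a 2 = S.a 2) (h8 : S'.a 8 = S.a 8) : Holds E q κ col S' where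
  stride := h6 ▸ hH.stride
  U := h0 ▸ hH.U
  V := h1 ▸ hH.V
  output := h2 ▸ hH.output
  proper := hH.proper
  table := h8 ▸ hH.table
  le := hH.le
  le' := hH.le'

theorem Holds.setV (hH : Holds E q κ col S) {x y : ℕ} (hx : x ≠ 6) :
    Holds E q κ col (S.setV x y) :=
  hH.frame (by simp [hx.symm]) rfl rfl rfl rfl

theorem Holds.nbr_le (hH : Holds E q κ col S) {v c : ℕ} (hc : c ≠ 0) : E.nbr col v c ≤ E.m := by
  by_cases h : E.nbr col v c = 0
  · omega
  · have := (nbr_spec hH.proper hc h).1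
    omega

/-- Uncolors the edge in variable `x`. -/
def uncolor (x : ℕ) : Program :=
  .seq (write 8 (.add (.mul (fstEnd x) (.var 6)) (.get 2 (.var x))) (.lit 0))
  (.seq (write 8 (.add (.mul (sndEnd x) (.var 6)) (.get 2 (.var x))) (.lit 0))
    (write 2 (.var x) (.lit 0)))

/-- Gives the color in variable `y` to the edge in variable `x`. -/
def setColor (x y : ℕ) : Program :=
  .seq (write 8 (.add (.mul (fstEnd x) (.var 6)) (.var y)) (.add (.var x) (.lit 1)))
  (.seq (write 8 (.add (.mul (sndEnd x) (.var 6)) (.var y)) (.add (.var x) (.lit 1)))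
    (write 2 (.var x) (.var y)))

theorem uncolor_spec (hF : Fits w E q s ℓ) (hH : Holds E q κ col S) {x h : ℕ} (hx : x < 90)
    (hxh : S.v x = h) (hm : h < E.m) :
    Det w E.m (uncolor x) (uncolor x).size S fun S' => Holds E q κ (update col h 0) S' ∧
      S'.v = S.v ∧ ∀ t, t ≠ 2 → t ≠ 8 → S'.a t = S.a t := by
  have hF1 := hF.table
  have hc := hH.le h hm
  have hκ := hH.le'
  have h0 : ∀ S', (Expr.lit 0).ok w E.m S' := fun _ => by simp
  have okc : ∀ {S' : HState}, S'.v = S.v → (Expr.get 2 (.var x)).ok w E.m S' := by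
    intro S' hS'
    simp only [Expr.ok, Expr.eval, hS', hxh, addr]
    norm_num
    omega
  have evc : ∀ {S' : HState}, S'.v = S.v → S'.a 2 = S.a 2 → (Expr.get 2 (.var x)).eval S' = col h := by
    intro S' h1 h2
    simp [h1, h2, hxh, hH.output]
  refine Det.write_seq hF.word (i := E.U h * (q + 1) + col h) (v := 0)
    (hF.cell_ok hH.stride (fstEnd_ok hF hx hxh hm) (okc rfl) (hH.fstEnd_eval hxh) (evc rfl rfl)
      (E.U_lt h hm) (by omega)) (h0 _) ?_ rfl ?_
  · simp only [Expr.eval, hH.fstEnd_eval hxh, hxh, hH.output, hH.stride]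
  have H1 : (S.setA 8 (E.U h * (q + 1) + col h) 0).a 1 = E.V := hH.V
  have H2 : (S.setA 8 (E.U h * (q + 1) + col h) 0).a 2 = col := hH.output
  refine Det.write_seq hF.word (i := E.V h * (q + 1) + col h) (v := 0)
    (hF.cell_ok (by exact hH.stride) (sndEnd_ok hF hx hxh hm) (okc rfl)
      (v := E.V h) (by simp [sndEnd, H1, hxh]) (evc rfl rfl)
      (E.V_lt h hm) (by omega)) (h0 _) ?_ rfl ?_
  · simp only [Expr.eval, sndEnd, H1, H2, HState.setA_v, hxh, hH.stride]
  refine Det.of_write hF.word (okc rfl) (h0 _) ⟨?_, rfl, fun t h2 h8 => ?_⟩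
  · refine ⟨hH.stride, hH.U, hH.V, ?_, hH.proper.uncolor h, fun v hv c hc1 hcq => ?_,
      fun i hi => ?_, hκ⟩
    · simp [HState.setA_a, hH.output, hxh]
    · simp only [HState.setA_a, Expr.eval, if_true, reduceIte, Nat.reduceEqDiff]
      rw [nbr_uncolor hH.proper hm (by omega)]
      simp only [update_apply, tableIndex_inj hcq (show col h ≤ q by omega)]
      have ht := hH.table v hv c hc1 hcq
      rw [ht]
      unfold EdgeList.Inc
      split_ifs <;> first | rfl | omega
    · rw [update_apply]
      split_ifs
      exacts [Nat.zero_le _, hH.le i hi]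
  · simp [HState.setA_a, h2, h8]

theorem setColor_spec (hF : Fits w E q s ℓ) (hH : Holds E q κ col S) {x y g c : ℕ} (hx : x < 90)
    (hy : y < 90) (hxg : S.v x = g) (hyc : S.v y = c) (hm : g < E.m) (hcκ : c ≤ κ)
    (h0 : col g = 0) (hmiss : ∀ v, E.Inc g v → E.nbr col v c = 0) :
    Det w E.m (setColor x y) (setColor x y).size S fun S' => Holds E q κ (update col g c) S' ∧
      S'.v = S.v ∧ ∀ t, t ≠ 2 → t ≠ 8 → S'.a t = S.a t := by
  have hF1 := hF.table
  have hκ := hH.le'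
  have oky : ∀ S', (Expr.var y).ok w E.m S' := fun _ => hy
  have hw1 : (1 : ℕ) < 2 ^ w := by have := hF.word; omega
  have okx : ∀ {S' : HState}, S'.v = S.v → (Expr.add (.var x) (.lit 1)).ok w E.m S' := by
    intro S' hS'
    simp only [Expr.ok, Expr.eval, hS', hxg]
    omega
  refine Det.write_seq hF.word (i := E.U g * (q + 1) + c) (v := g + 1)
    (hF.cell_ok hH.stride (fstEnd_ok hF hx hxg hm) (oky _) (hH.fstEnd_eval hxg) hyc
      (E.U_lt g hm) (by omega)) (okx rfl) ?_ (by simp [hxg]) ?_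
  · simp only [Expr.eval, hH.fstEnd_eval hxg, hyc, hH.stride]
  have H1 : (S.setA 8 (E.U g * (q + 1) + c) (g + 1)).a 1 = E.V := hH.V
  refine Det.write_seq hF.word (i := E.V g * (q + 1) + c) (v := g + 1)
    (hF.cell_ok (by exact hH.stride) (sndEnd_ok hF hx hxg hm) (oky _)
      (v := E.V g) (by simp [sndEnd, H1, hxg]) hyc
      (E.V_lt g hm) (by omega)) (okx rfl) ?_ (by simp [hxg]) ?_
  · simp only [Expr.eval, sndEnd, H1, HState.setA_v, hxg, hyc, hH.stride]
  refine Det.of_write hF.word ?_ (oky _) ⟨?_, rfl, fun t h2 h8 => ?_⟩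
  · simp only [Expr.ok, Expr.eval, HState.setA_v, hxg, addr]
    norm_num
    omega
  · refine ⟨hH.stride, hH.U, hH.V, ?_, hH.proper.color hmiss, fun v hv c' hc1' hcq => ?_,
      fun i hi => ?_, hκ⟩
    · simp [HState.setA_a, hH.output, hxg, hyc]
    · simp only [HState.setA_a, Expr.eval, if_true, reduceIte, Nat.reduceEqDiff]
      rw [nbr_color hH.proper hm (by omega) h0 hmiss]
      simp only [update_apply, tableIndex_inj hcq (show c ≤ q by omega)]
      have ht := hH.table v hv c' hc1' hcq
      rw [ht]
      unfold EdgeList.Inc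
      split_ifs <;> first | rfl | omega
    · rw [update_apply]
      split_ifs
      exacts [hcκ, hH.le i hi]
  · simp [HState.setA_a, h2, h8]

/-- Puts into variable `y` a color of the palette (array `3`, of length `v 10`) that is missing at the
vertex in variable `x`, or `0` if there is none. -/
def findMissing (x y : ℕ) : Program :=
  .seq (assign y (.lit 0)) (.seq (assign 26 (.var 10))
  (whileE (.var 26) (.seq (assign 26 (.sub (.var 26) (.lit 1)))
    (ifE (cell (.var x) (.get 3 (.var 26))) .skip (assign y (.get 3 (.var 26)))))))

/-- A bound for the time of `findMissing`. -/
def findTime (x y s : ℕ) : ℕ :=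
  (assign y (.lit 0)).size + ((assign 26 (.var 10)).size +
    loopTime (.var 26) (Program.seq (assign 26 (.sub (.var 26) (.lit 1)))
    (ifE (cell (.var x) (.get 3 (.var 26))) .skip (assign y (.get 3 (.var 26))))).size s + 1) + 1

theorem findMissing_spec (hF : Fits w E q s ℓ) (hH : Holds E q κ col S) {x y z : ℕ} (hx : x < 26)
    (hy : y < 26) (hxy : x ≠ y) (hy10 : y ≠ 10) (hy6 : y ≠ 6) (hxz : S.v x = z)
    (hz : z < E.n) {s' : ℕ} (hs : S.v 10 = s') (hs' : s' ≤ s) {pal : ℕ → ℕ} (hpal : S.a 3 = pal)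
    (hpal1 : ∀ j < s', 1 ≤ pal j ∧ pal j ≤ κ) :
    Det w E.m (findMissing x y) (findTime x y s') S fun S' => S'.a = S.a ∧
      (∀ i, i ≠ 26 → i ≠ y → S'.v i = S.v i) ∧
      ((S'.v y = 0 ∧ ∀ j < s', E.nbr col z (pal j) ≠ 0) ∨
        ∃ j < s', S'.v y = pal j ∧ E.nbr col z (pal j) = 0) := by
  have hw := hF.word
  have hF1 := hF.table
  have hκ := hH.le'
  have hw1 : 1 < 2 ^ w := by omega
  unfold findMissing findTime
  refine Det.assign_seq hw (show y < 90 by omega) (by simp) (v := 0) rfl ?_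
  refine Det.assign_seq hw (by omega) (by simp) (v := s') (by simp [hs, hy10.symm]) ?_
  have := Det.of_whileE (m := E.m) hw (e := .var 26) (P := .seq (assign 26 (.sub (.var 26) (.lit 1)))
    (ifE (cell (.var x) (.get 3 (.var 26))) .skip (assign y (.get 3 (.var 26)))))
    (t := (Program.seq (assign 26 (.sub (.var 26) (.lit 1)))
    (ifE (cell (.var x) (.get 3 (.var 26))) .skip (assign y (.get 3 (.var 26))))).size)
    (fun S' => S'.v 26 ≤ s' ∧ S'.a = S.a ∧ (∀ i, i ≠ 26 → i ≠ y → S'.v i = S.v i) ∧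
      ((S'.v y = 0 ∧ ∀ j < s', S'.v 26 ≤ j → E.nbr col z (pal j) ≠ 0) ∨
        ∃ j < s', S'.v y = pal j ∧ E.nbr col z (pal j) = 0)) (fun S' => S'.v 26)
    (S := (S.setV y 0).setV 26 s') (fun _ _ => by simp)
    (Q := fun S' => S'.a = S.a ∧ (∀ i, i ≠ 26 → i ≠ y → S'.v i = S.v i) ∧
      ((S'.v y = 0 ∧ ∀ j < s', E.nbr col z (pal j) ≠ 0) ∨
        ∃ j < s', S'.v y = pal j ∧ E.nbr col z (pal j) = 0)) ?_ ?_ ?_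
  · convert this using 1
    simp
  · rintro S' ⟨h1, h2, h3, h4⟩ hne
    simp only [Expr.eval] at hne
    refine Det.assign_seq hw (by omega) ⟨by simp, hw1⟩ (v := S'.v 26 - 1) rfl ?_
    have hH' : Holds E q κ col (S'.setV 26 (S'.v 26 - 1)) := by
      refine hH.frame ?_ ?_ ?_ ?_ ?_ <;> simp [h2, h3 6 (by omega) hy6.symm]
    have hj : S'.v 26 - 1 < s' := by omega
    have okp : (Expr.get 3 (.var 26)).ok w E.m (S'.setV 26 (S'.v 26 - 1)) := by
      simp [addr]
      omega
    have evp : (Expr.get 3 (.var 26)).eval (S'.setV 26 (S'.v 26 - 1)) = pal (S'.v 26 - 1) := by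
      simp [h2, hpal]
    have evx : (Expr.var x).eval (S'.setV 26 (S'.v 26 - 1)) = z := by
      simp [show x ≠ 26 by omega, h3 x (by omega) hxy, hxz]
    have hp1 := hpal1 _ hj
    have hcell := hH'.cell_eval evx evp hz hp1.1 (by omega)
    refine Det.of_ifE_size hw (hF.cell_ok hH'.stride (show x < 90 by omega) okp evx evp hz (by omega))
      (fun hc => Det.skip ?_) (fun hc => Det.of_assign hw (by omega) okp ?_)
    · rw [hcell] at hc
      refine ⟨⟨by simp; omega, h2, fun i hi hiy => by simp [hi, h3 i hi hiy], ?_⟩, by simp; omega⟩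
      rcases h4 with ⟨h4, h5⟩ | ⟨j, hj, h4, h5⟩
      · refine Or.inl ⟨by simpa [show y ≠ 26 by omega] using h4, fun j hj hle => ?_⟩
        simp only [HState.setV_v, if_true] at hle
        by_cases hjj : j = S'.v 26 - 1
        · rw [hjj]; exact hc
        · exact h5 j hj (by omega)
      · exact Or.inr ⟨j, hj, by simpa [show y ≠ 26 by omega] using h4, h5⟩
    · rw [hcell] at hc
      rw [evp]
      refine ⟨⟨by simp [show 26 ≠ y by omega]; omega, h2,
        fun i hi hiy => by simp [hi, hiy, h3 i hi hiy], ?_⟩, by simp [show 26 ≠ y by omega]; omega⟩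
      exact Or.inr ⟨_, hj, by simp, hc⟩
  · refine ⟨by simp, rfl, fun i hi hiy => by simp [hi, hiy], Or.inl ⟨?_, fun j hj hle => ?_⟩⟩
    · simp [show y ≠ 26 by omega]
    · simp at hle; omega
  · rintro S' ⟨h1, h2, h3, h4⟩ he
    simp only [Expr.eval] at he
    refine ⟨h2, h3, ?_⟩
    rcases h4 with ⟨h4, h5⟩ | h4
    · exact Or.inl ⟨h4, fun j hj => h5 j hj (by omega)⟩
    · exact Or.inr h4

end

end WordRAM

/-! ### Flipping paths, building fans and shifting colors on the word RAM -/

namespace WordRAM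

open Function EdgeList

/-- If variable `x` holds `h + 1`, uncolors edge `h`; if it holds `0`, does nothing. -/
def uncolorIf (x : ℕ) : Program :=
  ifE (.var x) (.seq (assign 25 (.sub (.var x) (.lit 1))) (uncolor 25)) .skip

/-- One step along the alternating path: the uncolored edge `v 23 - 1`, which was reached at vertex
`v 20`, gets the color `v 22`, after the next edge of the path has been uncolored. -/
def flipStep : Program :=
  .seq (assign 24 (.sub (.var 23) (.lit 1)))
  (.seq (assign 28 (otherEnd 24 20))
  (.seq (assign 29 (cell (.var 28) (.var 22)))
  (.seq (uncolorIf 29)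
  (.seq (setColor 24 22)
  (.seq (assign 20 (.var 28))
  (.seq (assign 23 (.var 29))
  (.seq (assign 30 (.var 21))
  (.seq (assign 21 (.var 22))
  (.seq (assign 22 (.var 30))
  (assign 11 (.sub (.var 11) (.lit 1))))))))))))

/-- Flips the alternating path from vertex `v 14` with colors `v 16`, `v 15`, up to `v 11` edges; if it
is longer, the next edge remains uncolored. -/
def flipPath : Program :=
  .seq (assign 20 (.var 14))
  (.seq (assign 21 (.var 16))
  (.seq (assign 22 (.var 15))
  (.seq (assign 23 (cell (.var 14) (.var 16)))
  (.seq (uncolorIf 23)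
  (whileE (.mul (.var 23) (.var 11)) flipStep)))))

/-- A bound for the time of `flipPath`. -/
def flipTime (k : ℕ) : ℕ :=
  (assign 20 (.var 14)).size + ((assign 21 (.var 16)).size + ((assign 22 (.var 15)).size +
    ((assign 23 (cell (.var 14) (.var 16))).size + ((uncolorIf 23).size +
      loopTime (.mul (.var 23) (.var 11)) flipStep.size k + 1) + 1) + 1) + 1) + 1

/-- Puts into variable `18` an index below `v 17` at which array `5` holds `v 16`, or `v 17` if there
is none. -/
def searchFan : Program :=
  .seq (assign 18 (.var 17)) (.seq (assign 26 (.var 17))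
  (whileE (.var 26) (.seq (assign 26 (.sub (.var 26) (.lit 1)))
    (ifE (.add (.sub (.get 5 (.var 26)) (.var 16)) (.sub (.var 16) (.get 5 (.var 26))))
      .skip (assign 18 (.var 26))))))

/-- A bound for the time of `searchFan`. -/
def searchTime (s : ℕ) : ℕ :=
  (assign 18 (.var 17)).size + ((assign 26 (.var 17)).size +
    loopTime (.var 26) (Program.seq (assign 26 (.sub (.var 26) (.lit 1)))
    (ifE (.add (.sub (.get 5 (.var 26)) (.var 16)) (.sub (.var 16) (.get 5 (.var 26))))
      .skip (assign 18 (.var 26)))).size s + 1) + 1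

/-- Extends the fan by the edge `v 23 - 1`. -/
def extendFan : Program :=
  .seq (assign 17 (.add (.var 17) (.lit 1)))
  (.seq (assign 23 (.sub (.var 23) (.lit 1)))
  (.seq (write 4 (.var 17) (.var 23))
  (assign 20 (otherEnd 23 14))))

/-- Decides whether the fan is finished, and extends it otherwise. -/
def decideFan : Program :=
  ifE (.var 16)
    (.seq (assign 23 (cell (.var 14) (.var 16)))
      (ifE (.var 23)
        (ifE (.sub (.var 17) (.var 18)) (assign 19 (.lit 0)) extendFan)
        (assign 19 (.lit 0))))
    (assign 19 (.lit 0))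

/-- One round of the construction of a fan with center `v 14`, at its last leaf `v 20`. -/
def fanStep : Program :=
  .seq (findMissing 20 16) (.seq (write 5 (.var 17) (.var 16)) (.seq searchFan decideFan))

/-- A bound for the time of `fanStep`. -/
def fanStepTime (s : ℕ) : ℕ :=
  findTime 20 16 s + ((write 5 (.var 17) (.var 16)).size + (searchTime s + decideFan.size + 1) + 1)
    + 1

/-- Moves the color of fan edge `v 30 + 1` to fan edge `v 30`. -/
def shiftStep : Program :=
  .seq (assign 24 (.get 4 (.var 30)))
  (.seq (assign 25 (.get 4 (.add (.var 30) (.lit 1))))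
  (.seq (assign 21 (.get 2 (.var 25)))
  (.seq (uncolor 25)
  (.seq (setColor 24 21)
  (assign 30 (.add (.var 30) (.lit 1)))))))

/-- Shifts the colors of the fan, and colors the last shifted edge with `v 16`. The shift ends at
index `v 18`, or at `v 17` if the flipped path ended, at `v 20`, in the leaf with index `v 18`. -/
def shiftFan : Program :=
  .seq (assign 24 (.get 4 (.var 18)))
  (.seq (assign 28 (otherEnd 24 14))
  (.seq (assign 27 (.var 18))
  (.seq (ifE (.add (.sub (.var 28) (.var 20)) (.sub (.var 20) (.var 28)))
    .skip (assign 27 (.var 17)))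
  (.seq (assign 30 (.lit 0))
  (.seq (whileE (.sub (.var 27) (.var 30)) shiftStep)
  (.seq (assign 24 (.get 4 (.var 27)))
  (setColor 24 16)))))))

/-- A bound for the time of `shiftFan`. -/
def shiftTime (k : ℕ) : ℕ :=
  (assign 24 (.get 4 (.var 18))).size + ((assign 28 (otherEnd 24 14)).size +
    ((assign 27 (.var 18)).size +
    ((ifE (.add (.sub (.var 28) (.var 20)) (.sub (.var 20) (.var 28)))
      .skip (assign 27 (.var 17))).size +
    ((assign 30 (.lit 0)).size + (loopTime (.sub (.var 27) (.var 30)) shiftStep.size k +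
    ((assign 24 (.get 4 (.var 27))).size + (setColor 24 16).size + 1) + 1) + 1) + 1) + 1) + 1) + 1

section

variable {w : ℕ} {E : EdgeList} {q κ s ℓ : ℕ} {col : ℕ → ℕ} {S : HState}

theorem loopTime_mono {e : Expr} {t k k' : ℕ} (h : k ≤ k') : loopTime e t k ≤ loopTime e t k' := by
  unfold loopTime
  gcongr

theorem uncolorIf_spec (hF : Fits w E q s ℓ) (hH : Holds E q κ col S) {x g : ℕ} (hx : x < 90)
    (hg : S.v x = g) (h : g ≠ 0 → g - 1 < E.m ∧ col (g - 1) ≠ 0) :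
    Det w E.m (uncolorIf x) (uncolorIf x).size S fun S' =>
      Holds E q κ (if g = 0 then col else update col (g - 1) 0) S' ∧
      (∀ i, i ≠ 25 → S'.v i = S.v i) ∧ ∀ t, t ≠ 2 → t ≠ 8 → S'.a t = S.a t := by
  have hw1 : 1 < 2 ^ w := by have := hF.word; omega
  subst hg
  refine Det.of_ifE_size hF.word (show x < 90 from hx) (fun h0 => ?_) fun h0 => Det.skip ?_
  · simp only [Expr.eval] at h0
    obtain ⟨h1, h2⟩ := h h0
    rw [if_neg h0]
    refine Det.assign_seq hF.word (by omega) ⟨hx, hw1⟩ (v := S.v x - 1) rfl ?_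
    refine (uncolor_spec hF (hH.setV (by omega)) (x := 25) (h := S.v x - 1) (by omega) (by simp)
      h1).mono le_rfl ?_
    rintro S' ⟨h3, h4, h5⟩
    exact ⟨h3, fun i hi => by simp [h4, hi], h5⟩
  · simp only [Expr.eval] at h0
    rw [if_pos h0]
    exact ⟨hH, fun _ _ => rfl, fun _ _ _ => rfl⟩

/-- The loop invariant of `flipPath`, for the initial state `S` and the budget `cnt`. -/
structure FlipInv (E : EdgeList) (q κ : ℕ) (col : ℕ → ℕ) (a b u cnt : ℕ) (S S' : HState) (p : ℕ)
    (C : ℕ → ℕ) : Prop where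
  flipped : E.Flipped col a b u p C
  holds : Holds E q κ C S'
  count : p + S'.v 11 = cnt
  vertex : S'.v 20 = E.vtx col a b u p
  color : S'.v 21 = altColor a b p
  color' : S'.v 22 = altColor a b (p + 1)
  edge : S'.v 23 = E.nbr col (E.vtx col a b u p) (altColor a b p)
  frame_v : ∀ i < 20, i ≠ 11 → S'.v i = S.v i
  frame_a : ∀ t, t ≠ 2 → t ≠ 8 → S'.a t = S.a t

variable {a b u cnt : ℕ}

theorem altColor_mem {lo hi : ℕ} (ha : lo ≤ a ∧ a ≤ hi) (hb : lo ≤ b ∧ b ≤ hi) (i : ℕ) :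
    lo ≤ altColor a b i ∧ altColor a b i ≤ hi := by
  rcases altColor_eq_or a b i with h | h <;> rw [h] <;> assumption

theorem flipStep_spec (hF : Fits w E q s ℓ) (hp : E.Proper col) (ha : 1 ≤ a ∧ a ≤ κ)
    (hb : 1 ≤ b ∧ b ≤ κ) (hu : E.nbr col u a = 0) {S' : HState} {p : ℕ} {C : ℕ → ℕ}
    (hI : FlipInv E q κ col a b u cnt S S' p C) (hne : S'.v 23 * S'.v 11 ≠ 0) :
    Det w E.m flipStep flipStep.size S' fun S'' => (∃ C', FlipInv E q κ col a b u cnt S S'' (p + 1) C')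
      ∧ S''.v 11 < S'.v 11 := by
  have hw := hF.word
  have hw1 : 1 < 2 ^ w := by omega
  have ha0 : a ≠ 0 := by omega
  have hb0 : b ≠ 0 := by omega
  have h23 : S'.v 23 ≠ 0 := fun h => hne (by simp [h])
  have h11 : S'.v 11 ≠ 0 := fun h => hne (by simp [h])
  have hnb := hI.edge ▸ h23
  have hv := hI.flipped.1.succ hnb
  have hub : E.nbr col u b ≠ 0 := hv 0 (by omega)
  have hab : a ≠ b := by rintro rfl; exact hub hu
  have hC : C = update (E.flip col a b u p) (E.pathEdge col a b u p) 0 := by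
    rcases hI.flipped.2 with ⟨h1, -⟩ | ⟨-, h1⟩
    · exact absurd h1 hnb
    · exact h1
  obtain ⟨e1, e2, e3, e4⟩ := hv.edge hp ha0 hb0 (Nat.lt_succ_self p)
  have hCe : C (E.pathEdge col a b u p) = 0 := by rw [hC, update_self]
  have hd := altColor_mem ha hb (p + 1)
  have hκ := hI.holds.le'
  have hyn : E.vtx col a b u (p + 1) < E.n := e3.lt e1
  have hnbC : E.nbr C (E.vtx col a b u (p + 1)) (altColor a b (p + 1)) =
      E.nbr col (E.vtx col a b u (p + 1)) (altColor a b (p + 1)) := by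
    rw [hC]; exact hv.nbr_flip hp ha0 hb0 hab hu
  unfold flipStep
  refine Det.assign_seq hw (by omega) ⟨by simp, hw1⟩ (v := E.pathEdge col a b u p)
    (by simp [hI.edge, pathEdge]) ?_
  have H1 : Holds E q κ C (S'.setV 24 (E.pathEdge col a b u p)) := hI.holds.setV (by omega)
  refine Det.assign_seq hw (by omega) (H1.otherEnd_ok hF (by omega) (by omega)
    (i := E.pathEdge col a b u p) (by simp) e1) (v := E.vtx col a b u (p + 1))
    (H1.otherEnd_eval (i := E.pathEdge col a b u p) (v := E.vtx col a b u p) (by simp)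
      (by simp [hI.vertex])) ?_
  have H2 := H1.setV (x := 28) (y := E.vtx col a b u (p + 1)) (by omega)
  refine Det.assign_seq hw (by omega) (hF.cell_ok H2.stride (by simp) (by simp)
    (v := E.vtx col a b u (p + 1)) (c := altColor a b (p + 1)) (by simp) (by simp [hI.color'])
    hyn (by omega)) (H2.cell_eval (by simp) (by simp [hI.color']) hyn hd.1 (by omega)) ?_
  rw [hnbC]
  have H3 := H2.setV (x := 29)
    (y := E.nbr col (E.vtx col a b u (p + 1)) (altColor a b (p + 1))) (by omega)
  have hspec := fun h0 => nbr_spec (v := E.vtx col a b u (p + 1)) H3.proper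
    (altColor_ne_zero ha0 hb0 (p + 1)) h0
  rw [hnbC] at hspec
  refine Det.seq (uncolorIf_spec hF H3
    (g := E.nbr col (E.vtx col a b u (p + 1)) (altColor a b (p + 1))) (by omega) (by simp)
    (fun h0 => ⟨(hspec h0).1, by rw [(hspec h0).2.2]; omega⟩)) ?_
  rintro S₁ ⟨H4, hv4, ha4⟩
  have hnear : E.nbr C (E.vtx col a b u p) (altColor a b (p + 1)) = 0 := by
    rw [hC]; exact hv.missing_near hp ha0 hb0 hab hu
  refine Det.seq (setColor_spec hF H4 (x := 24) (y := 22) (g := E.pathEdge col a b u p)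
    (c := altColor a b (p + 1)) (by omega) (by omega) (by simp [hv4])
    (by simp [hv4, hI.color']) e1 hd.2 ?_ ?_) ?_
  · split_ifs with h0
    · exact hCe
    · rw [update_apply, hCe, ite_self]
  · intro z hz
    split_ifs with h0
    · rcases e2.eq_or_eq_other hz with rfl | hz'
      · exact hnear
      · have : z = E.vtx col a b u (p + 1) := hz'
        rw [this, hnbC]; exact h0
    · rw [nbr_uncolor H3.proper (hspec h0).1 (by omega)]
      split_ifs with hif
      · rfl
      · rcases e2.eq_or_eq_other hz with rfl | hz'
        · exact hnear
        · have : z = E.vtx col a b u (p + 1) := hz'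
          rw [this] at hif
          exact absurd ⟨(hspec h0).2.1, (hspec h0).2.2⟩ hif
  rintro S₂ ⟨H5, hv5, ha5⟩
  refine Det.assign_seq hw (by omega) (by simp) (v := E.vtx col a b u (p + 1))
    (by simp [hv5, hv4]) ?_
  refine Det.assign_seq hw (by omega) (by simp)
    (v := E.nbr col (E.vtx col a b u (p + 1)) (altColor a b (p + 1))) (by simp [hv5, hv4]) ?_
  refine Det.assign_seq hw (by omega) (by simp) (v := altColor a b p)
    (by simp [hv5, hv4, hI.color]) ?_
  refine Det.assign_seq hw (by omega) (by simp) (v := altColor a b (p + 1))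
    (by simp [hv5, hv4, hI.color']) ?_
  refine Det.assign_seq hw (by omega) (by simp) (v := altColor a b p) (by simp) ?_
  refine Det.of_assign hw (by omega) ⟨by simp, hw1⟩ ⟨⟨update (if
    E.nbr col (E.vtx col a b u (p + 1)) (altColor a b (p + 1)) = 0 then C else
      update C (E.nbr col (E.vtx col a b u (p + 1)) (altColor a b (p + 1)) - 1) 0)
      (E.pathEdge col a b u p) (altColor a b (p + 1)),
    ⟨hv, ?_⟩, ?_, ?_, ?_, ?_, ?_, ?_, ?_, ?_⟩, ?_⟩
  · have hfs := hv.flip_succ hp ha0 hb0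
    rw [← hC] at hfs
    by_cases h0 : E.nbr col (E.vtx col a b u (p + 1)) (altColor a b (p + 1)) = 0
    · refine Or.inl ⟨h0, ?_⟩
      rw [if_pos h0, hfs]
    · refine Or.inr ⟨h0, ?_⟩
      rw [if_neg h0, update_comm, hfs]
      · rfl
      · intro he
        have h1 := (hspec h0).2.2
        rw [he, hCe] at h1
        omega
  · exact H5.frame (by simp) rfl rfl rfl rfl
  · have := hI.count
    simp [hv5, hv4]
    omega
  · simp
  · simp
  · simp only [HState.setV_v]
    norm_num
    exact altColor_congr (by omega)
  · simp
  · intro i hi hi11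
    have := hI.frame_v i hi hi11
    simp [hi11, hv5, hv4, show i ≠ 20 by omega, show i ≠ 21 by omega, show i ≠ 22 by omega,
      show i ≠ 23 by omega, show i ≠ 24 by omega, show i ≠ 25 by omega, show i ≠ 28 by omega,
      show i ≠ 29 by omega, show i ≠ 30 by omega, this]
  · intro t h2 h8
    simp [ha5 t h2 h8, ha4 t h2 h8, hI.frame_a t h2 h8]
  · simp [hv5, hv4]
    omega

theorem flipPath_spec (hF : Fits w E q s ℓ) (hH : Holds E q κ col S) (h14 : S.v 14 = u)
    (h15 : S.v 15 = a) (h16 : S.v 16 = b) (h11 : S.v 11 = cnt) (hcnt : cnt ≤ ℓ) (hun : u < E.n)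
    (ha : 1 ≤ a ∧ a ≤ κ) (hb : 1 ≤ b ∧ b ≤ κ) (hu : E.nbr col u a = 0) :
    Det w E.m flipPath (flipTime cnt) S fun S' => ∃ p C, E.Flipped col a b u p C ∧
      (E.nbr col (E.vtx col a b u p) (altColor a b p) ≠ 0 → p = cnt) ∧
      Holds E q κ C S' ∧ S'.v 20 = E.vtx col a b u p ∧
      (∀ i < 20, i ≠ 11 → S'.v i = S.v i) ∧ ∀ t, t ≠ 2 → t ≠ 8 → S'.a t = S.a t := by
  have hw := hF.word
  have hp := hH.proper
  have hκ := hH.le'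
  have ha0 : a ≠ 0 := by omega
  have hb0 : b ≠ 0 := by omega
  unfold flipPath flipTime
  refine Det.assign_seq hw (by omega) (by simp) (v := u) (by simp [h14]) ?_
  refine Det.assign_seq hw (by omega) (by simp) (v := b) (by simp [h16]) ?_
  refine Det.assign_seq hw (by omega) (by simp) (v := a) (by simp [h15]) ?_
  have H1 : Holds E q κ col (((S.setV 20 u).setV 21 b).setV 22 a) :=
    hH.frame (by simp) rfl rfl rfl rfl
  refine Det.assign_seq hw (by omega) (hF.cell_ok H1.stride (by simp) (by simp)
    (v := u) (c := b) (by simp [h14]) (by simp [h16])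
    hun (by omega)) (H1.cell_eval (by simp [h14]) (by simp [h16]) hun hb.1 (by omega)) ?_
  have H2 := H1.setV (x := 23) (y := E.nbr col u b) (by omega)
  have hspec := fun h0 => nbr_spec (v := u) hp hb0 h0
  refine Det.seq (uncolorIf_spec hF H2 (g := E.nbr col u b) (by omega) (by simp)
    (fun h0 => ⟨(hspec h0).1, by rw [(hspec h0).2.2]; omega⟩)) ?_
  rintro S₁ ⟨H3, hv3, ha3⟩
  have := Det.of_whileE (m := E.m) hw (e := .mul (.var 23) (.var 11)) (P := flipStep)
    (t := flipStep.size)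
    (fun S' => ∃ p C, FlipInv E q κ col a b u cnt S S' p C) (fun S' => S'.v 11)
    (S := S₁) ?_ (Q := fun S' => ∃ p C, E.Flipped col a b u p C ∧
      (E.nbr col (E.vtx col a b u p) (altColor a b p) ≠ 0 → p = cnt) ∧
      Holds E q κ C S' ∧ S'.v 20 = E.vtx col a b u p ∧
      (∀ i < 20, i ≠ 11 → S'.v i = S.v i) ∧ ∀ t, t ≠ 2 → t ≠ 8 → S'.a t = S.a t) ?_ ?_ ?_
  · simpa only [hv3 11 (by omega), HState.setV_v, show (11 : ℕ) ≠ 23 by omega,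
      show (11 : ℕ) ≠ 22 by omega, show (11 : ℕ) ≠ 21 by omega, show (11 : ℕ) ≠ 20 by omega,
      if_false, h11] using this
  · rintro S' ⟨p, C, hI⟩
    have h1 : S'.v 23 ≤ E.m := by
      rw [hI.edge]; exact hH.nbr_le (altColor_ne_zero ha0 hb0 p)
    have h2 : S'.v 11 ≤ ℓ := by have := hI.count; omega
    refine ⟨by simp, by simp, (Nat.mul_le_mul h1 h2).trans_lt hF.product⟩
  · rintro S' ⟨p, C, hI⟩ hne
    exact (flipStep_spec hF hp ha hb hu hI hne).mono le_rfl fun S'' h => ⟨⟨_, h.1⟩, h.2⟩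
  · refine ⟨0, _, ⟨fun i hi => by omega, ?_⟩, H3, by simp [hv3, h11], by simp [hv3]; rfl,
      by simp [hv3, altColor], by simp [hv3, altColor], by simp [hv3, altColor]; rfl, ?_, ?_⟩
    · by_cases h0 : E.nbr col u b = 0
      · exact Or.inl ⟨h0, by rw [if_pos h0, flip_zero]⟩
      · exact Or.inr ⟨h0, by rw [if_neg h0, flip_zero]; rfl⟩
    · intro i hi hi11
      simp [hv3 i (by omega), show i ≠ 20 by omega, show i ≠ 21 by omega, show i ≠ 22 by omega,
        show i ≠ 23 by omega]
    · intro t h2 h8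
      simp [ha3 t h2 h8]
  · rintro S' ⟨p, C, hI⟩ he
    refine ⟨p, C, hI.flipped, fun hne => ?_, hI.holds, hI.vertex, hI.frame_v, hI.frame_a⟩
    have hc := hI.count
    simp only [Expr.eval, mul_eq_zero] at he
    rw [hI.edge] at he
    omega

end

end WordRAM

namespace WordRAM

open Function EdgeList

section

variable {w : ℕ} {E : EdgeList} {q κ s ℓ : ℕ} {col : ℕ → ℕ} {S : HState} {a b u cnt s' : ℕ}
  {pal : ℕ → ℕ}

theorem searchFan_spec (hF : Fits w E q s ℓ) {k : ℕ} (hk : S.v 17 = k) (hks : k ≤ s')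
    (hs' : s' ≤ s) (h16 : S.v 16 = b)
    (hb : b < 2 ^ w) (hfc : ∀ j < k, S.a 5 j < 2 ^ w) :
    Det w E.m searchFan (searchTime s') S fun S' => S'.a = S.a ∧
      (∀ i, i ≠ 18 → i ≠ 26 → S'.v i = S.v i) ∧
      ((S'.v 18 = k ∧ ∀ j < k, S.a 5 j ≠ b) ∨ (S'.v 18 < k ∧ S.a 5 (S'.v 18) = b)) := by
  have hw := hF.word
  have hF1 := hF.table
  have hw1 : 1 < 2 ^ w := by omega
  unfold searchFan searchTime
  refine Det.assign_seq hw (by omega) (by simp) (v := k) (by simp [hk]) ?_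
  refine Det.assign_seq hw (by omega) (by simp) (v := k) (by simp [hk]) ?_
  refine (Det.of_whileE (m := E.m) hw
    (t := (Program.seq (assign 26 (.sub (.var 26) (.lit 1)))
    (ifE (.add (.sub (.get 5 (.var 26)) (.var 16)) (.sub (.var 16) (.get 5 (.var 26))))
      .skip (assign 18 (.var 26)))).size)
    (fun S' => S'.v 26 ≤ k ∧ S'.a = S.a ∧ (∀ i, i ≠ 18 → i ≠ 26 → S'.v i = S.v i) ∧
      ((S'.v 18 = k ∧ ∀ j < k, S'.v 26 ≤ j → S.a 5 j ≠ b) ∨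
        (S'.v 18 < k ∧ S.a 5 (S'.v 18) = b))) (fun S' => S'.v 26)
    (fun _ _ => by simp) ?_ ?_ ?_).mono (loopTime_mono (by simpa using hks)) fun _ => id
  · rintro S' ⟨h1, h2, h3, h4⟩ hne
    simp only [Expr.eval] at hne
    refine Det.assign_seq hw (by omega) ⟨by simp, hw1⟩ (v := S'.v 26 - 1) rfl ?_
    have evp : (Expr.get 5 (.var 26)).eval (S'.setV 26 (S'.v 26 - 1)) = S.a 5 (S'.v 26 - 1) := by
      simp [h2]
    have okp : (Expr.get 5 (.var 26)).ok w E.m (S'.setV 26 (S'.v 26 - 1)) := by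
      simp [addr]
      omega
    have ev16 : (Expr.var 16).eval (S'.setV 26 (S'.v 26 - 1)) = b := by
      simp [h3 16 (by omega) (by omega), h16]
    have hlt := hfc (S'.v 26 - 1) (by omega)
    refine Det.of_ifE_size hw ⟨⟨okp, by simp⟩, ⟨by simp, okp⟩, ?_⟩
      (fun hc => Det.skip ?_) (fun hc => Det.of_assign hw (by omega) (by simp) ?_)
    · simp only [Expr.eval] at evp ev16 ⊢
      rw [evp, ev16]; omega
    · simp only [Expr.eval] at hc evp ev16
      rw [evp, ev16] at hc
      refine ⟨⟨by simp; omega, h2, fun i hi hiy => by simp [hiy, h3 i hi hiy], ?_⟩,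
        by simp; omega⟩
      rcases h4 with ⟨h4, h5⟩ | ⟨h4, h5⟩
      · refine Or.inl ⟨by simpa using h4, fun j hj hle => ?_⟩
        simp only [HState.setV_v, if_true] at hle
        by_cases hjj : j = S'.v 26 - 1
        · rw [hjj]; omega
        · exact h5 j hj (by omega)
      · exact Or.inr ⟨by simpa using h4, by simpa using h5⟩
    · simp only [Expr.eval] at hc evp ev16
      rw [evp, ev16] at hc
      refine ⟨⟨by simp; omega, h2, fun i hi hiy => by simp [hi, hiy, h3 i hi hiy], ?_⟩,
        by simp; omega⟩
      exact Or.inr ⟨by simp; omega, by simp; omega⟩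
  · exact ⟨by simp, rfl, fun i hi hiy => by simp [hi, hiy],
      Or.inl ⟨by simp, fun j hj hle => by simp at hle; omega⟩⟩
  · rintro S' ⟨h1, h2, h3, h4⟩ he
    simp only [Expr.eval] at he
    refine ⟨h2, h3, ?_⟩
    rcases h4 with ⟨h4, h5⟩ | h4
    · exact Or.inl ⟨h4, fun j hj => h5 j hj (by omega)⟩
    · exact Or.inr h4

/-- The final states of the construction of a fan whose last index is `k`. -/
def FanEnd (E : EdgeList) (col : ℕ → ℕ) (u s' : ℕ) (pal : ℕ → ℕ) (S' : HState) : Prop :=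
  (S'.v 16 = 0 ∧ ∀ j < s', E.nbr col (E.other (S'.a 4 (S'.v 17)) u) (pal j) ≠ 0) ∨
  ((∃ j < s', S'.v 16 = pal j) ∧ E.nbr col (E.other (S'.a 4 (S'.v 17)) u) (S'.v 16) = 0 ∧
    ((S'.v 18 = S'.v 17 ∧ E.nbr col u (S'.v 16) = 0) ∨
      (S'.v 18 < S'.v 17 ∧ S'.a 5 (S'.v 18) = S'.v 16)))

/-- The invariant of the construction of a fan, for the initial state `S`. -/
structure FanInv (E : EdgeList) (q κ : ℕ) (col : ℕ → ℕ) (u s' : ℕ) (pal : ℕ → ℕ) (f : ℕ)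
    (S S' : HState) : Prop where
  holds : Holds E q κ col S'
  frame_v : ∀ i < 16, S'.v i = S.v i
  frame_a : ∀ t, t ≠ 4 → t ≠ 5 → S'.a t = S.a t
  fan : E.IsFan col u (S'.v 17) (S'.a 4) (S'.a 5)
  start : S'.a 4 0 = f
  le : S'.v 17 ≤ s'
  palette : ∀ i < S'.v 17, ∃ j < s', S'.a 5 i = pal j
  flag : S'.v 19 = 0 ∨ S'.v 19 = 1
  leaf : S'.v 19 = 1 → S'.v 20 = E.other (S'.a 4 (S'.v 17)) u
  done : S'.v 19 = 0 → FanEnd E col u s' pal S'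

theorem le_of_injOn {k s' : ℕ} {c pal : ℕ → ℕ} (h : ∀ i < k, ∃ j < s', c i = pal j)
    (hinj : ∀ i < k, ∀ j < k, c i = c j → i = j) : k ≤ s' := by
  classical
  have h1 : (Finset.range k).image c ⊆ (Finset.range s').image pal := by
    intro x hx
    simp only [Finset.mem_image, Finset.mem_range] at hx ⊢
    obtain ⟨i, hi, rfl⟩ := hx
    obtain ⟨j, hj, h2⟩ := h i hi
    exact ⟨j, hj, h2.symm⟩
  have h2 := Finset.card_le_card h1
  rw [Finset.card_image_of_injOn] at h2
  · simpa using h2.trans Finset.card_image_le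
  · intro i hi j hj hij
    exact hinj i (by simpa using hi) j (by simpa using hj) hij

theorem Fits.color_lt (hF : Fits w E q s ℓ) (hn : 0 < E.n) {c : ℕ} (hc : c ≤ q) : c < 2 ^ w := by
  have h1 := hF.table
  have h2 := tableIndex_lt hn hc
  omega

theorem fanStep_spec (hF : Fits w E q s ℓ) (h14 : S.v 14 = u) (h10 : S.v 10 = s') (hs' : s' ≤ s)
    (hpal : S.a 3 = pal) (hpal1 : ∀ j < s', 1 ≤ pal j ∧ pal j ≤ κ) (hun : u < E.n) {f : ℕ}
    {S' : HState} (hI : FanInv E q κ col u s' pal f S S') (hgo : S'.v 19 ≠ 0) :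
    Det w E.m fanStep (fanStepTime s') S' fun S'' => FanInv E q κ col u s' pal f S S'' ∧
      S''.v 19 * (s' + 1 - S''.v 17) < S'.v 19 * (s' + 1 - S'.v 17) := by
  have hw := hF.word
  have hF1 := hF.table
  have hw1 : 1 < 2 ^ w := by omega
  have hp := hI.holds.proper
  have hκ := hI.holds.le'
  have h19 : S'.v 19 = 1 := hI.flag.resolve_left hgo
  have hks := hI.le
  have hfan := hI.fan
  have hleaf := hI.leaf h19
  have hstart := hI.start
  have hpalf := hI.palette
  obtain ⟨m1, m2⟩ := hfan.mem hp le_rfl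
  generalize hk : S'.v 17 = k at *
  have hzn : E.other (S'.a 4 k) u < E.n := m2.other.lt m1
  have hn : 0 < E.n := by omega
  unfold fanStep fanStepTime
  refine Det.seq (findMissing_spec hF hI.holds (x := 20) (y := 16) (by omega) (by omega)
    (by omega) (by omega) (by omega) hleaf hzn (s' := s') (by rw [hI.frame_v 10 (by omega), h10])
    hs' (pal := pal) (by rw [hI.frame_a 3 (by omega) (by omega), hpal]) hpal1) ?_
  rintro S₁ ⟨ha1, hv1, hb1⟩
  have hb2 : S₁.v 16 ≤ κ := by
    rcases hb1 with ⟨h, -⟩ | ⟨j, hj, h, -⟩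
    · omega
    · rw [h]; exact (hpal1 j hj).2
  have hb3 : S₁.v 16 < 2 ^ w := hF.color_lt hn (by omega)
  generalize hb : S₁.v 16 = b at *
  have hk1 : S₁.v 17 = k := by rw [hv1 17 (by omega) (by omega), hk]
  refine Det.write_seq hw (i := k) (v := b) ⟨by simp, by omega, by omega, ?_⟩ (by simp)
    (by simp [hk1]) (by simp [hb]) ?_
  · simp [hk1, addr]; omega
  refine Det.seq (searchFan_spec hF (k := k) (b := b) (by simp [hk1]) hks hs' (by simp [hb]) hb3
    ?_) ?_
  · intro j hj
    rw [HState.setA_a_same, update_of_ne hj.ne, ha1]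
    obtain ⟨i, hi, h⟩ := hpalf j hj
    rw [h]
    exact hF.color_lt hn ((hpal1 i hi).2.trans hκ)
  rintro S₂ ⟨ha2, hv2, hj2⟩
  have hv3 : ∀ i, i ≠ 16 → i ≠ 18 → i ≠ 26 → S₂.v i = S'.v i := fun i h1 h2 h3 => by
    rw [hv2 i h2 h3]
    exact hv1 i h3 h1
  have hb4 : S₂.v 16 = b := by rw [hv2 16 (by omega) (by omega)]; exact hb
  have hk2 : S₂.v 17 = k := by rw [hv3 17 (by omega) (by omega) (by omega), hk]
  have ha3 : ∀ t, t ≠ 5 → S₂.a t = S'.a t := fun t h => by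
    rw [ha2, HState.setA_a_ne _ _ _ h, ha1]
  have ha5 : S₂.a 5 = update (S'.a 5) k b := by rw [ha2, HState.setA_a_same, ha1]
  have hj3 : (S₂.v 18 = k ∧ ∀ j < k, S'.a 5 j ≠ b) ∨ (S₂.v 18 < k ∧ S'.a 5 (S₂.v 18) = b) := by
    rcases hj2 with ⟨h1, h2⟩ | ⟨h1, h2⟩
    · refine Or.inl ⟨h1, fun j hj => ?_⟩
      have := h2 j hj
      rwa [HState.setA_a_same, update_of_ne hj.ne, ha1] at this
    · refine Or.inr ⟨h1, ?_⟩
      rwa [HState.setA_a_same, update_of_ne h1.ne, ha1] at h2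
  have hu2 : S₂.v 14 = u := by
    rw [hv3 14 (by omega) (by omega) (by omega), hI.frame_v 14 (by omega), h14]
  have hfan2 : E.IsFan col u k (S₂.a 4) (S₂.a 5) := by
    rw [ha3 4 (by omega), ha5]
    exact hfan.congr (fun _ _ => rfl) fun i hi => update_of_ne hi.ne _ _
  have H2 : Holds E q κ col S₂ := hI.holds.frame (hv3 6 (by omega) (by omega) (by omega))
    (ha3 0 (by omega)) (ha3 1 (by omega)) (ha3 2 (by omega)) (ha3 8 (by omega))
  -- The states in which the construction ends.
  have halt : ∀ S₃ : HState, (∀ i, i ≠ 19 → i ≠ 23 → S₃.v i = S₂.v i) → S₃.a = S₂.a →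
      S₃.v 19 = 0 → FanEnd E col u s' pal S₂ → FanInv E q κ col u s' pal f S S₃ ∧
      S₃.v 19 * (s' + 1 - S₃.v 17) < S'.v 19 * (s' + 1 - k) := by
    intro S₃ hv ha h0 hend
    have e17 : S₃.v 17 = k := by rw [hv 17 (by omega) (by omega), hk2]
    refine ⟨⟨H2.frame (hv 6 (by omega) (by omega)) (by rw [ha]) (by rw [ha]) (by rw [ha])
      (by rw [ha]), fun i hi => ?_, fun t h4 h5 => ?_, ?_, ?_, ?_, ?_, Or.inl h0, ?_, fun _ => ?_⟩,
      ?_⟩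
    · rw [hv i (by omega) (by omega), hv3 i (by omega) (by omega) (by omega), hI.frame_v i hi]
    · rw [ha, ha3 t h5, hI.frame_a t h4 h5]
    · rw [e17, ha]; exact hfan2
    · rw [ha, ha3 4 (by omega), hstart]
    · rw [e17]; exact hks
    · rw [e17, ha, ha5]
      intro i hi
      rw [update_of_ne hi.ne]
      exact hpalf i hi
    · intro h; omega
    · unfold FanEnd at hend ⊢
      rwa [ha, hv 16 (by omega) (by omega), hv 17 (by omega) (by omega),
        hv 18 (by omega) (by omega)]
    · rw [h0, h19]; omega
  have ev16 : ∀ y, (Expr.var 16).eval (S₂.setV 23 y) = b := fun y => by simp [hb4]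
  unfold decideFan
  refine Det.of_ifE_size hw (by simp) (fun hc => ?_) fun hc => ?_
  swap
  · simp only [Expr.eval, hb4] at hc
    refine Det.of_assign hw (by omega) (by simp) (halt _ (fun i h1 _ => by simp [h1]) rfl
      (by simp) ?_)
    rcases hb1 with ⟨-, h⟩ | ⟨j, hj, h, -⟩
    · refine Or.inl ⟨by rw [hb4, hc], ?_⟩
      rw [ha3 4 (by omega), hk2]
      exact h
    · have := hpal1 j hj
      omega
  simp only [Expr.eval, hb4] at hc
  obtain ⟨jb, hjb, hbj, hbl⟩ : ∃ j < s', b = pal j ∧ E.nbr col (E.other (S'.a 4 k) u) b = 0 := by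
    rcases hb1 with ⟨h, -⟩ | ⟨j, hj, h, h'⟩
    · exact absurd h hc
    · exact ⟨j, hj, h, by rw [h]; exact h'⟩
  refine Det.assign_seq hw (by omega) (hF.cell_ok H2.stride (by simp) (by simp)
    (v := u) (c := b) (by simp [hu2]) (by simp [hb4]) hun (by omega))
    (H2.cell_eval (v := u) (c := b) (by simp [hu2]) (by simp [hb4]) hun (by omega) (by omega)) ?_
  refine Det.of_ifE_size hw (by simp) (fun hc2 => ?_) fun hc2 => ?_
  swap
  · simp only [Expr.eval, HState.setV_v, if_true] at hc2
    refine Det.of_assign hw (by omega) (by simp) (halt _ (fun i h1 h2 => by simp [h1, h2]) rfl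
      (by simp) (Or.inr ⟨⟨jb, hjb, by rw [hb4, hbj]⟩, ?_, ?_⟩))
    · rw [hb4, ha3 4 (by omega), hk2]; exact hbl
    · rw [hk2, hb4]
      refine Or.inl ⟨(hj3.resolve_right ?_).1, hc2⟩
      rintro ⟨h1, h2⟩
      have := hfan.next _ h1
      rw [h2, hc2] at this
      omega
  simp only [Expr.eval, HState.setV_v, if_true] at hc2
  refine Det.of_ifE_size hw (by simp) (fun hc3 => ?_) fun hc3 => ?_
  · simp only [Expr.eval, HState.setV_v] at hc3
    norm_num [hk2] at hc3
    have hc4 : S₂.v 18 < k := by omega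
    refine Det.of_assign hw (by omega) (by simp) (halt _ (fun i h1 h2 => by simp [h1, h2]) rfl
      (by simp) (Or.inr ⟨⟨jb, hjb, by rw [hb4, hbj]⟩, ?_, ?_⟩))
    · rw [hb4, ha3 4 (by omega), hk2]; exact hbl
    · rw [hk2, hb4, ha5]
      refine Or.inr ⟨hc4, ?_⟩
      rw [update_of_ne hc4.ne]
      exact (hj3.resolve_left fun h => by omega).2
  · simp only [Expr.eval, HState.setV_v] at hc3
    norm_num [hk2] at hc3
    obtain ⟨-, hnew⟩ := hj3.resolve_right fun h => by omega
    obtain ⟨g1, g2, g3⟩ := nbr_spec hp hc hc2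
    have hpalk : ∀ i < k + 1, ∃ j < s', update (S'.a 5) k b i = pal j := by
      intro i hi
      by_cases hik : i = k
      · rw [hik, update_self]; exact ⟨jb, hjb, hbj⟩
      · rw [update_of_ne hik]; exact hpalf i (by omega)
    have hinj : ∀ i < k + 1, ∀ j < k + 1,
        update (S'.a 5) k b i = update (S'.a 5) k b j → i = j := by
      intro i hi j hj hij
      by_cases hik : i = k <;> by_cases hjk : j = k
      · omega
      · rw [hik, update_self, update_of_ne hjk] at hij
        exact absurd hij.symm (hnew j (by omega))
      · rw [hjk, update_self, update_of_ne hik] at hij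
        exact absurd hij (hnew i (by omega))
      · rw [update_of_ne hik, update_of_ne hjk] at hij
        exact hfan.inj i (by omega) j (by omega) hij
    have hle : k + 1 ≤ s' := le_of_injOn hpalk hinj
    unfold extendFan
    refine Det.assign_seq hw (by omega) ⟨by simp, hw1, ?_⟩ (v := k + 1) (by simp [hk2]) ?_
    · simp [hk2]; omega
    refine Det.assign_seq hw (by omega) ⟨by simp, hw1⟩ (v := E.nbr col u b - 1) (by simp) ?_
    refine Det.write_seq hw (i := k + 1) (v := E.nbr col u b - 1) ⟨by simp, by omega, by omega, ?_⟩
      (by simp) (by simp) (by simp) ?_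
    · simp [addr]; omega
    have H3 : Holds E q κ col ((((S₂.setV 23 (E.nbr col u b)).setV 17 (k + 1)).setV 23
        (E.nbr col u b - 1)).setA 4 (k + 1) (E.nbr col u b - 1)) :=
      H2.frame (by simp) (HState.setA_a_ne _ _ _ (by omega)) (HState.setA_a_ne _ _ _ (by omega))
        (HState.setA_a_ne _ _ _ (by omega)) (HState.setA_a_ne _ _ _ (by omega))
    refine Det.of_assign hw (by omega) (H3.otherEnd_ok hF (by omega) (by omega)
      (i := E.nbr col u b - 1) (by simp) g1) ?_
    rw [H3.otherEnd_eval (i := E.nbr col u b - 1) (v := u) (by simp) (by simp [hu2])]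
    have a4 : (((((S₂.setV 23 (E.nbr col u b)).setV 17 (k + 1)).setV 23
        (E.nbr col u b - 1)).setA 4 (k + 1) (E.nbr col u b - 1)).setV 20
        (E.other (E.nbr col u b - 1) u)).a 4 = update (S'.a 4) (k + 1) (E.nbr col u b - 1) := by
      simp [ha3]
    have a5 : (((((S₂.setV 23 (E.nbr col u b)).setV 17 (k + 1)).setV 23
        (E.nbr col u b - 1)).setA 4 (k + 1) (E.nbr col u b - 1)).setV 20
        (E.other (E.nbr col u b - 1) u)).a 5 = update (S'.a 5) k b := by
      simp [HState.setA_a_ne, ha5]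
    refine ⟨⟨H3.setV (by omega), fun i hi => ?_, fun t h4 h5 => ?_, ?_, ?_, ?_, ?_, ?_, fun _ => ?_,
      fun h0 => ?_⟩, ?_⟩
    · simp [show i ≠ 20 by omega, show i ≠ 23 by omega, show i ≠ 17 by omega,
        hv3 i (by omega) (by omega) (by omega), hI.frame_v i hi]
    · simp [HState.setA_a_ne _ _ _ h4, ha3 t h5, hI.frame_a t h4 h5]
    · rw [a4, a5]
      have e17 : (((((S₂.setV 23 (E.nbr col u b)).setV 17 (k + 1)).setV 23
        (E.nbr col u b - 1)).setA 4 (k + 1) (E.nbr col u b - 1)).setV 20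
        (E.other (E.nbr col u b - 1) u)).v 17 = k + 1 := by simp
      rw [e17]
      refine ⟨?_, ?_, ?_, fun i hi => ?_, fun i hi => ?_, fun i hi => ?_, hinj⟩
      · rw [update_of_ne (by omega)]; exact hfan.lt_zero
      · rw [update_of_ne (by omega)]; exact hfan.inc_zero
      · rw [update_of_ne (by omega)]; exact hfan.uncolored
      · by_cases hik : i = k
        · rw [hik, update_self]; exact hc
        · rw [update_of_ne hik]; exact hfan.pos i (by omega)
      · by_cases hik : i = k
        · rw [hik, update_self, update_self]; omega
        · rw [update_of_ne hik, update_of_ne (by omega)]; exact hfan.next i (by omega)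
      · by_cases hik : i = k
        · rw [hik, update_self, update_of_ne (by omega)]; exact hbl
        · rw [update_of_ne hik, update_of_ne (by omega)]; exact hfan.missing i (by omega)
    · rw [a4, update_of_ne (by omega), hstart]
    · simpa using hle
    · rw [a5]
      intro i hi
      exact hpalk i (by simpa using hi)
    · simp [hv3, h19]
    · rw [a4]; simp
    · simp [hv3, h19] at h0
    · simp [hv3, h19]; omega

end
end WordRAM

namespace WordRAM

open Function EdgeList

section

variable {w : ℕ} {E : EdgeList} {q κ s ℓ : ℕ} {col : ℕ → ℕ} {S : HState} {a b u cnt s' : ℕ}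
  {pal : ℕ → ℕ}

/-- Builds a fan with center `v 14` that starts with the uncolored edge `v 13`. -/
def buildFan : Program :=
  .seq (write 4 (.lit 0) (.var 13))
  (.seq (assign 17 (.lit 0))
  (.seq (assign 19 (.lit 1))
  (.seq (assign 20 (sndEnd 13))
  (whileE (.var 19) fanStep))))

/-- A bound for the time of `buildFan`. -/
def buildTime (s : ℕ) : ℕ :=
  (write 4 (.lit 0) (.var 13)).size + ((assign 17 (.lit 0)).size + ((assign 19 (.lit 1)).size +
    ((assign 20 (sndEnd 13)).size + loopTime (.var 19) (fanStepTime s) (s + 1) + 1) + 1) + 1) + 1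

theorem buildFan_spec (hF : Fits w E q s ℓ) (hH : Holds E q κ col S) {f : ℕ} (h13 : S.v 13 = f)
    (hf : f < E.m) (hf0 : col f = 0) (h14 : S.v 14 = E.U f) (h10 : S.v 10 = s') (hs' : s' ≤ s)
    (hpal : S.a 3 = pal) (hpal1 : ∀ j < s', 1 ≤ pal j ∧ pal j ≤ κ) :
    Det w E.m buildFan (buildTime s') S fun S' =>
      FanInv E q κ col (E.U f) s' pal f S S' ∧ FanEnd E col (E.U f) s' pal S' := by
  have hw := hF.word
  have hw1 : 1 < 2 ^ w := by omega
  have hF1 := hF.table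
  unfold buildFan buildTime
  refine Det.write_seq hw (i := 0) (v := f) (by simp [addr]; omega) (by simp) rfl
    (by simp [h13]) ?_
  refine Det.assign_seq hw (by omega) (by simp) (v := 0) rfl ?_
  refine Det.assign_seq hw (by omega) hw1 (v := 1) rfl ?_
  have H1 : Holds E q κ col (((S.setA 4 0 f).setV 17 0).setV 19 1) :=
    hH.frame (by simp) (by simp [HState.setA_a_ne]) (by simp [HState.setA_a_ne])
      (by simp [HState.setA_a_ne]) (by simp [HState.setA_a_ne])
  refine Det.assign_seq hw (by omega) (sndEnd_ok hF (i := f) (by omega) (by simp [h13]) hf)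
    (v := E.V f) (H1.sndEnd_eval (by simp [h13])) ?_
  refine Det.of_whileE hw (e := .var 19) (FanInv E q κ col (E.U f) s' pal f S)
    (fun S' => S'.v 19 * (s' + 1 - S'.v 17)) (fun _ _ => by simp) (fun S' hI hne =>
      fanStep_spec hF h14 h10 hs' hpal hpal1 (E.U_lt f hf) hI hne) ?_
      (fun S' hI h0 => ⟨hI, hI.done h0⟩) |>.mono (loopTime_mono (by simp)) fun _ => id
  refine ⟨H1.setV (by omega), fun i hi => ?_, fun t h4 h5 => ?_, ?_, by simp, by simp, by simp,
    by simp, fun _ => ?_, by simp⟩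
  · simp [show i ≠ 17 by omega, show i ≠ 19 by omega, show i ≠ 20 by omega]
  · simp [HState.setA_a_ne _ _ _ h4]
  · refine ⟨?_, ?_, ?_, ?_, ?_, ?_, ?_⟩ <;> simp [hf, hf0, EdgeList.Inc]
  · simp [EdgeList.other]

/-- The loop invariant of `shiftFan`, for the coloring `col'` at the start of the loop. -/
structure ShiftInv (E : EdgeList) (q κ : ℕ) (col' : ℕ → ℕ) (t : ℕ) (S S' : HState)
    (C : ℕ → ℕ) : Prop where
  holds : Holds E q κ C S'
  shift : IsShift col' (S.a 4) (S'.v 30) C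
  le : S'.v 30 ≤ t
  last : S'.v 27 = t
  frame_v : ∀ i < 20, S'.v i = S.v i
  frame_a : ∀ t, t ≠ 2 → t ≠ 8 → S'.a t = S.a t

theorem shiftStep_spec (hF : Fits w E q s ℓ) (hp : E.Proper col) {k t : ℕ} {fc col' : ℕ → ℕ}
    (hfan : E.IsFan col u k (S.a 4) fc) (hks : k ≤ s) (htk : t ≤ k)
    (hs : E.Shiftable col' u t b (S.a 4)) {S' : HState} {C : ℕ → ℕ}
    (hI : ShiftInv E q κ col' t S S' C) (hne : S'.v 30 < t) :
    Det w E.m shiftStep shiftStep.size S' fun S'' => (∃ C', ShiftInv E q κ col' t S S'' C') ∧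
      t - S''.v 30 < t - S'.v 30 := by
  have hw := hF.word
  have hw1 : 1 < 2 ^ w := by omega
  have hF1 := hF.table
  have hκ := hI.holds.le'
  have hCp := hI.holds.proper
  have ha4 := hI.frame_a 4 (by omega) (by omega)
  obtain ⟨c1, c2, c3⟩ := hI.shift.step hp hfan hs htk hne hCp
  have hlast := hI.last
  have hhole := hI.shift.hole
  generalize hi : S'.v 30 = i at *
  obtain ⟨m1, m2⟩ := hfan.mem hp (show i ≤ k by omega)
  obtain ⟨m3, m4⟩ := hfan.mem hp (show i + 1 ≤ k by omega)
  have hc0 : C (S.a 4 (i + 1)) ≠ 0 := by rw [c1]; exact hs.colored i hne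
  have hcle := hI.holds.le _ m3
  unfold shiftStep
  refine Det.assign_seq hw (by omega) ⟨by simp, by omega, by omega, ?_⟩ (v := S.a 4 i)
    (by simp [hi, ha4]) ?_
  · simp [hi, addr]; omega
  refine Det.assign_seq hw (by omega) ⟨⟨by simp, hw1, ?_⟩, by omega, by omega, ?_⟩
    (v := S.a 4 (i + 1)) (by simp [hi, ha4]) ?_
  · simp [hi]; omega
  · simp [hi, addr]; omega
  refine Det.assign_seq hw (by omega) ⟨by simp, by omega, fun _ => by simpa using m3, ?_⟩
    (v := C (S.a 4 (i + 1))) (by simp [hI.holds.output]) ?_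
  · simp only [Expr.eval, HState.setV_v, if_true, addr]; norm_num; omega
  have H1 : Holds E q κ C (((S'.setV 24 (S.a 4 i)).setV 25 (S.a 4 (i + 1))).setV 21
    (C (S.a 4 (i + 1)))) := hI.holds.frame (by simp) rfl rfl rfl rfl
  refine Det.seq (uncolor_spec hF H1 (x := 25) (h := S.a 4 (i + 1)) (by omega) (by simp) m3) ?_
  rintro S₁ ⟨H2, hv2, ha2⟩
  refine Det.seq (setColor_spec hF H2 (x := 24) (y := 21) (g := S.a 4 i)
    (c := C (S.a 4 (i + 1))) (by omega) (by omega) (by simp [hv2]) (by simp [hv2]) m1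
    hcle ?_ c2) ?_
  · rw [update_apply, hhole, ite_self]
  rintro S₂ ⟨H3, hv3, ha3⟩
  refine Det.of_assign hw (by omega) ⟨by simp, hw1, ?_⟩ ?_
  · simp [hv3, hv2, hi]; omega
  · have e30 : (S₂.setV 30 ((Expr.add (.var 30) (.lit 1)).eval S₂)).v 30 = i + 1 := by
      simp [hv3, hv2, hi]
    refine ⟨⟨_, H3.setV (by omega), ?_, ?_, ?_, fun x hx => ?_, fun x h2 h8 => ?_⟩, ?_⟩
    · rw [e30]; exact c3
    · rw [e30]; exact hne
    · simp [hv3, hv2, hlast]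
    · simp [hv3, hv2, show x ≠ 30 by omega, show x ≠ 25 by omega, show x ≠ 24 by omega,
        show x ≠ 21 by omega, hI.frame_v x hx]
    · simp [ha3 x h2 h8, ha2 x h2 h8, hI.frame_a x h2 h8]
    · rw [e30]; omega

theorem shiftFan_spec (hF : Fits w E q s ℓ) (hp : E.Proper col) {k j t z : ℕ} {fc col' : ℕ → ℕ}
    (hfan : E.IsFan col u k (S.a 4) fc) (hks' : k ≤ s') (hks : s' ≤ s) (H : Holds E q κ col' S)
    (h14 : S.v 14 = u) (h16 : S.v 16 = b) (h17 : S.v 17 = k) (h18 : S.v 18 = j) (h20 : S.v 20 = z)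
    (hj : j ≤ k) (hb : 1 ≤ b ∧ b ≤ κ) (ht : t = if z = E.other (S.a 4 j) u then k else j)
    (hs : E.Shiftable col' u t b (S.a 4)) (hz : z < E.n) :
    Det w E.m shiftFan (shiftTime s') S fun S' => ∃ C, Holds E q κ C S' ∧
      (∀ e, C e = 0 ↔ col' e = 0 ∧ e ≠ S.a 4 0) ∧ (∀ i < 20, S'.v i = S.v i) ∧
      ∀ x, x ≠ 2 → x ≠ 8 → S'.a x = S.a x := by
  have hw := hF.word
  have hw1 : 1 < 2 ^ w := by omega
  have hF1 := hF.table
  have hFn := hF.n_lt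
  have hp' := H.proper
  obtain ⟨m1, m2⟩ := hfan.mem hp hj
  have htk : t ≤ k := by rw [ht]; split_ifs <;> omega
  obtain ⟨m3, m4⟩ := hfan.mem hp htk
  have hzn := m2.other.lt m1
  unfold shiftFan shiftTime
  refine Det.assign_seq hw (by omega) ⟨by simp, by omega, by omega, ?_⟩ (v := S.a 4 j)
    (by simp [h18]) ?_
  · simp [h18, addr]; omega
  have H1 := H.setV (x := 24) (y := S.a 4 j) (by omega)
  refine Det.assign_seq hw (by omega) (H1.otherEnd_ok hF (i := S.a 4 j) (by omega) (by omega)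
    (by simp) m1) (v := E.other (S.a 4 j) u) (H1.otherEnd_eval (by simp) (by simp [h14])) ?_
  refine Det.assign_seq hw (by omega) (by simp) (v := j) (by simp [h18]) ?_
  set S₁ := ((S.setV 24 (S.a 4 j)).setV 28 (E.other (S.a 4 j) u)).setV 27 j with hS₁
  refine Det.seq (Q := fun S' => S'.v 27 = t ∧ (∀ i, i ≠ 27 → S'.v i = S₁.v i) ∧ S'.a = S₁.a)
    (Det.of_ifE_size hw ?_ (fun hc => Det.skip ?_) (fun hc => Det.of_assign hw (by omega) (by simp) ?_)) ?_
  · refine ⟨⟨by simp, by simp⟩, ⟨by simp, by simp⟩, ?_⟩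
    simp [hS₁, h20]
    omega
  · simp [hS₁, h20] at hc
    refine ⟨?_, fun _ _ => rfl, rfl⟩
    rw [ht, if_neg (by omega)]
    simp [hS₁]
  · simp [hS₁, h20] at hc
    refine ⟨?_, fun i hi => by simp [hi], rfl⟩
    rw [ht, if_pos (by omega)]
    simp [hS₁, h17]
  rintro S₂ ⟨h27, hv2, ha2⟩
  refine Det.assign_seq hw (by omega) (by simp) (v := 0) rfl ?_
  have H2 : Holds E q κ col' (S₂.setV 30 0) := H.frame (by simp [hv2, hS₁]) (by simp [ha2, hS₁])
    (by simp [ha2, hS₁]) (by simp [ha2, hS₁]) (by simp [ha2, hS₁])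
  refine Det.seq (Q := fun S' => ∃ C, ShiftInv E q κ col' t S S' C ∧ S'.v 30 = t) ?_ ?_
  · refine (Det.of_whileE hw (fun S' => ∃ C, ShiftInv E q κ col' t S S' C)
      (fun S' => t - S'.v 30) (fun _ _ => by simp) ?_ ?_ ?_).mono
      (loopTime_mono (k := t) (by omega)) fun _ => id
    · rintro S' ⟨C, hI⟩ hne
      have := hI.last
      simp only [Expr.eval, this] at hne
      exact shiftStep_spec hF hp hfan (by omega) htk hs hI (by omega)
    · refine ⟨col', H2, ⟨by simp, by simpa using hs.uncolored, fun _ _ => rfl⟩, by simp,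
        by simp [h27], fun i hi => ?_, fun x _ _ => by simp [ha2, hS₁]⟩
      simp [show i ≠ 30 by omega, hv2 i (by omega), hS₁, show i ≠ 27 by omega,
        show i ≠ 28 by omega, show i ≠ 24 by omega]
    · rintro S' ⟨C, hI⟩ h0
      have := hI.last
      simp only [Expr.eval, this] at h0
      exact ⟨C, hI, by have := hI.le; omega⟩
  rintro S₃ ⟨C, hI, h30⟩
  have hsh := hI.shift
  rw [h30] at hsh
  obtain ⟨c1, c2⟩ := hsh.finish hp hfan hs htk (b := b) (by omega)
  refine Det.assign_seq hw (by omega) ⟨by simp, by omega, by omega, ?_⟩ (v := S.a 4 t)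
    (by simp [hI.last, hI.frame_a 4]) ?_
  · simp [hI.last, addr]; omega
  refine (setColor_spec hF (hI.holds.setV (x := 24) (y := S.a 4 t) (by omega)) (x := 24) (y := 16)
    (g := S.a 4 t) (c := b) (by omega) (by omega) (by simp)
    (by simp [hI.frame_v 16, h16]) m3 hb.2 hsh.hole c1).mono le_rfl ?_
  rintro S' ⟨H3, hv3, ha3⟩
  refine ⟨_, H3, c2, fun i hi => ?_, fun x h2 h8 => ?_⟩
  · simp [hv3, show i ≠ 24 by omega, hI.frame_v i hi]
  · simp [ha3 x h2 h8, hI.frame_a x h2 h8]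

/-- Tries to color the edge `v 13` with the help of the palette: builds a fan, flips an alternating
path up to `v 11` edges, and shifts the fan. -/
def process : Program :=
  .seq (assign 14 (fstEnd 13))
  (.seq (findMissing 14 15)
  (ifE (.var 15)
    (.seq buildFan (ifE (.var 16) (.seq flipPath shiftFan) .skip)) .skip))

/-- A bound for the time of `process`. -/
def processTime (s ℓ : ℕ) : ℕ :=
  (assign 14 (fstEnd 13)).size + (findTime 14 15 s + (((Expr.var 15).comp 100).size +
    (buildTime s + (((Expr.var 16).comp 100).size + (flipTime ℓ + shiftTime s + 1 + 1) + 2) + 1 + 1)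
      + 2) + 1) + 1

/-- All palette colors are present at some vertex that is `u` or a neighbor of `u`. -/
def Blocked (E : EdgeList) (col : ℕ → ℕ) (u s : ℕ) (pal : ℕ → ℕ) : Prop :=
  ∃ z < E.n, (z = u ∨ ∃ i < E.m, E.Inc i u ∧ z = E.other i u) ∧ ∀ j < s, E.nbr col z (pal j) ≠ 0

/-- The edge `g` is where the flip of an alternating path from `u` with two palette colors is cut off
after `cnt` edges. -/
def CutAt (E : EdgeList) (col : ℕ → ℕ) (u s : ℕ) (pal : ℕ → ℕ) (cnt g : ℕ) : Prop :=
  ∃ j₁ < s, ∃ j₂ < s, E.nbr col u (pal j₁) = 0 ∧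
    E.Valid col (pal j₁) (pal j₂) u (cnt + 1) ∧ g = E.pathEdge col (pal j₁) (pal j₂) u cnt

/-- The effect of `process` on the set of uncolored edges. -/
structure Outcome (E : EdgeList) (col : ℕ → ℕ) (f s : ℕ) (pal : ℕ → ℕ) (cnt : ℕ)
    (C : ℕ → ℕ) : Prop where
  keep : ∀ e, e ≠ f → col e = 0 → C e = 0
  new : (∀ e, C e = 0 → col e = 0 ∧ e ≠ f) ∨
    (Blocked E col (E.U f) s pal ∧ ∀ e, C e = 0 → col e = 0) ∨
    ∃ g, CutAt E col (E.U f) s pal cnt g ∧ ∀ e, C e = 0 → (col e = 0 ∧ e ≠ f) ∨ e = g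

/-- Processing an edge keeps the coloring proper. It colors the edge, except if some vertex near it is
blocked; the only edge that may lose its color is the one where the path was cut off. -/
theorem process_spec (hF : Fits w E q s ℓ) (hH : Holds E q κ col S) {f : ℕ} (h13 : S.v 13 = f)
    (hf : f < E.m) (hf0 : col f = 0) (h11 : S.v 11 = cnt) (hcnt : cnt ≤ ℓ) (h10 : S.v 10 = s')
    (hs' : s' ≤ s) (hpal : S.a 3 = pal) (hpal1 : ∀ j < s', 1 ≤ pal j ∧ pal j ≤ κ) :
    Det w E.m process (processTime s' ℓ) S fun S' => ∃ C, Holds E q κ C S' ∧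
      Outcome E col f s' pal cnt C ∧ (∀ i < 13, i ≠ 11 → S'.v i = S.v i) ∧
      ∀ t, t ≠ 2 → t ≠ 4 → t ≠ 5 → t ≠ 8 → S'.a t = S.a t := by
  have hw := hF.word
  have hp := hH.proper
  have hU := E.U_lt f hf
  unfold process processTime
  refine Det.assign_seq hw (by omega) (fstEnd_ok hF (by omega) h13 hf) (hH.fstEnd_eval h13) ?_
  have H1 := hH.setV (x := 14) (y := E.U f) (by omega)
  refine Det.seq (findMissing_spec hF H1 (x := 14) (y := 15) (by omega) (by omega)
    (by omega) (by omega) (by omega) (z := E.U f) (by simp) hU (s' := s') (by simp [h10])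
    hs' (pal := pal) (by simp [hpal]) hpal1) ?_
  rintro S₁ ⟨ha1, hv1, hb1⟩
  have hv1' : ∀ i < 14, S₁.v i = S.v i := fun i hi => by
    simp [hv1 i (by omega) (by omega), show i ≠ 14 by omega]
  have H2 : Holds E q κ col S₁ := hH.frame (hv1' 6 (by omega)) (by simp [ha1]) (by simp [ha1])
    (by simp [ha1]) (by simp [ha1])
  refine Det.of_ifE hw (by simp) (fun hc => ?_) fun hc => Det.skip ?_ |>.mono (by omega) fun _ => id
  swap
  · simp only [Expr.eval] at hc
    refine ⟨col, H2, ⟨fun _ _ h => h, Or.inr (Or.inl ⟨⟨E.U f, hU, Or.inl rfl, ?_⟩, fun _ h => h⟩)⟩,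
      fun i hi _ => hv1' i (by omega), fun t _ _ _ _ => by simp [ha1]⟩
    rcases hb1 with ⟨-, h⟩ | ⟨j, hj, h, -⟩
    · exact h
    · have := hpal1 j hj
      omega
  simp only [Expr.eval] at hc
  obtain ⟨ja, hja, haj, hua⟩ := hb1.resolve_left fun h => hc h.1
  refine Det.mono (t := buildTime s' + (((Expr.var 16).comp 100).size +
    (flipTime ℓ + shiftTime s' + 1 + 1) + 2) + 1) ?_ (by omega) fun _ => id
  refine Det.seq (buildFan_spec hF H2 (f := f) (by rw [hv1' 13 (by omega), h13]) hf hf0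
    (by simp [hv1]) (s' := s') (by rw [hv1' 10 (by omega), h10]) hs' (pal := pal)
    (by simp [ha1, hpal]) hpal1) ?_
  rintro S₂ ⟨hI, hend⟩
  have hv2 : ∀ i < 14, S₂.v i = S.v i := fun i hi => by
    rw [hI.frame_v i (by omega), hv1' i hi]
  have hfan := hI.fan
  refine Det.of_ifE hw (by simp) (fun hc2 => ?_) fun hc2 => Det.skip ?_ |>.mono (by omega)
    fun _ => id
  swap
  · simp only [Expr.eval] at hc2
    obtain ⟨m1, m2⟩ := hfan.mem hp le_rfl
    refine ⟨col, hI.holds, ⟨fun _ _ h => h, Or.inr (Or.inl ⟨⟨_, m2.other.lt m1,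
      Or.inr ⟨_, m1, m2, rfl⟩, ?_⟩, fun _ h => h⟩)⟩,
      fun i hi _ => hv2 i (by omega), fun t _ h4 h5 _ => by rw [hI.frame_a t h4 h5, ha1]; rfl⟩
    rcases hend with ⟨-, h⟩ | ⟨⟨j, hj, h⟩, -, -⟩
    · exact h
    · have := hpal1 j hj
      omega
  simp only [Expr.eval] at hc2
  obtain ⟨⟨jb, hjb, hbj⟩, hbl, hbend⟩ := hend.resolve_left fun h => hc2 h.1
  have hκa := hpal1 ja hja
  have hκb := hpal1 jb hjb
  have h15 : S₂.v 15 = pal ja := by rw [hI.frame_v 15 (by omega), haj]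
  refine Det.mono (t := flipTime cnt + shiftTime s' + 1) ?_ ?_ fun _ => id
  swap
  · have : flipTime cnt ≤ flipTime ℓ := by
      unfold flipTime
      have := loopTime_mono (e := .mul (.var 23) (.var 11)) (t := flipStep.size) hcnt
      omega
    omega
  refine Det.seq (flipPath_spec hF hI.holds (u := E.U f) (a := pal ja) (b := pal jb) (cnt := cnt)
    (by rw [hI.frame_v 14 (by omega), hv1 14 (by omega) (by omega)]; simp) h15 hbj
    (by rw [hv2 11 (by omega), h11]) hcnt hU hκa hκb hua) ?_
  rintro S₃ ⟨p, col', hfl, hpc, H3, h20, hv3, ha3⟩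
  have ha0 : pal ja ≠ 0 := by omega
  have hb0 : pal jb ≠ 0 := by omega
  have hzn : E.vtx col (pal ja) (pal jb) (E.U f) p < E.n := by
    cases p with
    | zero => exact hU
    | succ p =>
      obtain ⟨e1, -, e3, -⟩ := hfl.1.edge hp ha0 hb0 (Nat.lt_succ_self p)
      exact e3.lt e1
  have e4 : S₃.a 4 = S₂.a 4 := ha3 4 (by omega) (by omega)
  have e0 : S₃.a 4 0 = f := by rw [e4]; exact hI.start
  -- If `b` is missing at the center, then nothing was flipped.
  have hp0 : E.nbr col (E.U f) (pal jb) = 0 → col' = col := by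
    intro h0
    have h1 : p = 0 := by
      by_contra hp1
      exact hfl.1 0 (by omega) h0
    subst h1
    rcases hfl.2 with ⟨-, h1⟩ | ⟨h1, -⟩
    · rw [h1, flip_zero]
    · exact absurd h0 h1
  have hs : ∃ t, S₂.v 18 ≤ S₂.v 17 ∧ (t = if E.vtx col (pal ja) (pal jb) (E.U f) p =
      E.other (S₃.a 4 (S₂.v 18)) (E.U f) then S₂.v 17 else S₂.v 18) ∧
      E.Shiftable col' (E.U f) t (pal jb) (S₃.a 4) := by
    rw [e4, ← hbj]
    rw [← hbj] at hp0
    rcases hbend with ⟨h1, h2⟩ | ⟨h1, h2⟩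
    · refine ⟨S₂.v 17, h1.le, ?_, ?_⟩
      · rw [h1, ite_self]
      · rw [hp0 h2]
        exact hfan.shiftable_self hp hbl h2
    · exact ⟨_, h1.le, rfl, hfan.shiftable hp ha0 hc2 hbl h1 h2 hua (by rw [hbj]; exact hfl)⟩
  obtain ⟨t, hj, ht, hs⟩ := hs
  refine (shiftFan_spec hF hp (k := S₂.v 17) (fc := S₂.a 5) (u := E.U f) (b := pal jb)
    (by rw [e4]; exact hfan) hI.le hs' H3 ?_ ?_ (hv3 17 (by omega) (by omega))
    (hv3 18 (by omega) (by omega)) h20 hj hκb ht hs hzn).mono le_rfl ?_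
  · rw [hv3 14 (by omega) (by omega), hI.frame_v 14 (by omega), hv1 14 (by omega) (by omega)]; simp
  · rw [hv3 16 (by omega) (by omega), hbj]
  rintro S₄ ⟨C, H4, hC, hv4, ha4⟩
  refine ⟨C, H4, ⟨fun e he h0 => (hC e).2 ⟨?_, by rwa [e0]⟩, ?_⟩, fun i hi hi11 => ?_,
    fun t h2 h4 h5 h8 => ?_⟩
  · rw [hfl.apply_of_ne hp ha0 hb0 (by omega) (by omega), h0]
  · rw [e0] at hC
    by_cases h0 : E.nbr col (E.U f) (pal jb) = 0
    · exact Or.inl fun e he => by rw [← hp0 h0]; exact (hC e).1 he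
    have hab : pal ja ≠ pal jb := fun h => h0 (h ▸ hua)
    by_cases h1 : E.nbr col (E.vtx col (pal ja) (pal jb) (E.U f) p)
        (altColor (pal ja) (pal jb) p) = 0
    · refine Or.inl fun e he => ⟨?_, ((hC e).1 he).2⟩
      exact (hfl.eq_zero hp ha0 hb0 ((hC e).1 he).1).resolve_right fun h => h.1 h1
    · obtain rfl := hpc h1
      refine Or.inr (Or.inr ⟨_, ⟨ja, hja, jb, hjb, hua, hfl.1.succ h1, rfl⟩, fun e he => ?_⟩)
      rcases hfl.eq_zero hp ha0 hb0 ((hC e).1 he).1 with h | ⟨-, h⟩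
      · exact Or.inl ⟨h, ((hC e).1 he).2⟩
      · exact Or.inr h.symm
  · rw [hv4 i (by omega), hv3 i (by omega) hi11, hv2 i (by omega)]
  · rw [ha4 t h2 h8, ha3 t h2 h8, hI.frame_a t h4 h5, ha1]; rfl

end
end WordRAM

/-! ### Uncolored edges at a vertex -/

namespace EdgeList

open Function Finset WordRAM

variable (E : EdgeList)

/-- The number of edges at `v`. -/
def deg (v : ℕ) : ℕ := #{i ∈ range E.m | E.Inc i v}

/-- The number of edges at `v` among the first `r` edges of the queue `perm`. -/
def load (r : ℕ) (perm : ℕ → ℕ) (v : ℕ) : ℕ := #{k ∈ range r | E.Inc (perm k) v}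

/-- The number of uncolored edges at `v`. -/
def holes (col : ℕ → ℕ) (v : ℕ) : ℕ := #{i ∈ range E.m | E.Inc i v ∧ col i = 0}

/-- The number of uncolored edges at `v` that are not among the first `r` edges of the queue. -/
def excess (r : ℕ) (perm col : ℕ → ℕ) (v : ℕ) : ℕ := E.holes col v - E.load r perm v

/-- The queue: the first `r` entries of `perm` are distinct uncolored edges. -/
structure Queue (r : ℕ) (perm col : ℕ → ℕ) : Prop where
  lt : ∀ k < r, perm k < E.m
  inj : ∀ k < r, ∀ k' < r, perm k = perm k' → k = k'
  uncolored : ∀ k < r, col (perm k) = 0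

/-- The queue after the `k`-th of `r` entries has been replaced by the last one. -/
def pop (r k : ℕ) (perm : ℕ → ℕ) : ℕ → ℕ := update perm k (perm (r - 1))

variable {E} {r k : ℕ} {perm col C : ℕ → ℕ} {v : ℕ}

theorem load_eq_sum : E.load r perm v = ∑ k ∈ range r, if E.Inc (perm k) v then 1 else 0 :=
  card_filter _ _

theorem sum_pop (hk : k < r) (g : ℕ → ℕ) :
    (∑ i ∈ range (r - 1), g (pop r k perm i)) + g (perm k) = ∑ i ∈ range r, g (perm i) := by
  obtain ⟨r, rfl⟩ : ∃ r', r = r' + 1 := ⟨r - 1, by omega⟩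
  rw [sum_range_succ]
  simp only [pop, Nat.add_sub_cancel]
  rcases Nat.lt_succ_iff_lt_or_eq.1 hk with h | rfl
  · rw [← add_sum_erase _ _ (mem_range.2 h), update_self,
      ← add_sum_erase (range r) (fun i => g (perm i)) (mem_range.2 h)]
    rw [sum_congr rfl fun i hi => by rw [update_of_ne (ne_of_mem_erase hi)]]
    omega
  · rw [sum_congr rfl fun i hi => by rw [update_of_ne (mem_range.1 hi).ne]]

theorem load_pop (hk : k < r) :
    E.load (r - 1) (pop r k perm) v + (if E.Inc (perm k) v then 1 else 0) = E.load r perm v := by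
  rw [load_eq_sum, load_eq_sum, sum_pop hk fun e => if E.Inc e v then 1 else 0]

theorem Queue.load_le_holes (h : E.Queue r perm col) : E.load r perm v ≤ E.holes col v := by
  unfold load holes
  refine card_le_card_of_injOn perm (fun k hk => ?_) fun k hk k' hk' hkk => ?_
  · simp only [coe_filter, mem_range, Set.mem_ofPred_eq] at hk ⊢
    exact ⟨h.lt k hk.1, hk.2, h.uncolored k hk.1⟩
  · simp only [coe_filter, mem_range, Set.mem_ofPred_eq] at hk hk'
    exact h.inj k hk.1 k' hk'.1 hkk

theorem holes_le_deg : E.holes col v ≤ E.deg v :=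
  card_le_card fun i hi => by simp only [mem_filter] at hi ⊢; exact ⟨hi.1, hi.2.1⟩

theorem Queue.load_le_deg (h : E.Queue r perm col) : E.load r perm v ≤ E.deg v :=
  h.load_le_holes.trans holes_le_deg

theorem Queue.pop (h : E.Queue r perm col) (hk : k < r)
    (hC : ∀ e, e ≠ perm k → col e = 0 → C e = 0) : E.Queue (r - 1) (pop r k perm) C := by
  have key : ∀ i < r - 1, ∃ j < r, EdgeList.pop r k perm i = perm j ∧ j ≠ k ∧
      ((i = k ∧ j = r - 1) ∨ (i ≠ k ∧ j = i)) := by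
    intro i hi
    by_cases hik : i = k
    · refine ⟨r - 1, by omega, ?_, by omega, Or.inl ⟨hik, rfl⟩⟩
      rw [EdgeList.pop, hik, update_self]
    · refine ⟨i, by omega, ?_, by omega, Or.inr ⟨hik, rfl⟩⟩
      rw [EdgeList.pop, update_of_ne hik]
  refine ⟨fun i hi => ?_, fun i hi i' hi' hii => ?_, fun i hi => ?_⟩
  · obtain ⟨j, hj, h1, -⟩ := key i hi
    rw [h1]; exact h.lt j hj
  · obtain ⟨j, hj, h1, -, h3⟩ := key i hi
    obtain ⟨j', hj', h1', -, h3'⟩ := key i' hi'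
    have := h.inj j hj j' hj' (by rw [← h1, ← h1', hii])
    omega
  · obtain ⟨j, hj, h1, h2, -⟩ := key i hi
    rw [h1]
    exact hC _ (fun h0 => h2 (h.inj _ hj _ hk h0)) (h.uncolored j hj)

theorem holes_le_of_imp {f : ℕ} (h : ∀ e, C e = 0 → (col e = 0 ∧ e ≠ f)) (hf : f < E.m)
    (hf0 : col f = 0) : E.holes C v + (if E.Inc f v then 1 else 0) ≤ E.holes col v := by
  split_ifs with hi
  · refine card_lt_card ((ssubset_iff_of_subset fun i hi => ?_).2 ⟨f, ?_, ?_⟩)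
    · simp only [mem_filter] at hi ⊢
      exact ⟨hi.1, hi.2.1, (h i hi.2.2).1⟩
    · simp [hf, hi, hf0]
    · simp only [mem_filter, not_and]
      exact fun _ _ h0 => (h f h0).2 rfl
  · refine (add_zero _).le.trans (card_le_card fun i hi => ?_)
    simp only [mem_filter] at hi ⊢
    exact ⟨hi.1, hi.2.1, (h i hi.2.2).1⟩

/-- The `k`-th edge of the queue may cause a new uncolored edge at `v`, which is not in the queue: it is
an edge at `v` and some vertex near it is blocked, or a path that starts at it is cut off at `v`. -/
def Hit (E : EdgeList) (perm col : ℕ → ℕ) (s : ℕ) (pal : ℕ → ℕ) (v cnt k : ℕ) : Prop :=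
  (E.Inc (perm k) v ∧ Blocked E col (E.U (perm k)) s pal) ∨
    ∃ g, CutAt E col (E.U (perm k)) s pal cnt g ∧ E.Inc g v

open Classical in
/-- A new uncolored edge at `v` is caused by a blocked vertex, or by a path that was cut off at `v`. -/
theorem excess_pop_le {s cnt : ℕ} {pal : ℕ → ℕ} (h : E.Queue r perm col) (hk : k < r)
    (hO : Outcome E col (perm k) s pal cnt C) (v : ℕ) :
    E.excess (r - 1) (pop r k perm) C v ≤ E.excess r perm col v +
      if E.Hit perm col s pal v cnt k then 1 else 0 := by
  have hl := load_pop (E := E) (perm := perm) (v := v) hk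
  have h1 := h.load_le_holes (v := v)
  have h2 := (h.pop hk hO.keep).load_le_holes (v := v)
  have hf := h.lt k hk
  have hf0 := h.uncolored k hk
  unfold excess
  rcases hO.new with h3 | ⟨h3, h4⟩ | ⟨g, h3, h4⟩
  · have := holes_le_of_imp h3 hf hf0 (v := v)
    omega
  · have h5 : E.holes C v ≤ E.holes col v := card_le_card fun i hi => by
      simp only [mem_filter] at hi ⊢
      exact ⟨hi.1, hi.2.1, h4 i hi.2.2⟩
    by_cases hi : E.Inc (perm k) v
    · rw [if_pos (c := E.Hit perm col s pal v cnt k) (Or.inl ⟨hi, h3⟩)]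
      rw [if_pos hi] at hl
      omega
    · rw [if_neg hi] at hl
      omega
  · have h5 := holes_le_of_imp (C := fun e => if e = g then 1 else C e) (f := perm k)
      (fun e he => (h4 e (by simpa [ite_eq_iff] using he : e ≠ g ∧ C e = 0).2).resolve_right
        (by simpa [ite_eq_iff] using he : e ≠ g ∧ C e = 0).1) hf hf0 (v := v)
    have h6 : E.holes C v ≤ E.holes (fun e => if e = g then 1 else C e) v +
        if E.Inc g v then 1 else 0 := by
      split_ifs with hi
      · refine (card_le_card (t := insert g {i ∈ range E.m | E.Inc i v ∧
          (fun e => if e = g then 1 else C e) i = 0}) fun i hi => ?_).trans (card_insert_le _ _)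
        simp only [mem_filter, mem_insert] at hi ⊢
        by_cases hig : i = g
        · exact Or.inl hig
        · exact Or.inr ⟨hi.1, hi.2.1, by rw [if_neg hig]; exact hi.2.2⟩
      · refine le_trans (card_le_card fun i hj => ?_) (add_zero _).ge
        simp only [mem_filter] at hj ⊢
        refine ⟨hj.1, hj.2.1, ?_⟩
        have hig : i ≠ g := by rintro rfl; exact hi hj.2.1
        simpa [hig] using hj.2.2
    by_cases hi : E.Inc g v
    · rw [if_pos (c := E.Hit perm col s pal v cnt k) (Or.inr ⟨g, h3, hi⟩)]
      rw [if_pos hi] at h6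
      omega
    · rw [if_neg hi] at h6
      omega

open Classical in
/-- For fixed positions in the palette, a fixed parity and a fixed end of the cut edge, the cut edges
at `v` determine the start and the length of the path. -/
theorem card_cut_le_of_parity {ℓ a b D : ℕ} (hp : E.Proper col) (ha : a ≠ 0) (hb : b ≠ 0)
    (hD : ∀ z, E.load r perm z ≤ D) (v par δ : ℕ) (hδ : δ ≤ 1) :
    #{x ∈ range ℓ ×ˢ range r | E.nbr col (E.U (perm x.2)) a = 0 ∧
      E.Valid col a b (E.U (perm x.2)) (x.1 + 1) ∧ x.1 % 2 = par ∧
      E.vtx col a b (E.U (perm x.2)) (x.1 + δ) = v} ≤ D := by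
  set F := {x ∈ range ℓ ×ˢ range r | E.nbr col (E.U (perm x.2)) a = 0 ∧
      E.Valid col a b (E.U (perm x.2)) (x.1 + 1) ∧ x.1 % 2 = par ∧
      E.vtx col a b (E.U (perm x.2)) (x.1 + δ) = v} with hF
  rcases F.eq_empty_or_nonempty with h0 | ⟨x₀, h0⟩
  · simp [h0]
  · have huniq : ∀ x ∈ F, E.U (perm x.2) = E.U (perm x₀.2) ∧ x.1 = x₀.1 := by
      intro x hx
      simp only [hF, mem_filter] at h0 hx
      obtain ⟨h1, h2⟩ := Valid.unique hp ha hb hx.2.1 h0.2.1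
        (hx.2.2.1.mono (show x.1 + δ ≤ x.1 + 1 by omega))
        (h0.2.2.1.mono (show x₀.1 + δ ≤ x₀.1 + 1 by omega))
        (hx.2.2.2.2.trans h0.2.2.2.2.symm) (by omega)
      exact ⟨h1, by omega⟩
    refine le_trans (card_le_card_of_injOn Prod.snd (fun x hx => ?_) fun x hx y hy hxy => ?_)
      (hD (E.U (perm x₀.2)))
    · have h1 := huniq x hx
      have hx' : x ∈ F := hx
      simp only [hF, mem_filter, mem_product, mem_range] at hx'
      simp only [coe_filter, mem_range, Set.mem_ofPred_eq]
      exact ⟨hx'.1.2, Or.inl h1.1⟩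
    · exact Prod.ext ((huniq x hx).2.trans (huniq y hy).2.symm) hxy

open Classical in
theorem card_cut_le {s ℓ D : ℕ} {pal : ℕ → ℕ} (hp : E.Proper col) (hpal : ∀ j < s, pal j ≠ 0)
    (hD : ∀ z, E.load r perm z ≤ D) (v : ℕ) :
    #{x ∈ range ℓ ×ˢ range r | ∃ g, CutAt E col (E.U (perm x.2)) s pal x.1 g ∧ E.Inc g v} ≤
      4 * s ^ 2 * D := by
  refine le_trans (card_le_card (t := (range s ×ˢ range s ×ˢ range 2 ×ˢ range 2).biUnion fun y =>
    {x ∈ range ℓ ×ˢ range r | E.nbr col (E.U (perm x.2)) (pal y.1) = 0 ∧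
      E.Valid col (pal y.1) (pal y.2.1) (E.U (perm x.2)) (x.1 + 1) ∧ x.1 % 2 = y.2.2.1 ∧
      E.vtx col (pal y.1) (pal y.2.1) (E.U (perm x.2)) (x.1 + y.2.2.2) = v}) fun x hx => ?_) ?_
  · simp only [mem_filter, mem_product, mem_range] at hx
    obtain ⟨hx1, g, ⟨j₁, hj₁, j₂, hj₂, h1, h2, rfl⟩, h3⟩ := hx
    simp only [mem_biUnion, mem_product, mem_filter, mem_range]
    obtain ⟨e1, e2, e3, -⟩ := h2.edge hp (hpal _ hj₁) (hpal _ hj₂) (Nat.lt_succ_self x.1)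
    rcases e2.eq_or_eq_other h3 with h4 | h4
    · exact ⟨(j₁, j₂, x.1 % 2, 0), ⟨hj₁, hj₂, Nat.mod_lt _ (by omega), by norm_num⟩, hx1, h1, h2, rfl,
        h4.symm⟩
    · exact ⟨(j₁, j₂, x.1 % 2, 1), ⟨hj₁, hj₂, Nat.mod_lt _ (by omega), by norm_num⟩, hx1, h1, h2, rfl,
        h4.symm⟩
  · refine card_biUnion_le.trans ?_
    refine (sum_le_card_nsmul _ _ D fun y hy => ?_).trans ?_
    · simp only [mem_product, mem_range] at hy
      exact card_cut_le_of_parity hp (hpal _ hy.1) (hpal _ hy.2.1) hD v y.2.2.1 y.2.2.2 (by omega)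
    · simp only [card_product, card_range, smul_eq_mul]
      apply le_of_eq
      ring

/-- The number of colors in `1, …, κ` present at `z` is at most the number of colored edges at `z`. -/
theorem card_present_le {κ : ℕ} (hp : E.Proper col) (z : ℕ) :
    #{c ∈ range κ | E.nbr col z (c + 1) ≠ 0} + E.holes col z ≤ E.deg z := by
  have h1 : #{c ∈ range κ | E.nbr col z (c + 1) ≠ 0} ≤
      #{i ∈ range E.m | E.Inc i z ∧ col i ≠ 0} := by
    refine card_le_card_of_injOn (fun c => E.nbr col z (c + 1) - 1) (fun c hc => ?_)
      fun c hc c' hc' hcc => ?_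
    · simp only [coe_filter, mem_range, Set.mem_ofPred_eq] at hc ⊢
      obtain ⟨g1, g2, g3⟩ := nbr_spec hp (by omega) hc.2
      exact ⟨g1, g2, by omega⟩
    · simp only [coe_filter, mem_range, Set.mem_ofPred_eq] at hc hc'
      have g3 := (nbr_spec hp (by omega) hc.2).2.2
      have g3' := (nbr_spec hp (by omega) hc'.2).2.2
      simp only at hcc
      rw [hcc] at g3
      omega
  have h2 : #{i ∈ range E.m | E.Inc i z ∧ col i ≠ 0} + E.holes col z = E.deg z := by
    unfold holes deg
    rw [← card_union_of_disjoint]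
    · congr 1
      ext i
      simp only [mem_union, mem_filter]
      tauto
    · rw [disjoint_left]
      intro i hi hi'
      simp only [mem_filter] at hi hi'
      exact hi.2.2 hi'.2.2
  omega

/-- The vertices `U (perm k)` and their neighbors, for the first `r` edges of the queue at `v`, counted
with multiplicity. -/
def reach (E : EdgeList) (r : ℕ) (perm : ℕ → ℕ) (v z : ℕ) : ℕ :=
  #{k ∈ range r | E.Inc (perm k) v ∧ (z = E.U (perm k) ∨
    ∃ i < E.m, E.Inc i (E.U (perm k)) ∧ z = E.other i (E.U (perm k)))}

theorem sum_reach_le {Δ : ℕ} (hΔ : ∀ z, E.deg z ≤ Δ) :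
    ∑ z ∈ range E.n, E.reach r perm v z ≤ E.load r perm v * (Δ + 1) := by
  unfold reach load
  simp only [card_filter]
  rw [sum_comm, sum_mul]
  refine sum_le_sum fun k _ => ?_
  rw [← card_filter]
  split_ifs with hk
  · simp only [hk, true_and, one_mul]
    refine le_trans (card_le_card (t := insert (E.U (perm k))
      ({i ∈ range E.m | E.Inc i (E.U (perm k))}.image fun i => E.other i (E.U (perm k))))
      fun z hz => ?_) ?_
    · simp only [mem_filter, mem_insert, mem_image, mem_range] at hz ⊢
      rcases hz.2 with h | ⟨i, h1, h2, h3⟩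
      · exact Or.inl h
      · exact Or.inr ⟨i, ⟨h1, h2⟩, h3.symm⟩
    · refine (card_insert_le _ _).trans ?_
      have := (card_image_le (s := {i ∈ range E.m | E.Inc i (E.U (perm k))})
        (f := fun i => E.other i (E.U (perm k)))).trans (hΔ (E.U (perm k)))
      omega
  · simp [hk]

open Classical in
theorem card_blocked_le {s : ℕ} {pal : ℕ → ℕ} :
    #{k ∈ range r | E.Inc (perm k) v ∧ Blocked E col (E.U (perm k)) s pal} ≤
      ∑ z ∈ range E.n, E.reach r perm v z *
        if ∀ j < s, E.nbr col z (pal j) ≠ 0 then 1 else 0 := by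
  refine le_trans (card_le_card (t := {z ∈ range E.n | ∀ j < s, E.nbr col z (pal j) ≠ 0}.biUnion
    fun z => {k ∈ range r | E.Inc (perm k) v ∧ (z = E.U (perm k) ∨
    ∃ i < E.m, E.Inc i (E.U (perm k)) ∧ z = E.other i (E.U (perm k)))}) fun k hk => ?_) ?_
  · simp only [mem_filter, mem_range, mem_biUnion] at hk ⊢
    obtain ⟨h1, h2, z, hz, h3, h4⟩ := hk
    exact ⟨z, ⟨hz, h4⟩, h1, h2, h3⟩
  · refine card_biUnion_le.trans ?_
    rw [sum_filter]
    refine sum_le_sum fun z _ => ?_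
    split_ifs <;> simp [reach]

open Classical in
theorem card_hit_le {s ℓ D : ℕ} {pal : ℕ → ℕ} (hp : E.Proper col) (hpal : ∀ j < s, pal j ≠ 0)
    (hD : ∀ z, E.load r perm z ≤ D) (v : ℕ) :
    ∑ cnt ∈ range ℓ, ∑ k ∈ range r, (if E.Hit perm col s pal v cnt k then 1 else 0) ≤
      ℓ * (∑ z ∈ range E.n, E.reach r perm v z *
        if ∀ j < s, E.nbr col z (pal j) ≠ 0 then 1 else 0) + 4 * s ^ 2 * D := by
  have h1 := card_cut_le (ℓ := ℓ) hp hpal hD v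
  have h2 := card_blocked_le (E := E) (r := r) (perm := perm) (v := v) (col := col) (s := s)
    (pal := pal)
  rw [card_filter, sum_product] at h1
  rw [card_filter] at h2
  calc _ ≤ ∑ cnt ∈ range ℓ, ∑ k ∈ range r,
        ((if E.Inc (perm k) v ∧ Blocked E col (E.U (perm k)) s pal then 1 else 0) +
        if ∃ g, CutAt E col (E.U (perm k)) s pal cnt g ∧ E.Inc g v then 1 else 0) := by
        refine sum_le_sum fun cnt _ => sum_le_sum fun k _ => ?_
        unfold Hit
        by_cases h3 : E.Inc (perm k) v ∧ Blocked E col (E.U (perm k)) s pal <;>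
          by_cases h4 : ∃ g, CutAt E col (E.U (perm k)) s pal cnt g ∧ E.Inc g v <;> simp [h3, h4]
    _ = ℓ * (∑ k ∈ range r,
        if E.Inc (perm k) v ∧ Blocked E col (E.U (perm k)) s pal then 1 else 0) +
        ∑ cnt ∈ range ℓ, ∑ k ∈ range r,
          if ∃ g, CutAt E col (E.U (perm k)) s pal cnt g ∧ E.Inc g v then 1 else 0 := by
        simp only [sum_add_distrib, sum_const, card_range, smul_eq_mul]
    _ ≤ _ := add_le_add (Nat.mul_le_mul_left _ h2) h1

end EdgeList

/-! ### The potential of the random coloring phase -/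

namespace EdgeList

open Function Finset WordRAM

variable (E : EdgeList)

/-- The exponential moments that control, for all `r' ≤ r`, how many of the edges at a vertex are
among the last `r'` edges of the queue. -/
noncomputable def tail (Δ e r : ℕ) (perm : ℕ → ℕ) : ℝ :=
  ∑ v ∈ range E.n, ∑ r' ∈ Icc 1 r,
    ((1 + (r' : ℝ) / r) ^ E.load r perm v * Real.exp (-(2 * r' * Δ / E.m + e / 100)) +
      (1 - (r' : ℝ) / (2 * r)) ^ E.load r perm v *
        Real.exp (r' * E.deg v / (4 * E.m) - e / 4))

/-- The rate of the growth of the excess that the analysis allows for. -/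
noncomputable def rate (Δ e : ℕ) : ℝ := E.m * (e : ℝ) ^ 2 / (12800 * Δ)

/-- The exponential moment of the excess, normalized so that it does not increase on average. -/
noncomputable def core (Δ e r : ℕ) (perm col : ℕ → ℕ) : ℝ :=
  (∑ v ∈ range E.n, (2 : ℝ) ^ E.excess r perm col v) *
    Real.exp (-(E.rate Δ e / r) - e / 64)

variable {E} {Δ e r k : ℕ} {perm col C : ℕ → ℕ} {v : ℕ}

theorem half_le_one_sub {r r' : ℕ} (h : r' ≤ r) : (0 : ℝ) ≤ 1 - (r' : ℝ) / (2 * r) - 1 / 2 := by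
  rcases Nat.eq_zero_or_pos r with rfl | hr
  · simp; norm_num
  · have hr' : (0 : ℝ) < r := by exact_mod_cast hr
    have h' : (r' : ℝ) ≤ r := by exact_mod_cast h
    have : (r' : ℝ) / (2 * r) ≤ 1 / 2 := by
      rw [div_le_div_iff₀ (by positivity) (by norm_num)]
      linarith
    linarith

theorem tail_term_nonneg {r' : ℕ} (h : r' ≤ r) (D : ℕ) (x y : ℝ) :
    0 ≤ (1 + (r' : ℝ) / r) ^ D * Real.exp x + (1 - (r' : ℝ) / (2 * r)) ^ D * Real.exp y := by
  have h1 := half_le_one_sub h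
  have h2 : (0 : ℝ) ≤ 1 - (r' : ℝ) / (2 * r) := by linarith
  positivity

/-- Bernoulli's inequality shows that sampling without replacement has smaller moments. -/
theorem sum_pow_load_pop_le {μ : ℝ} (hμ : -(1 / 2) ≤ μ) (hr : 1 ≤ r) :
    ∑ k ∈ range r, (1 + μ) ^ E.load (r - 1) (pop r k perm) v ≤
      r * (1 + μ * (1 - 1 / r)) ^ E.load r perm v := by
  have hr0 : (0 : ℝ) < r := by exact_mod_cast hr
  have hr1 : (1 : ℝ) ≤ r := by exact_mod_cast hr
  set D := E.load r perm v with hD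
  have h1 : (0 : ℝ) < 1 + μ := by linarith
  have e1 : ∀ k ∈ range r, (1 + μ) ^ E.load (r - 1) (pop r k perm) v =
      (1 + μ) ^ D * (1 - (if E.Inc (perm k) v then 1 else 0 : ℕ) * (μ / (1 + μ))) := by
    intro k hk
    have hl := load_pop (E := E) (perm := perm) (v := v) (mem_range.1 hk)
    rw [← hD] at hl
    split_ifs at hl ⊢ with h
    · rw [← hl, pow_succ]
      field_simp
      simp
    · rw [← hl]; simp
  rw [sum_congr rfl e1, ← mul_sum, sum_sub_distrib, ← sum_mul, ← Nat.cast_sum,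
    ← load_eq_sum (E := E), ← hD]
  have e2 : 1 + μ * (1 - 1 / r) = (1 + μ) * (1 + -(μ / (r * (1 + μ)))) := by field_simp; ring
  rw [e2, mul_pow, mul_left_comm]
  refine mul_le_mul_of_nonneg_left ?_ (by positivity)
  have e3 : μ / (r * (1 + μ)) ≤ 2 := by
    rw [div_le_iff₀ (by positivity)]
    nlinarith
  have := one_add_mul_le_pow (a := -(μ / (r * (1 + μ)))) (by linarith) D
  refine le_trans (le_of_eq ?_) (mul_le_mul_of_nonneg_left this hr0.le)
  simp
  field_simp
  ring

theorem sum_tail_pop_le (hr : 2 ≤ r) :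
    ∑ k ∈ range r, E.tail Δ e (r - 1) (pop r k perm) ≤ r * E.tail Δ e r perm := by
  unfold tail
  rw [sum_comm, mul_sum]
  refine sum_le_sum fun v _ => ?_
  rw [sum_comm]
  have hsub : Icc 1 (r - 1) ⊆ Icc 1 r := Icc_subset_Icc_right (by omega)
  refine le_trans ?_ (mul_le_mul_of_nonneg_left (sum_le_sum_of_subset_of_nonneg hsub
    fun r' hr' _ => tail_term_nonneg (mem_Icc.1 hr').2 _ _ _) (Nat.cast_nonneg r))
  rw [mul_sum]
  refine sum_le_sum fun r' hr' => ?_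
  have hr'' : r' ≤ r - 1 := (mem_Icc.1 hr').2
  have c1 : ((r - 1 : ℕ) : ℝ) = r - 1 := by rw [Nat.cast_sub (by omega)]; simp
  have hr2 : (2 : ℝ) ≤ r := by exact_mod_cast hr
  have hr1 : (0 : ℝ) < r - 1 := by linarith
  rw [sum_add_distrib, ← sum_mul, ← sum_mul, mul_add, ← mul_assoc, ← mul_assoc]
  refine add_le_add (mul_le_mul_of_nonneg_right ?_ (Real.exp_pos _).le)
    (mul_le_mul_of_nonneg_right ?_ (Real.exp_pos _).le)
  · refine (sum_pow_load_pop_le (μ := (r' : ℝ) / (r - 1 : ℕ)) ?_ (by omega)).trans_eq ?_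
    · have : (0 : ℝ) ≤ (r' : ℝ) / (r - 1 : ℕ) := by positivity
      linarith
    · congr 3
      rw [c1]
      field_simp
  · have h1 := half_le_one_sub hr''
    simp only [sub_eq_add_neg (1 : ℝ) ((r' : ℝ) / _)]
    refine (sum_pow_load_pop_le (μ := -((r' : ℝ) / (2 * (r - 1 : ℕ)))) ?_ (by omega)).trans_eq ?_
    · linarith
    · congr 3
      rw [c1]
      field_simp

theorem tail_nonneg : 0 ≤ E.tail Δ e r perm :=
  sum_nonneg fun _ _ => sum_nonneg fun _ h => tail_term_nonneg (mem_Icc.1 h).2 _ _ _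

theorem core_nonneg : 0 ≤ E.core Δ e r perm col := by unfold core; positivity

theorem load_bounds_of_tail_lt (hm : 0 < E.m) (hr : 1 ≤ r) (h : E.tail Δ e r perm < 1)
    (hv : v < E.n) : (E.load r perm v : ℝ) ≤ 4 * (r / E.m) * Δ + e / 50 ∧
      ((r / E.m) * E.deg v - e) / 4 ≤ (E.load r perm v : ℝ) := by
  have hr0 : (r : ℝ) ≠ 0 := by
    have : (1 : ℝ) ≤ r := by exact_mod_cast hr
    linarith
  have hm0 : (0 : ℝ) < E.m := by exact_mod_cast hm
  have hlog1 := Real.log_two_gt_d9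
  have hlog2 := Real.log_two_lt_d9
  have h1 : (1 + (r : ℝ) / r) ^ E.load r perm v *
      Real.exp (-(2 * r * Δ / E.m + e / 100)) + (1 - (r : ℝ) / (2 * r)) ^ E.load r perm v *
        Real.exp (r * E.deg v / (4 * E.m) - e / 4) < 1 := by
    refine lt_of_le_of_lt ?_ h
    refine le_trans ?_ (single_le_sum (f := fun v => ∑ r' ∈ Icc 1 r,
      ((1 + (r' : ℝ) / r) ^ E.load r perm v * Real.exp (-(2 * r' * Δ / E.m + e / 100)) +
      (1 - (r' : ℝ) / (2 * r)) ^ E.load r perm v *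
        Real.exp (r' * E.deg v / (4 * E.m) - e / 4)))
      (fun _ _ => sum_nonneg fun _ h => tail_term_nonneg (mem_Icc.1 h).2 _ _ _) (mem_range.2 hv))
    exact single_le_sum (f := fun r' : ℕ => ((1 + (r' : ℝ) / r) ^ E.load r perm v *
      Real.exp (-(2 * r' * Δ / E.m + e / 100)) +
      (1 - (r' : ℝ) / (2 * r)) ^ E.load r perm v *
        Real.exp (r' * E.deg v / (4 * E.m) - e / 4)))
      (fun _ h => tail_term_nonneg (mem_Icc.1 h).2 _ _ _) (mem_Icc.2 ⟨hr, le_rfl⟩)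
  set D := E.load r perm v
  have e1 : (1 + (r : ℝ) / r) = Real.exp (Real.log 2) := by
    rw [div_self hr0, Real.exp_log (by norm_num)]; norm_num
  have e2 : (1 - (r : ℝ) / (2 * r)) = Real.exp (-Real.log 2) := by
    rw [Real.exp_neg, Real.exp_log (by norm_num)]; field_simp; norm_num
  rw [e1, e2, ← Real.exp_nat_mul, ← Real.exp_nat_mul, ← Real.exp_add, ← Real.exp_add] at h1
  have p1 := Real.exp_pos (D * Real.log 2 + -(2 * r * Δ / E.m + e / 100))
  have p2 := Real.exp_pos (D * -Real.log 2 + (r * E.deg v / (4 * E.m) - e / 4))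
  have q1 := Real.exp_lt_one_iff.1 (show Real.exp (D * Real.log 2 +
    -(2 * r * Δ / E.m + e / 100)) < 1 by linarith)
  have q2 := Real.exp_lt_one_iff.1 (show Real.exp (D * -Real.log 2 +
    (r * E.deg v / (4 * E.m) - e / 4)) < 1 by linarith)
  have hD : (0 : ℝ) ≤ D := Nat.cast_nonneg _
  constructor
  · have : 2 * (r : ℝ) * Δ / E.m = 2 * (r / E.m) * Δ := by ring
    nlinarith
  · have : (r : ℝ) * E.deg v / (4 * E.m) = (r / E.m) * E.deg v / 4 := by ring
    nlinarith

theorem excess_le_of_core_lt (hΔ : 0 < Δ) (he : 0 < e) (hm : 0 < E.m)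
    (hr : E.m * e ≤ 200 * Δ * r) (h : E.core Δ e r perm col < 1) (hv : v < E.n) :
    (E.excess r perm col v : ℝ) ≤ e / 16 := by
  have hm0 : (0 : ℝ) < E.m := by exact_mod_cast hm
  have he0 : (0 : ℝ) < e := by exact_mod_cast he
  have hΔ0 : (0 : ℝ) < Δ := by exact_mod_cast hΔ
  have hlog1 := Real.log_two_gt_d9
  have hr' : (E.m : ℝ) * e ≤ 200 * Δ * r := by exact_mod_cast hr
  have hr0 : (0 : ℝ) < r := by
    have : (0 : ℝ) < E.m * e := by positivity
    by_contra hc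
    have : 200 * (Δ : ℝ) * r ≤ 0 := mul_nonpos_of_nonneg_of_nonpos (by positivity) (by linarith)
    linarith
  have h1 : (2 : ℝ) ^ E.excess r perm col v * Real.exp (-(E.rate Δ e / r) - e / 64) < 1 := by
    refine lt_of_le_of_lt ?_ h
    refine mul_le_mul_of_nonneg_right ?_ (Real.exp_pos _).le
    exact single_le_sum (f := fun v => (2 : ℝ) ^ E.excess r perm col v)
      (fun _ _ => by positivity) (mem_range.2 hv)
  have e1 : (2 : ℝ) = Real.exp (Real.log 2) := by rw [Real.exp_log (by norm_num)]
  rw [e1, ← Real.exp_nat_mul, ← Real.exp_add] at h1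
  have h2 := Real.exp_lt_one_iff.1 h1
  have h3 : E.rate Δ e / r ≤ e / 64 := by
    unfold rate
    rw [div_div, div_le_div_iff₀ (by positivity) (by norm_num)]
    nlinarith [mul_le_mul_of_nonneg_left hr' he0.le]
  have hX : (0 : ℝ) ≤ E.excess r perm col v := Nat.cast_nonneg _
  nlinarith

open Classical in
/-- A bound for the potential after a round with palette `pal`, path length `cnt` and edge `perm k`. -/
noncomputable def roundBound (E : EdgeList) (Δ e r : ℕ) (perm col : ℕ → ℕ) (s : ℕ) (pal : ℕ → ℕ)
    (p : ℝ) (cnt k : ℕ) : ℝ :=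
  min 1 ((∑ v ∈ range E.n, (2 : ℝ) ^ E.excess r perm col v *
    (1 + if E.Hit perm col s pal v cnt k then 1 else 0)) *
    Real.exp (-(E.rate Δ e / (r - 1 : ℕ)) - e / 64) + E.tail Δ e (r - 1) (pop r k perm) + p)

theorem min_potential_le_roundBound {s cnt : ℕ} {pal : ℕ → ℕ} {p : ℝ} (h : E.Queue r perm col)
    (hk : k < r) (hO : Outcome E col (perm k) s pal cnt C) :
    min 1 (E.core Δ e (r - 1) (pop r k perm) C + E.tail Δ e (r - 1) (pop r k perm) + p) ≤
      E.roundBound Δ e r perm col s pal p cnt k := by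
  refine min_le_min_left _ (add_le_add_left (add_le_add_left
    (mul_le_mul_of_nonneg_right (sum_le_sum fun v _ => ?_) (Real.exp_pos _).le) _) _)
  refine (pow_le_pow_right₀ (by norm_num) (excess_pop_le h hk hO v)).trans_eq ?_
  rw [pow_add]
  split_ifs <;> norm_num

/-- The part of the bound for a round that does not depend on the palette. -/
noncomputable def roundConst (E : EdgeList) (Δ e r : ℕ) (perm col : ℕ → ℕ) (s ℓ D : ℕ)
    (p : ℝ) : ℝ :=
  (∑ v ∈ range E.n, (2 : ℝ) ^ E.excess r perm col v * (1 + 4 * s ^ 2 * D / (r * ℓ))) *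
    Real.exp (-(E.rate Δ e / (r - 1 : ℕ)) - e / 64) + E.tail Δ e r perm + p

/-- The weight of a vertex `z` at which all palette colors are present. -/
noncomputable def roundWeight (E : EdgeList) (Δ e r : ℕ) (perm col : ℕ → ℕ) (z : ℕ) : ℝ :=
  (∑ v ∈ range E.n, (2 : ℝ) ^ E.excess r perm col v * (E.reach r perm v z / r)) *
    Real.exp (-(E.rate Δ e / (r - 1 : ℕ)) - e / 64)

open Classical in
theorem average_roundBound_le {s ℓ D : ℕ} {pal : ℕ → ℕ} {p : ℝ} (hp : E.Proper col)
    (hpal : ∀ j < s, pal j ≠ 0) (hD : ∀ z, E.load r perm z ≤ D) (hr : 2 ≤ r) (hℓ : 0 < ℓ) :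
    (∑ cnt ∈ range ℓ, (∑ k ∈ range r, E.roundBound Δ e r perm col s pal p cnt k) / r) / ℓ ≤
      E.roundConst Δ e r perm col s ℓ D p + ∑ z ∈ range E.n, E.roundWeight Δ e r perm col z *
        if ∀ j < s, E.nbr col z (pal j) ≠ 0 then 1 else 0 := by
  have hr0 : (0 : ℝ) < r := by exact_mod_cast (show 0 < r by omega)
  have hℓ0 : (0 : ℝ) < ℓ := by exact_mod_cast hℓ
  rw [← sum_div, div_div, div_le_iff₀ (by positivity)]
  set x := Real.exp (-(E.rate Δ e / (r - 1 : ℕ)) - e / 64) with hx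
  have hx0 : 0 < x := Real.exp_pos _
  have h1 : ∀ v, (∑ cnt ∈ range ℓ, ∑ k ∈ range r,
      (if E.Hit perm col s pal v cnt k then (1 : ℝ) else 0)) ≤
      ℓ * (∑ z ∈ range E.n, E.reach r perm v z *
        if ∀ j < s, E.nbr col z (pal j) ≠ 0 then (1 : ℝ) else 0) + 4 * s ^ 2 * D := by
    intro v
    have := card_hit_le (ℓ := ℓ) hp hpal hD v
    exact_mod_cast this
  calc _ ≤ ∑ cnt ∈ range ℓ, ∑ k ∈ range r, ((∑ v ∈ range E.n,
        (2 : ℝ) ^ E.excess r perm col v * (1 + if E.Hit perm col s pal v cnt k then 1 else 0)) * x +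
        E.tail Δ e (r - 1) (pop r k perm) + p) :=
        sum_le_sum fun cnt _ => sum_le_sum fun k _ => min_le_right _ _
    _ = (∑ v ∈ range E.n, (2 : ℝ) ^ E.excess r perm col v * (ℓ * r +
        ∑ cnt ∈ range ℓ, ∑ k ∈ range r, if E.Hit perm col s pal v cnt k then 1 else 0)) * x +
        ℓ * (∑ k ∈ range r, E.tail Δ e (r - 1) (pop r k perm)) + ℓ * r * p := by
        have e1 : ∑ cnt ∈ range ℓ, ∑ k ∈ range r, ∑ v ∈ range E.n,
            (2 : ℝ) ^ E.excess r perm col v * (1 + if E.Hit perm col s pal v cnt k then 1 else 0) =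
            ∑ v ∈ range E.n, (2 : ℝ) ^ E.excess r perm col v * (ℓ * r +
              ∑ cnt ∈ range ℓ, ∑ k ∈ range r, if E.Hit perm col s pal v cnt k then 1 else 0) := by
          rw [sum_congr rfl fun c _ => sum_comm, sum_comm]
          refine sum_congr rfl fun v _ => ?_
          simp only [← mul_sum, sum_add_distrib, sum_const, card_range, nsmul_eq_mul, mul_one]
        rw [← e1]
        simp only [sum_add_distrib, ← sum_mul, sum_const, card_range, nsmul_eq_mul, mul_assoc]
    _ ≤ (∑ v ∈ range E.n, (2 : ℝ) ^ E.excess r perm col v * (ℓ * r +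
        (ℓ * (∑ z ∈ range E.n, E.reach r perm v z *
        if ∀ j < s, E.nbr col z (pal j) ≠ 0 then (1 : ℝ) else 0) + 4 * s ^ 2 * D))) * x +
        ℓ * (r * E.tail Δ e r perm) + ℓ * r * p := by
        gcongr with v _
        · exact h1 v
        · exact sum_tail_pop_le hr
    _ = _ := by
        unfold roundConst roundWeight
        rw [← hx]
        have e2 : ∑ z ∈ range E.n, (∑ v ∈ range E.n, (2 : ℝ) ^ E.excess r perm col v *
            (E.reach r perm v z / r)) * x * (if ∀ j < s, E.nbr col z (pal j) ≠ 0 then 1 else 0) =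
            (∑ v ∈ range E.n, (2 : ℝ) ^ E.excess r perm col v * ((∑ z ∈ range E.n,
              E.reach r perm v z * if ∀ j < s, E.nbr col z (pal j) ≠ 0 then (1 : ℝ) else 0) / r))
              * x := by
          simp only [sum_mul, mul_sum, sum_div]
          rw [sum_comm]
          refine sum_congr rfl fun v _ => sum_congr rfl fun z _ => ?_
          ring
        rw [e2]
        have e3 : ∀ v, (2 : ℝ) ^ E.excess r perm col v * (ℓ * r +
            (ℓ * (∑ z ∈ range E.n, E.reach r perm v z *
            if ∀ j < s, E.nbr col z (pal j) ≠ 0 then (1 : ℝ) else 0) + 4 * s ^ 2 * D)) =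
            ((2 : ℝ) ^ E.excess r perm col v * (1 + 4 * s ^ 2 * D / (r * ℓ)) +
            (2 : ℝ) ^ E.excess r perm col v * ((∑ z ∈ range E.n,
              E.reach r perm v z * if ∀ j < s, E.nbr col z (pal j) ≠ 0 then (1 : ℝ) else 0) / r))
              * (r * ℓ) := by
          intro v
          field_simp
          ring
        rw [sum_congr rfl fun v _ => e3 v, ← sum_mul, sum_add_distrib]
        ring

theorem round_le {s ℓ D : ℕ} {ρ p : ℝ} (hρ : 0 ≤ ρ) (hr : 2 ≤ r)
    (hΔ : ∀ z, E.deg z ≤ Δ) (h : ∀ v < E.n, 4 * (s : ℝ) ^ 2 * D / (r * ℓ) +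
      E.load r perm v * (Δ + 1) * ρ / r ≤ E.rate Δ e / r ^ 2) :
    E.roundConst Δ e r perm col s ℓ D p + ∑ z ∈ range E.n, E.roundWeight Δ e r perm col z * ρ ≤
      E.core Δ e r perm col + E.tail Δ e r perm + p := by
  have hr0 : (0 : ℝ) < r := by exact_mod_cast (show 0 < r by omega)
  have hr2 : (2 : ℝ) ≤ r := by exact_mod_cast hr
  have c1 : ((r - 1 : ℕ) : ℝ) = r - 1 := by rw [Nat.cast_sub (by omega)]; simp
  have hrate : 0 ≤ E.rate Δ e := by unfold rate; positivity
  unfold roundConst roundWeight core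
  set x := Real.exp (-(E.rate Δ e / (r - 1 : ℕ)) - e / 64) with hx
  have hx0 : 0 < x := Real.exp_pos _
  have h1 : x * (1 + E.rate Δ e / r ^ 2) ≤ Real.exp (-(E.rate Δ e / r) - e / 64) := by
    have h2 := Real.add_one_le_exp (E.rate Δ e / r ^ 2)
    refine (mul_le_mul_of_nonneg_left (by linarith : _ ≤ Real.exp (E.rate Δ e / r ^ 2))
      hx0.le).trans ?_
    rw [hx, ← Real.exp_add, Real.exp_le_exp, c1]
    have h3 : E.rate Δ e / r ^ 2 ≤ E.rate Δ e / (r - 1) - E.rate Δ e / r := by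
      have hr1 : (0 : ℝ) < r - 1 := by linarith
      rw [div_sub_div _ _ hr1.ne' hr0.ne', div_le_div_iff₀ (by positivity) (by positivity)]
      nlinarith [mul_nonneg hrate hr0.le]
    linarith
  have e2 : ∑ z ∈ range E.n, (∑ v ∈ range E.n, (2 : ℝ) ^ E.excess r perm col v *
      (E.reach r perm v z / r)) * x * ρ =
      (∑ v ∈ range E.n, (2 : ℝ) ^ E.excess r perm col v * ((∑ z ∈ range E.n,
        (E.reach r perm v z : ℝ)) * ρ / r)) * x := by
    simp only [sum_mul, mul_sum, sum_div]
    rw [sum_comm]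
    refine sum_congr rfl fun v _ => sum_congr rfl fun z _ => ?_
    ring
  rw [e2, add_right_comm, add_right_comm _ (E.tail Δ e r perm), ← add_mul, ← sum_add_distrib]
  refine add_le_add_left (add_le_add_left (le_trans ?_ (mul_le_mul_of_nonneg_left h1
    (show 0 ≤ ∑ v ∈ range E.n, (2 : ℝ) ^ E.excess r perm col v by positivity))) _) _
  rw [mul_comm x, ← mul_assoc]
  refine mul_le_mul_of_nonneg_right ?_ hx0.le
  rw [sum_mul]
  refine sum_le_sum fun v hv => ?_
  rw [← mul_add]
  refine mul_le_mul_of_nonneg_left ?_ (by positivity)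
  have h4 : (∑ z ∈ range E.n, (E.reach r perm v z : ℝ)) ≤ E.load r perm v * (Δ + 1) := by
    exact_mod_cast sum_reach_le (E := E) (r := r) (perm := perm) (v := v) hΔ
  have h5 : (∑ z ∈ range E.n, (E.reach r perm v z : ℝ)) * ρ / r ≤
      E.load r perm v * (Δ + 1) * ρ / r := by gcongr
  linarith [h v (mem_range.1 hv)]

theorem round_numeric {m Δ e L r s ℓ D d ρ : ℝ} (hr0 : 0 < r) (hr : r ≤ m) (hL : 1 ≤ L)
    (hs0 : 0 ≤ s) (hs : s ≤ 33 * L * m / r) (hD0 : 0 ≤ D) (hD : D ≤ 6 * (r / m) * Δ)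
    (hℓ0 : 0 < ℓ) (hℓ : 10 ^ 9 * L ^ 2 * Δ ^ 2 ≤ ℓ * e ^ 2) (hd0 : 0 ≤ d) (hd : d ≤ Δ)
    (hρ0 : 0 ≤ ρ) (hρ : ρ ≤ 1 / Δ ^ 4) (he : 400 ≤ e) (hΔ : 1 ≤ Δ) :
    4 * s ^ 2 * D / (r * ℓ) + d * (Δ + 1) * ρ / r ≤ m * e ^ 2 / (12800 * Δ) / r ^ 2 := by
  have hm : 0 < m := by linarith
  have hΔ0 : 0 < Δ := by linarith
  have h1 : 4 * s ^ 2 * D / (r * ℓ) ≤ m * e ^ 2 / (25600 * Δ) / r ^ 2 := by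
    calc 4 * s ^ 2 * D / (r * ℓ) ≤ 4 * (33 * L * m / r) ^ 2 * (6 * (r / m) * Δ) / (r * ℓ) := by
          gcongr
      _ = 26136 * L ^ 2 * Δ * m / (r ^ 2 * ℓ) := by field_simp; ring
      _ ≤ m * e ^ 2 / (25600 * Δ) / r ^ 2 := by
          rw [div_div, div_le_div_iff₀ (by positivity) (by positivity)]
          have : 26136 * 25600 * (L ^ 2 * Δ ^ 2) ≤ ℓ * e ^ 2 := by
            nlinarith [show 0 ≤ L ^ 2 * Δ ^ 2 by positivity]
          have h2 := mul_le_mul_of_nonneg_left this (show 0 ≤ m * r ^ 2 by positivity)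
          linarith
  have h2 : d * (Δ + 1) * ρ / r ≤ m * e ^ 2 / (25600 * Δ) / r ^ 2 := by
    calc d * (Δ + 1) * ρ / r ≤ Δ * (Δ + Δ) * (1 / Δ ^ 4) / r := by gcongr
      _ = 2 / (Δ ^ 2 * r) := by field_simp; ring
      _ ≤ m * e ^ 2 / (25600 * Δ) / r ^ 2 := by
          rw [div_div, div_le_div_iff₀ (by positivity) (by positivity)]
          have h3 : 160000 ≤ e ^ 2 := by nlinarith
          have h4 : r * (51200 * Δ * r) ≤ m * (160000 * Δ ^ 2 * r) := by
            have : 51200 * Δ * r ≤ 160000 * Δ ^ 2 * r := by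
              refine mul_le_mul_of_nonneg_right ?_ hr0.le
              nlinarith
            exact mul_le_mul hr this (by positivity) hm.le
          have h5 := mul_le_mul_of_nonneg_right h3 (show 0 ≤ m * Δ ^ 2 * r by positivity)
          linarith
  calc _ ≤ m * e ^ 2 / (25600 * Δ) / r ^ 2 + m * e ^ 2 / (25600 * Δ) / r ^ 2 := add_le_add h1 h2
    _ = _ := by field_simp; norm_num

/-- Relations between the parameters of the algorithm. -/
structure Params (E : EdgeList) (Δ e L ℓ : ℕ) : Prop where
  deg_le : ∀ v, E.deg v ≤ Δ
  e_ge : 400 ≤ e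
  e_le : e ≤ Δ
  le_m : Δ ≤ E.m
  L_pos : 1 ≤ L
  le_pow : Δ ≤ 2 ^ L
  ℓ_ge : 10 ^ 9 * L ^ 2 * Δ ^ 2 ≤ ℓ * e ^ 2

/-- Few palettes consist of colors present at a vertex. -/
theorem Params.pow_le {L ℓ s : ℕ} (hP : E.Params Δ e L ℓ) (hr : 0 < r) (hrm : r ≤ E.m)
    (hs : 32 * L * E.m / r < s) :
    (1 - (r / E.m : ℝ) / 8) ^ s ≤ 1 / (Δ : ℝ) ^ 4 := by
  have hr0 : (0 : ℝ) < r := by exact_mod_cast hr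
  have hrm0 : (r : ℝ) ≤ E.m := by exact_mod_cast hrm
  have hm0 : (0 : ℝ) < E.m := by linarith
  have hΔ0 : (0 : ℝ) < Δ := by
    have := hP.e_ge.trans hP.e_le
    exact_mod_cast (by omega : 0 < Δ)
  have hs1 : 32 * (L : ℝ) * E.m ≤ s * r := by
    have := (Nat.div_lt_iff_lt_mul hr).1 hs
    exact_mod_cast this.le
  have hx1 : (r / E.m : ℝ) ≤ 1 := (div_le_one hm0).2 hrm0
  have h1 : 1 - (r / E.m : ℝ) / 8 ≤ Real.exp (-((r / E.m : ℝ) / 8)) := by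
    have := Real.add_one_le_exp (-((r / E.m : ℝ) / 8))
    linarith
  have h2 : (Δ : ℝ) ≤ Real.exp L := by
    have h3 : (Δ : ℝ) ≤ 2 ^ L := by exact_mod_cast hP.le_pow
    have h4 : (2 : ℝ) ≤ Real.exp 1 := by linarith [Real.add_one_le_exp (1 : ℝ)]
    calc (Δ : ℝ) ≤ 2 ^ L := h3
      _ ≤ Real.exp 1 ^ L := by gcongr
      _ = Real.exp L := by rw [← Real.exp_nat_mul, mul_one]
  calc (1 - (r / E.m : ℝ) / 8) ^ s ≤ Real.exp (-((r / E.m : ℝ) / 8)) ^ s :=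
        pow_le_pow_left₀ (by linarith) h1 s
    _ = Real.exp (-(s * (r / E.m) / 8)) := by rw [← Real.exp_nat_mul]; congr 1; ring
    _ ≤ Real.exp (-(4 * L)) := by
        rw [Real.exp_le_exp, neg_le_neg_iff, le_div_iff₀ (by norm_num), mul_div_assoc',
          le_div_iff₀ hm0]
        linarith
    _ = 1 / Real.exp L ^ 4 := by
        rw [Real.exp_neg, ← Real.exp_nat_mul, one_div]; norm_num
    _ ≤ 1 / (Δ : ℝ) ^ 4 := by gcongr

/-- If the potential is less than `1`, the number of colors present at a vertex is small. -/
theorem Params.present_le {L ℓ κ : ℕ} (hP : E.Params Δ e L ℓ) (hr : 0 < r) (hrm : r ≤ E.m)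
    (hκ : κ = Δ + e / 2) (hp : E.Proper col) (hQ : E.Queue r perm col)
    (ht : E.tail Δ e r perm < 1) {z : ℕ} (hz : z < E.n) :
    (#{c ∈ range κ | E.nbr col z (c + 1) ≠ 0} : ℝ) ≤ (1 - (r / E.m : ℝ) / 8) * κ := by
  have hr0 : (0 : ℝ) < r := by exact_mod_cast hr
  have hrm0 : (r : ℝ) ≤ E.m := by exact_mod_cast hrm
  have hm0 : (0 : ℝ) < E.m := by linarith
  have hx1 : (r / E.m : ℝ) ≤ 1 := (div_le_one hm0).2 hrm0
  have hx0 : 0 ≤ (r / E.m : ℝ) := by positivity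
  have h1 := card_present_le (κ := κ) hp z
  have h2 := hQ.load_le_holes (v := z)
  have h3 := (load_bounds_of_tail_lt (by omega) hr ht hz).2
  have h4 : (#{c ∈ range κ | E.nbr col z (c + 1) ≠ 0} : ℝ) + E.load r perm z ≤ E.deg z := by
    exact_mod_cast (by omega : #{c ∈ range κ | E.nbr col z (c + 1) ≠ 0} + E.load r perm z ≤ E.deg z)
  have h5 : (E.deg z : ℝ) ≤ Δ := by exact_mod_cast hP.deg_le z
  have h6 : (Δ : ℝ) + e / 2 - 1 / 2 ≤ κ := by
    have : 2 * Δ + e ≤ 2 * κ + 1 := by omega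
    have : 2 * (Δ : ℝ) + e ≤ 2 * κ + 1 := by exact_mod_cast this
    linarith
  have h7 : (κ : ℝ) ≤ 2 * Δ := by
    have := hP.e_le
    exact_mod_cast (by omega : κ ≤ 2 * Δ)
  have h8 : (400 : ℝ) ≤ e := by exact_mod_cast hP.e_ge
  generalize (r / E.m : ℝ) = x at *
  nlinarith

/-- The bounds of a round in terms of the potential. -/
theorem Params.round_le {L ℓ s : ℕ} {p : ℝ} (hP : E.Params Δ e L ℓ) (hr : 2 ≤ r) (hrm : r ≤ E.m)
    (hre : E.m * e < 100 * Δ * r) (hs : s = 32 * L * E.m / r + 1)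
    (hQ : E.Queue r perm col)
    (ht : E.tail Δ e r perm < 1) : ∃ D : ℕ, (∀ z, E.load r perm z ≤ D) ∧
    E.roundConst Δ e r perm col s ℓ D p + ∑ z ∈ range E.n, E.roundWeight Δ e r perm col z *
      (1 - (r / E.m : ℝ) / 8) ^ s ≤ E.core Δ e r perm col + E.tail Δ e r perm + p := by
  have hr0 : (0 : ℝ) < r := by exact_mod_cast (by omega : 0 < r)
  have hrm0 : (r : ℝ) ≤ E.m := by exact_mod_cast hrm
  have hm0 : (0 : ℝ) < E.m := by linarith
  have hx1 : (r / E.m : ℝ) ≤ 1 := (div_le_one hm0).2 hrm0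
  have hx0 : 0 ≤ (r / E.m : ℝ) := by positivity
  have he : (400 : ℝ) ≤ e := by exact_mod_cast hP.e_ge
  have heΔ : (e : ℝ) ≤ Δ := by exact_mod_cast hP.e_le
  have hL : (1 : ℝ) ≤ L := by exact_mod_cast hP.L_pos
  have hℓ : 10 ^ 9 * (L : ℝ) ^ 2 * Δ ^ 2 ≤ ℓ * e ^ 2 := by exact_mod_cast hP.ℓ_ge
  have hre' : (E.m : ℝ) * e ≤ 100 * Δ * r := by exact_mod_cast hre.le
  have hρ := hP.pow_le (s := s) (by omega) hrm (by omega)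
  refine ⟨⌊6 * (r / E.m : ℝ) * Δ⌋₊, fun z => Nat.le_floor ?_, ?_⟩
  · by_cases hz : z < E.n
    · refine (load_bounds_of_tail_lt (by omega) (by omega) ht hz).1.trans ?_
      have : (e : ℝ) ≤ 100 * Δ * (r / E.m) := by
        rw [mul_div_assoc', le_div_iff₀ hm0]; linarith
      linarith
    · have : E.load r perm z = 0 := by
        rw [load, card_eq_zero, filter_eq_empty_iff]
        intro k hk hi
        exact hz (hi.lt (hQ.lt k (mem_range.1 hk)))
      rw [this]
      have : (0 : ℝ) ≤ Δ := by linarith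
      simp only [Nat.cast_zero]
      positivity
  · have hρ0 : (0 : ℝ) ≤ (1 - (r / E.m : ℝ) / 8) ^ s := pow_nonneg (by linarith) _
    refine EdgeList.round_le hρ0 hr hP.deg_le fun v hv => ?_
    have hs1 : (s : ℝ) ≤ 33 * L * E.m / r := by
      have h1 : ((32 * L * E.m / r : ℕ) : ℝ) ≤ (32 * L * E.m : ℕ) / (r : ℝ) := Nat.cast_div_le
      have h2 : (1 : ℝ) ≤ L * E.m / r := by
        rw [le_div_iff₀ hr0]; nlinarith
      rw [hs]
      push_cast at h1 ⊢
      have h3 : 33 * (L : ℝ) * E.m / r = 32 * L * E.m / r + L * E.m / r := by ring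
      linarith
    refine round_numeric hr0 hrm0 hL (Nat.cast_nonneg _) hs1 (Nat.cast_nonneg _)
      (Nat.floor_le (by positivity)) ?_ hℓ (Nat.cast_nonneg _) ?_ hρ0 hρ he (by linarith)
    · by_contra hc
      have : (ℓ : ℝ) * e ^ 2 ≤ 0 := mul_nonpos_of_nonpos_of_nonneg (by linarith) (by positivity)
      have : 0 < 10 ^ 9 * (L : ℝ) ^ 2 * Δ ^ 2 := by
        have : (0 : ℝ) < Δ := by linarith
        positivity
      linarith
    · exact_mod_cast (hQ.load_le_deg (v := v)).trans (hP.deg_le v)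

end EdgeList

/-! ### The random coloring phase on the word RAM -/

namespace WordRAM

open Function EdgeList Finset

open scoped ENNReal

section

variable {w m : ℕ}

theorem Expect.rand_seq (hw : 16 < 2 ^ w) {e : Expr} {x N t : ℕ} {P : Program} {S : HState}
    {h : HState → ℝ≥0∞} (hx : x < 90) (he : e.ok w m S) (hN : e.eval S = N) (hpos : 0 < N)
    {a : ℕ → ℝ} {b : ℝ} (ha : ∀ y < N, 0 ≤ a y)
    (H : ∀ y < N, Expect w m P t (S.setV x y) h (ENNReal.ofReal (a y)))
    (hb : (∑ y ∈ range N, a y) / N ≤ b) :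
    Expect w m (.seq (randE x e) P) ((randE x e).size + t + 1) S h (ENNReal.ofReal b) := by
  classical
  subst hN
  refine Expect.seq (h := fun S' => if S'.v x < e.eval S ∧ S' = S.setV x (S'.v x) then
    ENNReal.ofReal (a (S'.v x)) else ⊤) ((Expect.of_randE hw hx he hpos).mono le_rfl
      (fun _ => le_rfl) ?_) fun S' hS' => ?_
  · have h1 : ∀ y ∈ range (e.eval S), (if (S.setV x y).v x < e.eval S ∧
        S.setV x y = S.setV x ((S.setV x y).v x) then
        ENNReal.ofReal (a ((S.setV x y).v x)) else ⊤) = ENNReal.ofReal (a y) := by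
      intro y hy
      have : (S.setV x y).v x = y := by simp
      rw [this, if_pos ⟨mem_range.1 hy, rfl⟩]
    rw [sum_congr rfl h1, ← ENNReal.ofReal_sum_of_nonneg fun y hy => ha y (mem_range.1 hy),
      ← ENNReal.ofReal_natCast, ← ENNReal.ofReal_div_of_pos (by exact_mod_cast hpos)]
    exact ENNReal.ofReal_le_ofReal hb
  · by_cases hc : S'.v x < e.eval S ∧ S' = S.setV x (S'.v x)
    · rw [if_pos hc]
      have := H _ hc.1
      rwa [← hc.2] at this
    · simp [hc] at hS'

/-- Fills the palette, array `3`, with `v 10` random colors from `1, …, v 5`. -/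
def drawPalette : Program :=
  .seq (assign 26 (.var 10))
  (whileE (.var 26) (.seq (assign 26 (.sub (.var 26) (.lit 1)))
    (.seq (randE 28 (.var 5)) (write 3 (.var 26) (.add (.var 28) (.lit 1))))))

/-- A bound for the time of `drawPalette`. -/
def drawTime (s : ℕ) : ℕ :=
  (assign 26 (.var 10)).size + loopTime (.var 26) (Program.seq (assign 26 (.sub (.var 26) (.lit 1)))
    (.seq (randE 28 (.var 5)) (write 3 (.var 26) (.add (.var 28) (.lit 1))))).size s + 1

/-- The state `S'` arises from `S` by drawing palette colors from position `j` on. -/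
structure Drawn (κ s : ℕ) (S : HState) (j : ℕ) (S' : HState) : Prop where
  frame_v : ∀ i, i ≠ 26 → i ≠ 28 → S'.v i = S.v i
  frame_a : ∀ t, t ≠ 3 → S'.a t = S.a t
  mem : ∀ i, j ≤ i → i < s → 1 ≤ S'.a 3 i ∧ S'.a 3 i ≤ κ

open Classical in
/-- The palette colors are independent: if at each vertex at most a fraction `ρ` of all colors is
present, all `s` palette colors are present there with probability at most `ρ ^ s`. -/
theorem drawPalette_expect (hw : 16 < 2 ^ w) {E : EdgeList} {s κ : ℕ} {S : HState}
    {h : HState → ℝ≥0∞} (h10 : S.v 10 = s) (h5 : S.v 5 = κ) (hκ : 0 < κ) (hκw : κ + 1 < 2 ^ w)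
    (hs : 3 * m + 16 * s + 3 < 2 ^ w) {col : ℕ → ℕ} {c₀ ρ : ℝ} {β : ℕ → ℝ} (hc₀ : 0 ≤ c₀)
    (hβ : ∀ z, 0 ≤ β z) (hρ0 : 0 ≤ ρ)
    (hρ : ∀ z < E.n, (#{c ∈ range κ | E.nbr col z (c + 1) ≠ 0} : ℝ) ≤ ρ * κ)
    (hh : ∀ S', Drawn κ s S 0 S' → h S' ≤ ENNReal.ofReal (c₀ + ∑ z ∈ range E.n, β z *
      if ∀ j < s, E.nbr col z (S'.a 3 j) ≠ 0 then 1 else 0)) :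
    Expect w m drawPalette (drawTime s) S h
      (ENNReal.ofReal (c₀ + ∑ z ∈ range E.n, β z * ρ ^ s)) := by
  have hw1 : 1 < 2 ^ w := by omega
  unfold drawPalette drawTime
  refine Det.seq_expect (Q := fun S' => S' = S.setV 26 s)
    (Det.of_assign hw (by omega) (by simp) (by simp [h10])) ?_
  rintro _ rfl
  have key := Expect.of_whileE (m := m) hw (e := .var 26) (h := h)
    (P := (.seq (assign 26 (.sub (.var 26) (.lit 1)))
      (.seq (randE 28 (.var 5)) (write 3 (.var 26) (.add (.var 28) (.lit 1))))))
    (t := (Program.seq (assign 26 (.sub (.var 26) (.lit 1)))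
      (.seq (randE 28 (.var 5)) (write 3 (.var 26) (.add (.var 28) (.lit 1))))).size)
    (fun S' => S'.v 26 ≤ s ∧ Drawn κ s S (S'.v 26) S') (fun S' => S'.v 26)
    (fun S' => ENNReal.ofReal (c₀ + ∑ z ∈ range E.n, β z * ρ ^ S'.v 26 *
      if ∀ j < s, S'.v 26 ≤ j → E.nbr col z (S'.a 3 j) ≠ 0 then 1 else 0))
    (fun _ _ => by simp) ?_ (S := S.setV 26 s) ?_ ?_
  · refine key.mono (by simp) (fun _ => le_rfl) (ENNReal.ofReal_le_ofReal ?_)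
    refine add_le_add_right (sum_le_sum fun z _ => le_of_eq ?_) _
    rw [if_pos]
    · simp
    · intro j hj hle
      simp at hle
      omega
  · rintro S' ⟨h1, hD⟩ hne h' hh'
    simp only [Expr.eval] at hne
    obtain ⟨j, hj⟩ : ∃ j, S'.v 26 = j + 1 := ⟨S'.v 26 - 1, by omega⟩
    refine (Det.seq_expect (Q := fun S'' => S'' = S'.setV 26 j)
      (Det.of_assign (m := m) (S := S') (e := .sub (.var 26) (.lit 1)) hw (by omega)
        ⟨by simp, hw1⟩ (by simp [hj])) ?_).mono
      (t := (assign 26 (.sub (.var 26) (.lit 1))).size + ((randE 28 (.var 5)).size +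
        (write 3 (.var 26) (.add (.var 28) (.lit 1))).size + 1) + 1)
      (by simp only [Program.size]; omega) (fun _ => le_rfl) le_rfl
    rintro _ rfl
    have hv5 : S'.v 5 = κ := by rw [hD.frame_v 5 (by omega) (by omega), h5]
    rw [hj] at hD h1 hh'
    refine Expect.rand_seq hw (by omega) (by simp) (N := κ) (by simp [hv5]) hκ
      (a := fun y => c₀ + ∑ z ∈ range E.n, β z * ρ ^ j *
        ((if E.nbr col z (y + 1) ≠ 0 then 1 else 0) *
        if ∀ i < s, j + 1 ≤ i → E.nbr col z (S'.a 3 i) ≠ 0 then 1 else 0))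
      (fun y _ => ?_) (fun y hy => ?_) ?_
    · refine add_nonneg hc₀ (sum_nonneg fun z _ => ?_)
      have := hβ z
      positivity
    · refine Det.expect (Q := fun S'' => S'' = ((S'.setV 26 j).setV 28 y).setA 3 j (y + 1))
        (Det.of_write (m := m) (S := (S'.setV 26 j).setV 28 y) (t := 3) (e := .var 26)
          (f := .add (.var 28) (.lit 1)) hw ?_ ?_ ?_) ?_
      · simp [addr]; omega
      · exact ⟨by simp, hw1, by simp; omega⟩
      · simp
      · rintro _ rfl
        refine (hh' _ ⟨by simp; omega, fun i h26 h28 => ?_, fun t ht => ?_, fun i hi his => ?_⟩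
          (by simp)).trans (ENNReal.ofReal_le_ofReal ?_)
        · simp [h26, h28, hD.frame_v i h26 h28]
        · simp [HState.setA_a_ne _ _ _ ht, hD.frame_a t ht]
        · simp only [HState.setA_v, HState.setV_v] at hi
          norm_num at hi
          simp only [HState.setA_a_same, HState.setV_a, update_apply]
          split_ifs with hij
          · omega
          · exact hD.mem i (by omega) his
        · refine add_le_add_right (sum_le_sum fun z _ => ?_) _
          have e26 : (((S'.setV 26 j).setV 28 y).setA 3 j (y + 1)).v 26 = j := by simp
          rw [e26]
          refine mul_le_mul_of_nonneg_left ?_ (mul_nonneg (hβ z) (by positivity))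
          by_cases hall : ∀ i < s, j ≤ i →
              E.nbr col z ((((S'.setV 26 j).setV 28 y).setA 3 j (y + 1)).a 3 i) ≠ 0
          · rw [if_pos hall, if_pos, if_pos]
            · norm_num
            · intro i hi hji
              have := hall i hi (by omega)
              rwa [HState.setA_a_same, update_of_ne (by omega)] at this
            · have := hall j (by omega) le_rfl
              rwa [HState.setA_a_same, update_self] at this
          · rw [if_neg hall]; positivity
    · have hκ0 : (0 : ℝ) < κ := by exact_mod_cast hκ
      rw [div_le_iff₀ hκ0, sum_add_distrib, sum_comm, add_mul, sum_mul]
      refine add_le_add (by simp [mul_comm]) (sum_le_sum fun z hz => ?_)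
      rw [← mul_sum, ← sum_mul, hj, pow_succ]
      have h2 := hρ z (mem_range.1 hz)
      rw [card_filter] at h2
      push_cast at h2
      have h3 : 0 ≤ β z * ρ ^ j := mul_nonneg (hβ z) (by positivity)
      calc _ ≤ β z * ρ ^ j * ((ρ * κ) *
          if ∀ i < s, j + 1 ≤ i → E.nbr col z (S'.a 3 i) ≠ 0 then 1 else 0) := by
            refine mul_le_mul_of_nonneg_left (mul_le_mul_of_nonneg_right h2 ?_) h3
            positivity
        _ = _ := by ring
  · refine ⟨by simp, fun i h26 h28 => by simp [h26], fun t ht => rfl, fun i hi his => ?_⟩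
    simp at hi
    omega
  · rintro S' ⟨h1, hD⟩ h0
    simp only [Expr.eval] at h0
    rw [h0] at hD
    refine (hh S' hD).trans (ENNReal.ofReal_le_ofReal ?_)
    simp [h0]

end

end WordRAM

namespace WordRAM

open Function EdgeList Finset

open scoped ENNReal

/-- Takes a random edge out of the queue, array `7` of length `v 9`, and processes it. -/
def popProcess : Program :=
  .seq (assign 9 (.sub (.var 9) (.lit 1)))
  (.seq (assign 13 (.get 7 (.var 12)))
  (.seq (write 7 (.var 12) (.get 7 (.var 9))) process))

/-- A bound for the time of `popProcess`. -/
def popTime (s ℓ : ℕ) : ℕ :=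
  (assign 9 (.sub (.var 9) (.lit 1))).size + ((assign 13 (.get 7 (.var 12))).size +
    ((write 7 (.var 12) (.get 7 (.var 9))).size + processTime s ℓ + 1) + 1) + 1

/-- The palette is longer when the queue is shorter. -/
def paletteSize : Expr :=
  .add (.div (.mul (.mul (.lit 32) (.var 7)) (.var 1)) (.var 9)) (.lit 1)

/-- One round of the random coloring phase. -/
def round : Program :=
  .seq (assign 10 paletteSize)
  (.seq drawPalette
  (.seq (randE 11 (.var 8))
  (.seq (randE 12 (.var 9)) popProcess)))

/-- A bound for the time of `round`. -/
def roundTime (s ℓ : ℕ) : ℕ :=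
  (assign 10 paletteSize).size + (drawTime s + ((randE 11 (.var 8)).size +
    ((randE 12 (.var 9)).size + popTime s ℓ + 1) + 1) + 1) + 1

/-- The condition under which the random coloring phase goes on. -/
def queueLong : Expr :=
  .sub (.mul (.var 9) (.mul (.lit 100) (.var 3))) (.mul (.var 1) (.var 4))

/-- The random coloring phase. -/
def randomPhase : Program := whileE queueLong round

/-- The invariant of the random coloring phase. -/
structure Phase (E : EdgeList) (q κ Δ e L ℓ : ℕ) (S : HState) : Prop where
  holds : Holds E q κ (S.a 2) S
  v1 : S.v 1 = E.m
  v2 : S.v 2 = q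
  v3 : S.v 3 = Δ
  v4 : S.v 4 = e
  v5 : S.v 5 = κ
  v7 : S.v 7 = L
  v8 : S.v 8 = ℓ
  queue : E.Queue (S.v 9) (S.a 7) (S.a 2)
  le : S.v 9 ≤ E.m
  ge : E.m * e < 100 * Δ * (S.v 9 + 1)

/-- Relations between the parameters of the algorithm and the word length. -/
structure Setup (w : ℕ) (E : EdgeList) (q κ Δ e L ℓ s : ℕ) : Prop where
  params : E.Params Δ e L ℓ
  fits : Fits w E q s ℓ
  κ_eq : κ = Δ + e / 2
  word₁ : 100 * Δ * E.m < 2 ^ w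
  word₂ : 33 * L * E.m + 1 < 2 ^ w
  palette : ∀ r ≤ E.m, E.m * e < 100 * Δ * r → 32 * L * E.m / r + 1 ≤ s

/-- The potential of a state in the random coloring phase, with an allowance `p` for the failure of the
final phase. -/
noncomputable def potential (E : EdgeList) (Δ e : ℕ) (p : ℝ) (S : HState) : ℝ :=
  min 1 (E.core Δ e (S.v 9) (S.a 7) (S.a 2) + E.tail Δ e (S.v 9) (S.a 7) + p)

section

variable {w : ℕ} {E : EdgeList} {q κ Δ e L ℓ s : ℕ} {S : HState} {p : ℝ} {h : HState → ℝ≥0∞}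

theorem roundBound_nonneg {r s' : ℕ} {perm col pal : ℕ → ℕ} (hp : 0 ≤ p) (cnt k : ℕ) :
    0 ≤ E.roundBound Δ e r perm col s' pal p cnt k := by
  classical
  refine le_min zero_le_one (add_nonneg (add_nonneg (mul_nonneg (sum_nonneg fun v _ => ?_)
    (Real.exp_pos _).le) tail_nonneg) hp)
  positivity

theorem loopTime_mono_both {e : Expr} {t t' k k' : ℕ} (ht : t ≤ t') (hk : k ≤ k') :
    loopTime e t k ≤ loopTime e t' k' := by
  unfold loopTime
  gcongr

theorem findTime_mono {x y s s' : ℕ} (h : s ≤ s') : findTime x y s ≤ findTime x y s' := by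
  unfold findTime
  exact Nat.add_le_add_right (Nat.add_le_add_left (Nat.add_le_add_right
    (Nat.add_le_add_left (loopTime_mono h) _) _) _) _

theorem fanStepTime_mono {s s' : ℕ} (h : s ≤ s') : fanStepTime s ≤ fanStepTime s' := by
  have h1 := findTime_mono (x := 20) (y := 16) h
  have h2 : searchTime s ≤ searchTime s' := by
    unfold searchTime
    exact Nat.add_le_add_right (Nat.add_le_add_left (Nat.add_le_add_right
      (Nat.add_le_add_left (loopTime_mono h) _) _) _) _
  unfold fanStepTime
  generalize findTime 20 16 s = a at *
  generalize findTime 20 16 s' = a' at *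
  omega

theorem processTime_mono {s s' : ℕ} (h : s ≤ s') : processTime s ℓ ≤ processTime s' ℓ := by
  have h1 := findTime_mono (x := 14) (y := 15) h
  have h2 : buildTime s ≤ buildTime s' := by
    have := loopTime_mono_both (e := .var 19) (fanStepTime_mono h) (Nat.add_le_add_right h 1)
    unfold buildTime
    generalize loopTime _ _ _ = a at *
    generalize loopTime _ _ _ = a' at *
    omega
  have h3 : shiftTime s ≤ shiftTime s' := by
    have := loopTime_mono (e := .sub (.var 27) (.var 30)) (t := shiftStep.size) h
    unfold shiftTime
    generalize loopTime _ _ s = a at *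
    generalize loopTime _ _ s' = a' at *
    omega
  unfold processTime
  generalize findTime 14 15 s = a at *
  generalize findTime 14 15 s' = a' at *
  omega

/-- Once the palette, the path length and the edge are drawn, a round is deterministic. -/
theorem popProcess_expect (hs : Setup w E q κ Δ e L ℓ s) {s' r cnt k : ℕ} {S₀ : HState}
    (hI : Phase E q κ Δ e L ℓ S₀) (hr : S₀.v 9 = r) (hr2 : 2 ≤ r)
    (hlong : E.m * e < 100 * Δ * r) (hs' : s' ≤ s) {pal : ℕ → ℕ}
    (hpal : ∀ j < s', 1 ≤ pal j ∧ pal j ≤ κ) (h10 : S.v 10 = s') (h3 : S.a 3 = pal)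
    (h11 : S.v 11 = cnt) (h12 : S.v 12 = k) (hcnt : cnt < ℓ) (hk : k < r)
    (hv : ∀ i < 10, S.v i = S₀.v i) (ha : ∀ t, t ≠ 3 → S.a t = S₀.a t)
    (hh : ∀ S', Phase E q κ Δ e L ℓ S' → S'.v 9 < r →
      h S' ≤ ENNReal.ofReal (potential E Δ e p S')) :
    Expect w E.m popProcess (popTime s' ℓ) S h (ENNReal.ofReal
      (E.roundBound Δ e r (S₀.a 7) (S₀.a 2) s' pal p cnt k)) := by
  have hw := hs.fits.word
  have hF1 := hs.fits.table
  have hw1 : 1 < 2 ^ w := by omega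
  have hle := hI.le
  have hQ := hI.queue
  rw [hr] at hle hQ
  have hf := hQ.lt k hk
  have hv9 : S.v 9 = r := by rw [hv 9 (by omega), hr]
  have ha7 : S.a 7 = S₀.a 7 := ha 7 (by omega)
  have hfl := hQ.lt (r - 1) (by omega)
  have hdet : Det w E.m popProcess (popTime s' ℓ) S fun S' => Phase E q κ Δ e L ℓ S' ∧
      S'.v 9 = r - 1 ∧ S'.a 7 = pop r k (S₀.a 7) ∧
      Outcome E (S₀.a 2) (S₀.a 7 k) s' pal cnt (S'.a 2) := by
    unfold popProcess popTime
    refine Det.assign_seq hw (by omega) ⟨by simp, hw1⟩ (v := r - 1) (by simp [hv9]) ?_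
    refine Det.assign_seq hw (by omega) ⟨by simp, by omega, by omega, ?_⟩ (v := S₀.a 7 k)
      (by simp [h12, ha7]) ?_
    · simp [h12, addr]; omega
    refine Det.write_seq hw (i := k) (v := S₀.a 7 (r - 1)) ⟨by simp, by omega, by omega, ?_⟩
      ⟨by simp, by omega, by omega, ?_⟩ (by simp [h12]) (by simp [ha7]) ?_
    · simp [h12, addr]; omega
    · simp [addr]; omega
    have H1 : Holds E q κ (S₀.a 2) (((S.setV 9 (r - 1)).setV 13 (S₀.a 7 k)).setA 7 k
        (S₀.a 7 (r - 1))) := hI.holds.frame (by simp [hv]) (by simp [HState.setA_a_ne, ha])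
        (by simp [HState.setA_a_ne, ha]) (by simp [HState.setA_a_ne, ha])
        (by simp [HState.setA_a_ne, ha])
    refine (process_spec hs.fits H1 (f := S₀.a 7 k) (s' := s') (cnt := cnt) (pal := pal) (by simp)
      hf (hQ.uncolored k hk) (by simp [h11]) hcnt.le (by simp [h10]) hs'
      (by simp [HState.setA_a_ne, h3]) hpal).mono le_rfl ?_
    rintro S' ⟨C, H2, hO, hv2, ha2⟩
    have e9 : S'.v 9 = r - 1 := by rw [hv2 9 (by omega) (by omega)]; simp
    have e7 : S'.a 7 = pop r k (S₀.a 7) := by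
      rw [ha2 7 (by omega) (by omega) (by omega) (by omega)]
      simp [pop, ha7]
    obtain rfl := H2.output
    refine ⟨⟨H2, ?_, ?_, ?_, ?_, ?_, ?_, ?_, ?_, ?_, ?_⟩, e9, e7, hO⟩
    · rw [hv2 1 (by omega) (by omega), ← hI.v1, ← hv 1 (by omega)]; simp
    · rw [hv2 2 (by omega) (by omega), ← hI.v2, ← hv 2 (by omega)]; simp
    · rw [hv2 3 (by omega) (by omega), ← hI.v3, ← hv 3 (by omega)]; simp
    · rw [hv2 4 (by omega) (by omega), ← hI.v4, ← hv 4 (by omega)]; simp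
    · rw [hv2 5 (by omega) (by omega), ← hI.v5, ← hv 5 (by omega)]; simp
    · rw [hv2 7 (by omega) (by omega), ← hI.v7, ← hv 7 (by omega)]; simp
    · rw [hv2 8 (by omega) (by omega), ← hI.v8, ← hv 8 (by omega)]; simp
    · rw [e9, e7]; exact hQ.pop hk hO.keep
    · omega
    · rw [e9, show r - 1 + 1 = r by omega]; exact hlong
  refine hdet.expect fun S' hS' => ?_
  obtain ⟨h1, h2, h4, h5⟩ := hS'
  refine (hh S' h1 (by omega)).trans (ENNReal.ofReal_le_ofReal ?_)
  have := min_potential_le_roundBound (Δ := Δ) (e := e) (p := p) hQ hk h5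
  rwa [← h4, ← h2] at this

open Classical in
/-- A round, for a given bound of the average over path lengths and edges. -/
theorem round_expect_of_average (hs : Setup w E q κ Δ e L ℓ s) (hI : Phase E q κ Δ e L ℓ S)
    {r s' : ℕ} (hr : S.v 9 = r) (hr2 : 2 ≤ r) (hlong : E.m * e < 100 * Δ * r)
    (hs' : s' = 32 * L * E.m / r + 1) (hp : 0 ≤ p)
    (hh : ∀ S', Phase E q κ Δ e L ℓ S' → S'.v 9 < r →
      h S' ≤ ENNReal.ofReal (potential E Δ e p S'))
    {c₀ ρ : ℝ} {β : ℕ → ℝ} (hc₀ : 0 ≤ c₀) (hβ : ∀ z, 0 ≤ β z) (hρ0 : 0 ≤ ρ)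
    (hρ : ∀ z < E.n, (#{c ∈ range κ | E.nbr (S.a 2) z (c + 1) ≠ 0} : ℝ) ≤ ρ * κ)
    (hav : ∀ pal : ℕ → ℕ, (∀ j < s', 1 ≤ pal j) →
      (∑ cnt ∈ range ℓ, (∑ k ∈ range r,
        E.roundBound Δ e r (S.a 7) (S.a 2) s' pal p cnt k) / r) / ℓ ≤
      c₀ + ∑ z ∈ range E.n, β z * if ∀ j < s', E.nbr (S.a 2) z (pal j) ≠ 0 then 1 else 0) :
    Expect w E.m round (roundTime s ℓ) S h
      (ENNReal.ofReal (c₀ + ∑ z ∈ range E.n, β z * ρ ^ s')) := by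
  have hw := hs.fits.word
  have hF1 := hs.fits.table
  have hw1 : 1 < 2 ^ w := by omega
  have hle := hI.le
  have hss : s' ≤ s := by rw [hs']; exact hs.palette r (by omega) hlong
  have hr0 : 0 < r := by omega
  have hm0 : 0 < E.m := by omega
  have hn0 : 0 < E.n := (Nat.zero_le _).trans_lt (E.U_lt 0 hm0)
  have hκq : κ + 1 < 2 ^ w := by
    have := hI.holds.le'
    have := tableIndex_lt hn0 this
    omega
  have hℓ0 : 0 < ℓ := by
    by_contra hc
    have h1 := hs.params.ℓ_ge
    rw [show ℓ = 0 by omega, zero_mul] at h1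
    have := hs.params.L_pos
    have := hs.params.e_ge.trans hs.params.e_le
    have : 0 < 10 ^ 9 * L ^ 2 * Δ ^ 2 := by positivity
    omega
  have hκ0 : 0 < κ := by
    have := hs.params.e_ge.trans hs.params.e_le
    rw [hs.κ_eq]; omega
  have hword := hs.word₂
  have hdiv : 32 * L * E.m / r ≤ 32 * L * E.m := Nat.div_le_self _ _
  have hLm : 32 * L * E.m ≤ 33 * L * E.m := by gcongr; omega
  have h32 : 32 * L ≤ 32 * L * E.m := Nat.le_mul_of_pos_right _ hm0
  have hL1 := hs.params.L_pos
  refine Expect.mono (t := roundTime s' ℓ) ?_ ?_ (fun _ => le_rfl) le_rfl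
  swap
  · have h1 := processTime_mono (ℓ := ℓ) hss
    have h2 : drawTime s' ≤ drawTime s := by
      unfold drawTime
      gcongr
      exact loopTime_mono hss
    unfold roundTime popTime
    omega
  unfold round roundTime
  refine Det.seq_expect (Q := fun S' => S' = S.setV 10 s')
    (Det.of_assign (m := E.m) (S := S) (e := paletteSize) hw (by omega) ?_ ?_) ?_
  · simp only [paletteSize, Expr.ok, Expr.eval, hI.v7, hI.v1, hr]
    omega
  · simp only [paletteSize, Expr.eval, hI.v7, hI.v1, hr, hs']
  rintro _ rfl
  refine Expect.seq (h := fun S' => if Drawn κ s' (S.setV 10 s') 0 S' then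
    ENNReal.ofReal (c₀ + ∑ z ∈ range E.n, β z *
      if ∀ j < s', E.nbr (S.a 2) z (S'.a 3 j) ≠ 0 then 1 else 0) else ⊤)
    (drawPalette_expect hw (by simp) (by simp [hI.v5]) hκ0 hκq (by omega) hc₀ hβ hρ0 hρ
      fun S' hS' => by rw [if_pos hS']) fun S₁ hS₁ => ?_
  have hD : Drawn κ s' (S.setV 10 s') 0 S₁ := by
    by_contra hc
    exact hS₁ (if_neg hc)
  rw [if_pos hD]
  have hv₁ : ∀ i < 10, S₁.v i = S.v i := fun i hi => by
    rw [hD.frame_v i (by omega) (by omega)]; simp [show i ≠ 10 by omega]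
  have h10 : S₁.v 10 = s' := by rw [hD.frame_v 10 (by omega) (by omega)]; simp
  refine Expect.rand_seq hw (by omega) (by simp) (N := ℓ) (by simp [hv₁, hI.v8]) hℓ0
    (a := fun cnt => (∑ k ∈ range r,
        E.roundBound Δ e r (S.a 7) (S.a 2) s' (S₁.a 3) p cnt k) / r)
    (fun cnt _ => div_nonneg (sum_nonneg fun k _ => roundBound_nonneg hp _ _) (Nat.cast_nonneg _))
    (fun cnt hcnt => ?_) (hav _ fun j hj => (hD.mem j (Nat.zero_le _) hj).1)
  refine Expect.rand_seq hw (by omega) (by simp) (N := r) (by simp [hv₁, hr]) hr0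
    (a := fun k => E.roundBound Δ e r (S.a 7) (S.a 2) s' (S₁.a 3) p cnt k)
    (fun k _ => roundBound_nonneg hp _ _) (fun k hk => ?_) le_rfl
  refine popProcess_expect hs hI hr hr2 hlong hss (fun j hj => hD.mem j (Nat.zero_le _) hj)
    (by simp [h10]) (by simp) (by simp) (by simp) hcnt hk (fun i hi => ?_) (fun t ht => ?_) hh
  · simp [show i ≠ 12 by omega, show i ≠ 11 by omega, hv₁ i hi]
  · simp [hD.frame_a t ht]

theorem Phase.two_le (hs : Setup w E q κ Δ e L ℓ s) (hI : Phase E q κ Δ e L ℓ S) :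
    3 ≤ S.v 9 := by
  have h1 := hI.ge
  have h2 := hs.params.le_m
  have h3 := hs.params.e_ge
  have h4 : Δ * 400 ≤ E.m * e := Nat.mul_le_mul h2 h3
  have h5 : 100 * Δ * 4 < 100 * Δ * (S.v 9 + 1) := by omega
  have := Nat.lt_of_mul_lt_mul_left h5
  omega

/-- The potential does not increase on average. -/
theorem round_expect (hs : Setup w E q κ Δ e L ℓ s) (hI : Phase E q κ Δ e L ℓ S)
    (hlong : E.m * e < 100 * Δ * S.v 9) (hp : 0 ≤ p)
    (hh : ∀ S', Phase E q κ Δ e L ℓ S' → S'.v 9 < S.v 9 →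
      h S' ≤ ENNReal.ofReal (potential E Δ e p S')) :
    Expect w E.m round (roundTime s ℓ) S h (ENNReal.ofReal (potential E Δ e p S)) := by
  classical
  have h2 := hI.two_le hs
  have hle := hI.le
  have hQ := hI.queue
  have hpr := hI.holds.proper
  generalize hr : S.v 9 = r at *
  by_cases hc : 1 ≤ E.core Δ e r (S.a 7) (S.a 2) + E.tail Δ e r (S.a 7) + p
  · have := round_expect_of_average hs hI hr (by omega) hlong rfl hp hh (c₀ := 1) (ρ := 1)
      (β := fun _ => 0) zero_le_one (fun _ => le_rfl) zero_le_one (fun z _ => ?_) fun pal _ => ?_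
    · rw [potential, hr, min_eq_left hc]
      simpa using this
    · rw [one_mul]
      exact_mod_cast (card_filter_le _ _).trans (card_range κ).le
    · have h1 : ∀ cnt, (∑ k ∈ range r, E.roundBound Δ e r (S.a 7) (S.a 2)
          (32 * L * E.m / r + 1) pal p cnt k) / r ≤ 1 := fun cnt => by
        refine div_le_one_of_le₀ ((sum_le_sum fun k _ => min_le_left 1 _).trans ?_)
          (Nat.cast_nonneg _)
        simp
      refine (div_le_one_of_le₀ ((sum_le_sum fun k _ => h1 k).trans ?_)
          (Nat.cast_nonneg _)).trans ?_ <;> simp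
  · push Not at hc
    have ht : E.tail Δ e r (S.a 7) < 1 := by
      have := core_nonneg (E := E) (Δ := Δ) (e := e) (r := r) (perm := S.a 7) (col := S.a 2)
      linarith
    have hr0 : (0 : ℝ) < r := by exact_mod_cast (by omega : 0 < r)
    have hm0 : (0 : ℝ) < E.m := by exact_mod_cast (by omega : 0 < E.m)
    have hx1 : (r / E.m : ℝ) ≤ 1 := (div_le_one hm0).2 (by exact_mod_cast hle)
    have hx0 : 0 ≤ (r / E.m : ℝ) := by positivity
    obtain ⟨D, hD, hD2⟩ := hs.params.round_le (p := p) (by omega) hle hlong rfl hQ ht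
      (col := S.a 2) (L := L) (ℓ := ℓ)
    have hℓ0 : 0 < ℓ := by
      by_contra hc
      have h1 := hs.params.ℓ_ge
      rw [show ℓ = 0 by omega, zero_mul] at h1
      have := hs.params.L_pos
      have := hs.params.e_ge.trans hs.params.e_le
      have : 0 < 10 ^ 9 * L ^ 2 * Δ ^ 2 := by positivity
      omega
    have hc0 : 0 ≤ E.roundConst Δ e r (S.a 7) (S.a 2) (32 * L * E.m / r + 1) ℓ D p := by
      refine add_nonneg (add_nonneg (mul_nonneg (sum_nonneg fun v _ => ?_)
        (Real.exp_pos _).le) tail_nonneg) hp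
      positivity
    have hb0 : ∀ z, 0 ≤ E.roundWeight Δ e r (S.a 7) (S.a 2) z := fun z => by
      unfold roundWeight
      positivity
    refine (round_expect_of_average hs hI hr (by omega) hlong rfl hp hh hc0 hb0
      (ρ := 1 - (r / E.m : ℝ) / 8) (by linarith)
      (fun z hz => hs.params.present_le (by omega) hle hs.κ_eq hpr hQ ht hz) fun pal hpal =>
        average_roundBound_le hpr (fun j hj => by have := hpal j hj; omega) hD (by omega)
          hℓ0).mono le_rfl (fun _ => le_rfl) ?_
    rw [potential, hr, min_eq_right hc.le]
    exact ENNReal.ofReal_le_ofReal hD2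

/-- At the end of the random coloring phase, the mean of the potential is at most its initial value. -/
theorem randomPhase_expect (hs : Setup w E q κ Δ e L ℓ s) (hI : Phase E q κ Δ e L ℓ S)
    (hp : 0 ≤ p) (hh : ∀ S', Phase E q κ Δ e L ℓ S' → 100 * Δ * S'.v 9 ≤ E.m * e →
      h S' ≤ ENNReal.ofReal (potential E Δ e p S')) :
    Expect w E.m randomPhase (loopTime queueLong (roundTime s ℓ) (S.v 9)) S h
      (ENNReal.ofReal (potential E Δ e p S)) := by
  refine Expect.of_whileE hs.fits.word (Phase E q κ Δ e L ℓ) (fun S' => S'.v 9)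
    (fun S' => ENNReal.ofReal (potential E Δ e p S')) (fun S' hS' => ?_) (fun S' hS' hne h' hh' => ?_)
    hI fun S' hS' h0 => ?_
  · have h1 := hs.word₁
    have h2 := hs.params.e_le
    have h3 := hS'.le
    have hm : 1 ≤ E.m := (by have := hS'.two_le hs; omega)
    have h4 : S'.v 9 * (100 * Δ) ≤ 100 * Δ * E.m := by rw [mul_comm]; gcongr
    have h5 : E.m * e ≤ 100 * Δ * E.m := by
      rw [mul_comm]
      exact Nat.mul_le_mul_right _ (by omega)
    have h6 : 100 * Δ ≤ 100 * Δ * E.m := Nat.le_mul_of_pos_right _ hm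
    have h7 := hs.params.e_ge
    simp only [queueLong, Expr.ok, Expr.eval, hS'.v3, hS'.v4, hS'.v1]
    omega
  · simp only [queueLong, Expr.eval, hS'.v3, hS'.v4, hS'.v1] at hne
    rw [mul_comm (S'.v 9)] at hne
    exact round_expect hs hS' (by omega) hp hh'
  · simp only [queueLong, Expr.eval, hS'.v3, hS'.v4, hS'.v1] at h0
    rw [mul_comm (S'.v 9)] at h0
    exact hh S' hS' (by omega)

end

end WordRAM

/-! ### The final phase: coloring the remaining edges greedily with reserved colors -/

namespace WordRAM

open Function EdgeList Finset

open scoped ENNReal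

/-- Tries a random color above `v 5` for the edge `v 13`, and moves on to the next edge if the color is
missing at both endpoints. -/
def tryColor : Program :=
  .seq (assign 28 (.add (.add (.var 28) (.lit 1)) (.var 5)))
    (ifE (.add (cell (fstEnd 13) (.var 28)) (cell (sndEnd 13) (.var 28))) .skip
      (.seq (setColor 13 28) (assign 27 (.var 13))))

/-- One round of the final phase; all edges from `v 27` on are colored. -/
def finalStep : Program :=
  .seq (assign 26 (.sub (.var 26) (.lit 1)))
  (ifE (.var 27)
    (.seq (assign 13 (.sub (.var 27) (.lit 1)))
      (ifE (.get 2 (.var 13)) (assign 27 (.var 13))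
        (.seq (randE 28 (.sub (.var 2) (.var 5))) tryColor)))
    .skip)

/-- The final phase. -/
def finalPhase : Program :=
  .seq (assign 26 (.mul (.lit 8) (.var 1)))
  (.seq (assign 27 (.var 1)) (whileE (.var 26) finalStep))

/-- A bound for the time of `finalPhase`. -/
def finalTime (m : ℕ) : ℕ :=
  (assign 26 (.mul (.lit 8) (.var 1))).size + ((assign 27 (.var 1)).size +
    loopTime (.var 26) finalStep.size (8 * m) + 1) + 1

/-- At each vertex, all but `B` edges have a color in `1, …, κ`. -/
def FewLeft (E : EdgeList) (κ B : ℕ) (col : ℕ → ℕ) : Prop :=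
  ∀ v, #{i ∈ range E.m | E.Inc i v ∧ (col i = 0 ∨ κ < col i)} ≤ B

/-- The invariant of the final phase. If `G` holds, then few edges are left at each vertex. -/
structure Final (E : EdgeList) (q κ B : ℕ) (G : Prop) (S : HState) : Prop where
  holds : Holds E q q (S.a 2) S
  v2 : S.v 2 = q
  v5 : S.v 5 = κ
  le : S.v 27 ≤ E.m
  colored : ∀ i, S.v 27 ≤ i → i < E.m → S.a 2 i ≠ 0
  few : G → FewLeft E κ B (S.a 2)

open Classical in
/-- The potential of the final phase when `i` edges are to be considered in `b` rounds. -/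
noncomputable def finalPotential (G : Prop) (i b : ℕ) : ℝ :=
  if G then (if i = 0 then 0 else 4 ^ i * (5 / 8) ^ b) else 1

theorem finalPotential_nonneg (G : Prop) (i b : ℕ) : 0 ≤ finalPotential G i b := by
  unfold finalPotential
  split_ifs <;> positivity

theorem finalPotential_zero_le (G : Prop) (b b' : ℕ) :
    finalPotential G 0 b ≤ finalPotential G 0 b' := by
  simp [finalPotential]

theorem finalPotential_succ_le (G : Prop) (i b : ℕ) :
    finalPotential G i b ≤ finalPotential G (i + 1) (b + 1) := by
  unfold finalPotential
  split_ifs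
  · simp_all
  · positivity
  · simp_all
  · rw [pow_succ, pow_succ (5 / 8 : ℝ)]
    have : (0 : ℝ) ≤ 4 ^ i * (5 / 8) ^ b := by positivity
    nlinarith
  · exact le_rfl

section

variable {w : ℕ} {E : EdgeList} {q κ B ℓ s : ℕ} {G : Prop} {S : HState} {h : HState → ℝ≥0∞}

theorem FewLeft.color {col : ℕ → ℕ} (h : FewLeft E κ B col) {i c : ℕ} (hi : col i = 0)
    (hc : κ < c) : FewLeft E κ B (update col i c) := by
  intro v
  convert h v using 2
  refine filter_congr fun j _ => ?_
  by_cases hj : j = i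
  · subst hj; simp [hi, hc]
  · simp [update_of_ne hj]

theorem FewLeft.card_le {col : ℕ → ℕ} (h : FewLeft E κ B col) (hp : E.Proper col) (N z : ℕ) :
    #{y ∈ range N | E.nbr col z (y + 1 + κ) ≠ 0} ≤ B := by
  refine le_trans (card_le_card_of_injOn (fun y => E.nbr col z (y + 1 + κ) - 1) (fun y hy => ?_)
    fun y hy y' hy' hyy => ?_) (h z)
  · simp only [coe_filter, mem_range, Set.mem_ofPred_eq] at hy ⊢
    obtain ⟨g1, g2, g3⟩ := nbr_spec hp (by omega) hy.2
    exact ⟨g1, g2, Or.inr (by omega)⟩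
  · simp only [coe_filter, mem_range, Set.mem_ofPred_eq] at hy hy'
    have g3 := (nbr_spec hp (by omega) hy.2).2.2
    have g3' := (nbr_spec hp (by omega) hy'.2).2.2
    simp only at hyy
    rw [hyy] at g3
    omega

theorem tryColor_expect (hF : Fits w E q s ℓ) (hκq : κ < q) {b i y : ℕ}
    (hI : Final E q κ B G S) (h13 : S.v 13 = i) (h27 : S.v 27 = i + 1) (h26 : S.v 26 = b)
    (h28 : S.v 28 = y) (hy : y < q - κ) (hi0 : S.a 2 i = 0)
    (hh : ∀ S', Final E q κ B G S' → S'.v 26 = b →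
      h S' ≤ ENNReal.ofReal (finalPotential G (S'.v 27) (S'.v 26))) :
    Expect w E.m tryColor tryColor.size S h (ENNReal.ofReal
      (finalPotential G (if E.nbr (S.a 2) (E.U i) (y + 1 + κ) + E.nbr (S.a 2) (E.V i) (y + 1 + κ) = 0
        then i else i + 1) b)) := by
  have hw := hF.word
  have hw1 : 1 < 2 ^ w := by omega
  have hF1 := hF.table
  have him : i < E.m := by have := hI.le; omega
  have hU := E.U_lt i him
  have hV := E.V_lt i him
  have hcw := hF.color_lt (by omega) (show y + 1 + κ ≤ q by omega)
  have hnb : ∀ v, E.nbr (S.a 2) v (y + 1 + κ) ≤ E.m := fun v => hI.holds.nbr_le (by omega)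
  have hdet : Det w E.m tryColor tryColor.size S fun S' => Final E q κ B G S' ∧ S'.v 26 = b ∧
      S'.v 27 = if E.nbr (S.a 2) (E.U i) (y + 1 + κ) + E.nbr (S.a 2) (E.V i) (y + 1 + κ) = 0
        then i else i + 1 := by
    unfold tryColor
    refine (Det.assign_seq (m := E.m) (S := S) (e := .add (.add (.var 28) (.lit 1)) (.var 5))
      (t := (ifE (.add (cell (fstEnd 13) (.var 28)) (cell (sndEnd 13)
      (.var 28))) .skip (.seq (setColor 13 28) (assign 27 (.var 13)))).size) hw (by omega)
      ⟨⟨by simp, hw1, by simp [h28]; omega⟩, by simp, by simp [h28, hI.v5]; omega⟩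
      (v := y + 1 + κ) (by simp [h28, hI.v5]) ?_).mono (by simp only [Program.size]; omega)
      fun _ => id
    have H1 := hI.holds.setV (x := 28) (y := y + 1 + κ) (by omega)
    have okU := hF.cell_ok H1.stride (fstEnd_ok hF (x := 13) (by omega) (by simp [h13]) him)
      (Expr.ok.eq_1 .. ▸ (by omega : 28 < 90) : (Expr.var 28).ok w E.m (S.setV 28 (y + 1 + κ)))
      (H1.fstEnd_eval (by simp [h13])) (c := y + 1 + κ) (by simp) hU (by omega)
    have evU := H1.cell_eval (H1.fstEnd_eval (x := 13) (by simp [h13])) (f := .var 28)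
      (c := y + 1 + κ) (by simp) hU (by omega) (by omega)
    have okV := hF.cell_ok H1.stride (sndEnd_ok hF (x := 13) (by omega) (by simp [h13]) him)
      (Expr.ok.eq_1 .. ▸ (by omega : 28 < 90) : (Expr.var 28).ok w E.m (S.setV 28 (y + 1 + κ)))
      (H1.sndEnd_eval (by simp [h13])) (c := y + 1 + κ) (by simp) hV (by omega)
    have evV := H1.cell_eval (H1.sndEnd_eval (x := 13) (by simp [h13])) (f := .var 28)
      (c := y + 1 + κ) (by simp) hV (by omega) (by omega)
    have h1 := hnb (E.U i)
    have h2 := hnb (E.V i)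
    refine Det.of_ifE_size hw ⟨okU, okV, ?_⟩ (fun hc => Det.skip ?_) fun hc => ?_
    · rw [evU, evV]; omega
    · simp only [Expr.eval] at hc evU evV
      rw [evU, evV] at hc
      rw [if_neg hc]
      exact ⟨⟨H1, by simp [hI.v2], by simp [hI.v5], by simpa using hI.le,
        fun j hj => hI.colored j (by simpa using hj), hI.few⟩, by simp [h26], by simp [h27]⟩
    · simp only [Expr.eval] at hc evU evV
      rw [evU, evV] at hc
      rw [if_pos hc]
      refine (Det.seq (setColor_spec hF H1 (x := 13) (y := 28) (g := i) (c := y + 1 + κ) (by omega)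
        (by omega) (by simp [h13]) (by simp) him (by omega) hi0 ?_)
        (t' := (assign 27 (.var 13)).size) ?_).mono (by simp only [Program.size]; omega) fun _ => id
      · rintro v (rfl | rfl) <;> omega
      · rintro S₁ ⟨H2, hv, ha⟩
        have h2 := H2.output
        have hx : Expr.eval S₁ (.var 13) = i := by simp [hv, h13]
        refine Det.of_assign hw (by omega) (by simp) ?_
        rw [hx]
        refine ⟨⟨?_, by simp [hv, hI.v2], by simp [hv, hI.v5], by simp; omega,
          fun j hj hjm => ?_, fun hG => ?_⟩, by simp [hv, h26], by simp⟩
        · rw [HState.setV_a, h2]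
          exact H2.setV (by omega)
        · simp only [HState.setV_v, if_true] at hj
          rw [HState.setV_a, h2, update_apply]
          split_ifs with hji
          · omega
          · exact hI.colored j (by omega) hjm
        · rw [HState.setV_a, h2]
          exact (hI.few hG).color hi0 (by omega)
  refine hdet.expect fun S' hS' => ?_
  obtain ⟨h1, h2, h3⟩ := hS'
  have := hh S' h1 h2
  rwa [h3, h2] at this

theorem finalStep_expect (hF : Fits w E q s ℓ) (hκq : κ < q) (hB : 4 * B ≤ q - κ)
    (hI : Final E q κ B G S) (h26 : S.v 26 ≠ 0)
    (hh : ∀ S', Final E q κ B G S' → S'.v 26 < S.v 26 →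
      h S' ≤ ENNReal.ofReal (finalPotential G (S'.v 27) (S'.v 26))) :
    Expect w E.m finalStep finalStep.size S h
      (ENNReal.ofReal (finalPotential G (S.v 27) (S.v 26))) := by
  classical
  have hw := hF.word
  have hw1 : 1 < 2 ^ w := by omega
  have hF1 := hF.table
  obtain ⟨b, hb⟩ : ∃ b, S.v 26 = b + 1 := ⟨S.v 26 - 1, by omega⟩
  unfold finalStep
  refine (Det.seq_expect (Q := fun S' => S' = S.setV 26 b)
    (Det.of_assign (m := E.m) (S := S) (e := .sub (.var 26) (.lit 1)) hw (by omega)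
        ⟨by simp, hw1⟩ (by simp [hb])) (h := h) (t' := ((Expr.var 27).comp 100).size +
    ((assign 13 (.sub (.var 27) (.lit 1))).size +
    (((Expr.get 2 (.var 13)).comp 100).size + ((assign 27 (.var 13)).size +
    ((randE 28 (.sub (.var 2) (.var 5))).size + tryColor.size + 1)) + 2) + 1 + 1) + 2)
    (x := ENNReal.ofReal (finalPotential G (S.v 27) (S.v 26)))
    ?_).mono (by simp only [Program.size, ifE]; omega) (fun _ => le_rfl) le_rfl
  rintro _ rfl
  have H1 := hI.holds.setV (x := 26) (y := b) (by omega)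
  have I1 : Final E q κ B G (S.setV 26 b) := ⟨H1, by simp [hI.v2], by simp [hI.v5],
    by simpa using hI.le, fun j hj => hI.colored j (by simpa using hj), hI.few⟩
  refine Expect.of_ifE hw (by simp) (fun hc => ?_) fun hc => ?_
  swap
  · simp only [Expr.eval, HState.setV_v] at hc
    norm_num at hc
    refine ((Det.skip (Q := fun S' => S' = S.setV 26 b) rfl).mono (by omega) fun _ => id).expect ?_
    rintro _ rfl
    refine (hh _ I1 (by simp; omega)).trans (ENNReal.ofReal_le_ofReal ?_)
    simp only [HState.setV_v]
    norm_num [hc]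
    exact finalPotential_zero_le _ _ _
  simp only [Expr.eval, HState.setV_v] at hc
  norm_num at hc
  obtain ⟨i, hi⟩ : ∃ i, S.v 27 = i + 1 := ⟨S.v 27 - 1, by omega⟩
  have him : i < E.m := by have := hI.le; omega
  refine Expect.mono (t := (assign 13 (.sub (.var 27) (.lit 1))).size +
    (((Expr.get 2 (.var 13)).comp 100).size + ((assign 27 (.var 13)).size +
    ((randE 28 (.sub (.var 2) (.var 5))).size + tryColor.size + 1)) + 2) + 1) ?_ (by omega)
    (fun _ => le_rfl) le_rfl
  refine Det.seq_expect (Q := fun S' => S' = (S.setV 26 b).setV 13 i)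
    (Det.of_assign (m := E.m) (S := S.setV 26 b) (e := .sub (.var 27) (.lit 1)) hw (by omega)
        ⟨by simp, hw1⟩ (by simp [hi])) ?_
  rintro _ rfl
  have I2 : Final E q κ B G ((S.setV 26 b).setV 13 i) := ⟨H1.setV (by omega), by simp [hI.v2],
    by simp [hI.v5], by simpa using hI.le, fun j hj => hI.colored j (by simpa using hj), hI.few⟩
  refine Expect.of_ifE hw ⟨by simp, by omega, fun _ => by simpa using him, ?_⟩ (fun hc => ?_)
    fun hc => ?_
  · simp [addr]; omega
  · simp only [Expr.eval, HState.setV_v, HState.setV_a, if_true] at hc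
    refine ((Det.of_assign (m := E.m) (S := (S.setV 26 b).setV 13 i) (e := .var 13) (x := 27) hw
      (by omega) (by simp) (Q := fun S' => S' = ((S.setV 26 b).setV 13 i).setV 27 i)
      (by simp)).mono (by omega) fun _ => id).expect ?_
    rintro _ rfl
    refine (hh (((S.setV 26 b).setV 13 i).setV 27 i) ⟨I2.holds.setV (by omega), by simp [hI.v2],
      by simp [hI.v5], by simp; omega, fun j hj hjm => ?_, hI.few⟩ (by simp; omega)).trans
      (ENNReal.ofReal_le_ofReal ?_)
    · simp only [HState.setV_v, if_true] at hj
      simp only [HState.setV_a]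
      by_cases hji : j = i
      · rw [hji]; exact hc
      · exact hI.colored j (by omega) hjm
    · simp only [HState.setV_v]
      norm_num
      rw [hb, hi]
      exact finalPotential_succ_le _ _ _
  simp only [Expr.eval, HState.setV_v, HState.setV_a, if_true] at hc
  refine Expect.mono (t := (randE 28 (.sub (.var 2) (.var 5))).size + tryColor.size + 1) ?_
    (by omega) (fun _ => le_rfl) le_rfl
  refine Expect.rand_seq (m := E.m) (S := (S.setV 26 b).setV 13 i) (e := .sub (.var 2) (.var 5)) hw
    (by omega) ⟨by simp, by simp⟩ (N := q - κ) (by simp [hI.v2, hI.v5])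
    (by omega) (a := fun y => finalPotential G (if E.nbr (S.a 2) (E.U i) (y + 1 + κ) +
      E.nbr (S.a 2) (E.V i) (y + 1 + κ) = 0 then i else i + 1) b)
    (fun y _ => finalPotential_nonneg _ _ _) (fun y hy => ?_) ?_
  · exact tryColor_expect hF hκq (S := (((S.setV 26 b).setV 13 i).setV 28 y)) (b := b) (i := i)
      (y := y) ⟨I2.holds.setV (by omega), by simp [hI.v2],
      by simp [hI.v5], by simpa using hI.le, fun j hj => hI.colored j (by simpa using hj), hI.few⟩
      (by simp) (by simp [hi]) (by simp) (by simp) hy hc fun S' h1 h2 => hh S' h1 (by omega)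
  · have hN : (0 : ℝ) < (q - κ : ℕ) := by exact_mod_cast (by omega : 0 < q - κ)
    rw [hb, hi, div_le_iff₀ hN]
    by_cases hG : G
    swap
    · simp [finalPotential, hG]
    have hX : (0 : ℝ) ≤ 4 ^ i * (5 / 8) ^ b := by positivity
    have h1 : ∀ y ∈ range (q - κ), finalPotential G (if E.nbr (S.a 2) (E.U i) (y + 1 + κ) +
        E.nbr (S.a 2) (E.V i) (y + 1 + κ) = 0 then i else i + 1) b ≤ 4 ^ i * (5 / 8) ^ b *
        (1 + 3 * ((if E.nbr (S.a 2) (E.U i) (y + 1 + κ) ≠ 0 then 1 else 0) +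
        (if E.nbr (S.a 2) (E.V i) (y + 1 + κ) ≠ 0 then 1 else 0))) := by
      intro y _
      have h2 : finalPotential G i b ≤ 4 ^ i * (5 / 8) ^ b := by
        rw [finalPotential, if_pos hG]
        split_ifs
        exacts [hX, le_rfl]
      have h3 : finalPotential G (i + 1) b = 4 * (4 ^ i * (5 / 8) ^ b) := by
        rw [finalPotential, if_pos hG, if_neg (by omega), pow_succ]; ring
      by_cases h6 : E.nbr (S.a 2) (E.U i) (y + 1 + κ) + E.nbr (S.a 2) (E.V i) (y + 1 + κ) = 0
      · rw [if_pos h6, if_neg (by omega), if_neg (by omega)]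
        simpa using h2
      · have h7 : (1 : ℝ) ≤ (if E.nbr (S.a 2) (E.U i) (y + 1 + κ) ≠ 0 then 1 else 0) +
            (if E.nbr (S.a 2) (E.V i) (y + 1 + κ) ≠ 0 then 1 else 0) := by
          split_ifs
          · norm_num
          · norm_num
          · norm_num
          · omega
        rw [if_neg h6, h3]
        nlinarith
    refine (sum_le_sum h1).trans ?_
    rw [← mul_sum, sum_add_distrib, ← mul_sum, sum_add_distrib]
    have h4 := (hI.few hG).card_le hI.holds.proper (q - κ) (E.U i)
    have h5 := (hI.few hG).card_le hI.holds.proper (q - κ) (E.V i)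
    rw [card_filter] at h4 h5
    have h6 : (∑ y ∈ range (q - κ), if E.nbr (S.a 2) (E.U i) (y + 1 + κ) ≠ 0 then (1 : ℝ) else 0) ≤
        B := by exact_mod_cast h4
    have h7 : (∑ y ∈ range (q - κ), if E.nbr (S.a 2) (E.V i) (y + 1 + κ) ≠ 0 then (1 : ℝ) else 0) ≤
        B := by exact_mod_cast h5
    have h8 : 4 * (B : ℝ) ≤ (q - κ : ℕ) := by exact_mod_cast hB
    have h9 : finalPotential G (i + 1) (b + 1) = 4 ^ i * (5 / 8) ^ b * (5 / 2) := by
      rw [finalPotential, if_pos hG, if_neg (by omega), pow_succ, pow_succ]; ring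
    rw [h9, mul_assoc _ (5 / 2 : ℝ)]
    refine mul_le_mul_of_nonneg_left ?_ hX
    simp only [sum_const, card_range, nsmul_eq_mul, mul_one]
    linarith

/-- If few edges are left at each vertex, the final phase colors all of them, except with a probability
given by the potential. -/
theorem finalPhase_expect (hF : Fits w E q s ℓ) (hκq : κ < q) (hB : 4 * B ≤ q - κ)
    (hH : Holds E q q (S.a 2) S) (h1 : S.v 1 = E.m) (h2 : S.v 2 = q) (h5 : S.v 5 = κ)
    (hG : G → FewLeft E κ B (S.a 2)) (hh1 : ∀ S', h S' ≤ 1)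
    (hh0 : ∀ S', Holds E q q (S'.a 2) S' → (∀ i < E.m, S'.a 2 i ≠ 0) → h S' = 0) :
    Expect w E.m finalPhase (finalTime E.m) S h
      (ENNReal.ofReal (finalPotential G E.m (8 * E.m))) := by
  have hw := hF.word
  have hF1 := hF.table
  unfold finalPhase finalTime
  refine Det.seq_expect (Q := fun S' => S' = S.setV 26 (8 * E.m))
    (Det.of_assign (m := E.m) (S := S) (e := .mul (.lit 8) (.var 1)) hw (by omega) ?_
      (by simp [h1])) ?_
  · simp [h1]; omega
  rintro _ rfl
  refine Det.seq_expect (Q := fun S' => S' = (S.setV 26 (8 * E.m)).setV 27 E.m)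
    (Det.of_assign (m := E.m) (S := S.setV 26 (8 * E.m)) (e := .var 1) hw (by omega) (by simp)
      (by simp [h1])) ?_
  rintro _ rfl
  have := Expect.of_whileE (m := E.m) hw (e := .var 26) (h := h) (P := finalStep)
    (t := finalStep.size) (Final E q κ B G) (fun S' => S'.v 26)
    (fun S' => ENNReal.ofReal (finalPotential G (S'.v 27) (S'.v 26))) (fun _ _ => by simp)
    (fun S' hI hne h' hh' => finalStep_expect hF hκq hB hI hne hh')
    (S := (S.setV 26 (8 * E.m)).setV 27 E.m)
    ⟨(hH.setV (by omega)).setV (by omega), by simp [h2], by simp [h5], by simp, fun i hi him => ?_,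
      hG⟩ fun S' hI h0 => ?_
  · simpa using this
  · simp at hi; omega
  · simp only [Expr.eval] at h0
    by_cases h27 : S'.v 27 = 0
    · rw [hh0 S' hI.holds fun i hi => hI.colored i (by omega) hi]
      exact zero_le
    · refine (hh1 S').trans ?_
      rw [ENNReal.one_le_ofReal, h0, finalPotential, if_neg h27]
      split_ifs
      · have : (1 : ℝ) ≤ 4 ^ S'.v 27 := one_le_pow₀ (by norm_num)
        simpa using this
      · exact le_rfl

end

end WordRAM

/-! ### Initialization and the whole program -/

namespace WordRAM

open Function EdgeList Finset

open scoped ENNReal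

/-- Counts edge `v 26` at its endpoint in array `x`; array `6` holds the degrees and `v 3` their
maximum. -/
def bump (x : ℕ) : Program :=
  .seq (assign 28 (.get x (.var 26)))
  (.seq (write 6 (.var 28) (.add (.get 6 (.var 28)) (.lit 1)))
  (ifE (.sub (.get 6 (.var 28)) (.var 3)) (assign 3 (.get 6 (.var 28))) .skip))

/-- Puts one edge into the queue and counts it at its endpoints. -/
def enqueue : Program :=
  .seq (assign 26 (.sub (.var 26) (.lit 1)))
  (.seq (write 7 (.var 26) (.var 26)) (.seq (bump 0) (bump 1)))

/-- Computes into `v 7` the number of binary digits of `v 3`, plus one. -/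
def countDigits : Program :=
  .seq (assign 7 (.lit 1)) (.seq (assign 26 (.var 3))
    (whileE (.var 26) (.seq (assign 26 (.div (.var 26) (.lit 2)))
      (assign 7 (.add (.var 7) (.lit 1))))))

/-- The maximal length of a path to be flipped. -/
def pathBudget : Expr :=
  .mul (.mul (.lit (10 ^ 9)) (.mul (.var 7) (.var 7)))
    (.mul (.add (.div (.var 3) (.var 4)) (.lit 1)) (.add (.div (.var 3) (.var 4)) (.lit 1)))

/-- Computes the parameters. -/
def prepare : Program :=
  .seq (assign 26 (.var 1))
  (.seq (whileE (.var 26) enqueue)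
  (.seq (assign 6 (.add (.var 2) (.lit 1)))
  (.seq (assign 4 (.sub (.var 2) (.var 3)))
  (.seq (assign 5 (.add (.var 3) (.div (.var 4) (.lit 2))))
  (.seq countDigits
  (.seq (assign 8 pathBudget) (assign 9 (.var 1))))))))

/-- A bound for the time of `countDigits`. -/
def digitsTime (Δ : ℕ) : ℕ :=
  (assign 7 (.lit 1)).size + ((assign 26 (.var 3)).size +
    loopTime (.var 26) (Program.seq (assign 26 (.div (.var 26) (.lit 2)))
      (assign 7 (.add (.var 7) (.lit 1)))).size Δ + 1) + 1

/-- A bound for the time of `prepare`. -/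
def initTime (m Δ : ℕ) : ℕ :=
  (assign 26 (.var 1)).size + (loopTime (.var 26) enqueue.size m +
    ((assign 6 (.add (.var 2) (.lit 1))).size + ((assign 4 (.sub (.var 2) (.var 3))).size +
    ((assign 5 (.add (.var 3) (.div (.var 4) (.lit 2)))).size + (digitsTime Δ +
    ((assign 8 pathBudget).size + (assign 9 (.var 1)).size + 1) + 1) + 1) + 1) + 1) + 1) + 1

/-- The state that the input describes. -/
def inputState (E : EdgeList) (q : ℕ) : HState where
  v i := if i = 0 then E.n else if i = 1 then E.m else if i = 2 then q else 0
  a t := if t = 0 then E.U else if t = 1 then E.V else fun _ => 0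

section

variable {w : ℕ} {E : EdgeList} {q κ Δ e L ℓ s : ℕ} {S : HState}

theorem bump_spec (hF : Fits w E q s ℓ) {x i z : ℕ} (hx : x < 2) (h26 : S.v 26 = i) (hi : i < E.m)
    (hz : S.a x i = z) (hzn : z < E.n) (hd : S.a 6 z ≤ 2 * E.m) :
    Det w E.m (bump x) (bump x).size S fun S' => S'.a 6 = update (S.a 6) z (S.a 6 z + 1) ∧
      S'.v 3 = max (S.v 3) (S.a 6 z + 1) ∧ (∀ i, i ≠ 3 → i ≠ 28 → S'.v i = S.v i) ∧
      ∀ t, t ≠ 6 → S'.a t = S.a t := by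
  have hw := hF.word
  have hw1 : 1 < 2 ^ w := by omega
  have hF1 := hF.table
  have hFn := hF.n_lt
  have hn : E.n ≤ E.n * (q + 1) := Nat.le_mul_of_pos_right _ (by omega)
  unfold bump
  refine (Det.assign_seq (m := E.m) (S := S) (e := .get x (.var 26)) hw (by omega) (v := z)
    ⟨by simp, by omega, fun _ => by simp [h26, hi], ?_⟩ (by simp [h26, hz])
    (t := (write 6 (.var 28) (.add (.get 6 (.var 28)) (.lit 1))).size +
      (ifE (.sub (.get 6 (.var 28)) (.var 3)) (assign 3 (.get 6 (.var 28))) .skip).size + 1)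
    ?_).mono (by simp only [Program.size]; omega) fun _ => id
  · simp only [Expr.eval, h26, addr]
    split_ifs <;> omega
  have ok6 : ∀ S' : HState, S'.v 28 = z → (Expr.get 6 (.var 28)).ok w E.m S' := by
    intro S' h
    refine ⟨by simp, by omega, by omega, ?_⟩
    simp [h, addr]; omega
  refine Det.write_seq hw (i := z) (v := S.a 6 z + 1) (ok6 _ (by simp))
    ⟨ok6 _ (by simp), hw1, ?_⟩ (by simp) (by simp) ?_
  · simp; omega
  refine Det.of_ifE_size hw ⟨ok6 _ (by simp), by simp⟩ (fun hc => ?_) (fun hc => Det.skip ?_)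
  · refine Det.of_assign hw (by omega) (ok6 _ (by simp)) ?_
    simp at hc
    refine ⟨by simp, ?_, fun i h3 h28 => by simp [h3, h28], fun t ht => by
      simp [HState.setA_a_ne _ _ _ ht]⟩
    simp
    omega
  · simp at hc
    refine ⟨by simp, ?_, fun i h3 h28 => by simp [h28], fun t ht => by
      simp [HState.setA_a_ne _ _ _ ht]⟩
    simp
    omega

/-- The number of edges at `v` with index at least `j`. -/
def degFrom (E : EdgeList) (j v : ℕ) : ℕ := #{i ∈ range E.m | j ≤ i ∧ E.Inc i v}

theorem degFrom_zero (v : ℕ) : degFrom E 0 v = E.deg v := by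
  simp [degFrom, EdgeList.deg]

theorem degFrom_le (j v : ℕ) : degFrom E j v ≤ E.m := by
  simpa [degFrom] using card_filter_le (range E.m) fun i => j ≤ i ∧ E.Inc i v

theorem degFrom_succ {j : ℕ} (hj : j < E.m) :
    degFrom E j = update (update (degFrom E (j + 1)) (E.U j) (degFrom E (j + 1) (E.U j) + 1)) (E.V j)
      (degFrom E (j + 1) (E.V j) + 1) := by
  have hne := E.loopless j hj
  have h1 : ∀ v, degFrom E j v = degFrom E (j + 1) v + if E.Inc j v then 1 else 0 := by
    intro v
    unfold degFrom
    split_ifs with hi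
    · rw [← card_insert_of_notMem (a := j) (by simp)]
      congr 1
      ext i
      simp only [mem_insert, mem_filter, mem_range]
      constructor
      · rintro ⟨h1, h2, h3⟩
        rcases h2.lt_or_eq with h | h
        · exact Or.inr ⟨h1, h, h3⟩
        · exact Or.inl h.symm
      · rintro (rfl | ⟨h1, h2, h3⟩)
        · exact ⟨hj, le_rfl, hi⟩
        · exact ⟨h1, by omega, h3⟩
    · rw [add_zero]
      congr 1
      refine filter_congr fun i _ => ⟨fun ⟨h2, h3⟩ => ⟨?_, h3⟩, fun ⟨h2, h3⟩ => ⟨by omega, h3⟩⟩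
      rcases h2.lt_or_eq with h | h
      · exact h
      · exact absurd (h ▸ h3) hi
  funext v
  rw [h1]
  simp only [update_apply, EdgeList.Inc]
  split_ifs <;> first | omega | grind

/-- The invariant of the loop that fills the queue. -/
structure Enqueued (E : EdgeList) (q : ℕ) (S : HState) : Prop where
  le : S.v 26 ≤ E.m
  queue : ∀ i, S.v 26 ≤ i → i < E.m → S.a 7 i = i
  deg : S.a 6 = degFrom E (S.v 26)
  max_ge : ∀ v, S.a 6 v ≤ S.v 3
  max_le : ∃ v, S.v 3 ≤ S.a 6 v
  frame_v : ∀ i, i ≠ 3 → i ≠ 26 → i ≠ 28 → S.v i = (inputState E q).v i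
  frame_a : ∀ t, t ≠ 6 → t ≠ 7 → S.a t = (inputState E q).a t

theorem enqueue_spec (hF : Fits w E q s ℓ) (hI : Enqueued E q S) (h26 : S.v 26 ≠ 0) :
    Det w E.m enqueue enqueue.size S fun S' => Enqueued E q S' ∧ S'.v 26 < S.v 26 := by
  have hw := hF.word
  have hw1 : 1 < 2 ^ w := by omega
  have hF1 := hF.table
  obtain ⟨j, hj⟩ : ∃ j, S.v 26 = j + 1 := ⟨S.v 26 - 1, by omega⟩
  have hjm : j < E.m := by have := hI.le; omega
  have hdeg := hI.deg
  rw [hj] at hdeg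
  have hle := fun v => degFrom_le (E := E) (j + 1) v
  have hUV := E.loopless j hjm
  unfold enqueue
  refine (Det.assign_seq (m := E.m) (S := S) (e := .sub (.var 26) (.lit 1)) hw (by omega) (v := j)
    ⟨by simp, hw1⟩ (by simp [hj]) (t := (write 7 (.var 26) (.var 26)).size +
      ((bump 0).size + (bump 1).size + 1) + 1) ?_).mono (by simp only [Program.size]; omega)
      fun _ => id
  refine Det.write_seq hw (i := j) (v := j) ⟨by simp, by omega, by omega, ?_⟩ (by simp) (by simp)
    (by simp) ?_
  · simp [addr]; omega
  refine Det.seq (bump_spec hF (x := 0) (i := j) (z := E.U j) (by omega) (by simp) hjm ?_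
    (E.U_lt j hjm) ?_) ?_
  · simp [HState.setA_a_ne, hI.frame_a, inputState]
  · simp only [HState.setV_a, HState.setA_a_ne _ _ _ (show 6 ≠ 7 by omega), hdeg]
    have := hle (E.U j)
    omega
  rintro S₁ ⟨h6, h3, hv, ha⟩
  simp only [HState.setV_a, HState.setA_a_ne _ _ _ (show 6 ≠ 7 by omega), hdeg] at h6 h3
  refine (bump_spec hF (S := S₁) (x := 1) (i := j) (z := E.V j) (by omega)
    (by rw [hv 26 (by omega) (by omega)]; simp) hjm ?_ (E.V_lt j hjm) ?_).mono le_rfl ?_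
  · simp [ha, HState.setA_a_ne, hI.frame_a, inputState]
  · rw [h6, update_of_ne hUV.symm]
    have := hle (E.V j)
    omega
  rintro S₂ ⟨h6', h3', hv', ha'⟩
  rw [h6, update_of_ne hUV.symm] at h6' h3'
  rw [h3] at h3'
  simp only [HState.setA_v, HState.setV_v, show (3 : ℕ) ≠ 26 by omega, if_false] at h3'
  have e26 : S₂.v 26 = j := by
    rw [hv' 26 (by omega) (by omega), hv 26 (by omega) (by omega)]; simp
  have e7 : S₂.a 7 = update (S.a 7) j j := by
    rw [ha' 7 (by omega), ha 7 (by omega)]; simp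
  have hmax := hI.max_ge
  rw [hdeg] at hmax
  refine ⟨⟨by omega, fun i hi him => ?_, ?_, fun v => ?_, ?_, fun i h3 h26 h28 => ?_,
    fun t h6 h7 => ?_⟩, by omega⟩
  · rw [e7, update_apply]
    split_ifs with h
    · exact h.symm
    · exact hI.queue i (by omega) him
  · rw [e26, degFrom_succ hjm, h6']
  · rw [h6', h3', update_apply, update_apply]
    have := hmax v
    split_ifs <;> simp
    exact Or.inl this
  · obtain ⟨v, hv⟩ := hI.max_le
    rw [hdeg] at hv
    rw [h6', h3']
    by_cases h1 : S.v 3 ≤ degFrom E (j + 1) (E.V j) + 1 ∧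
        degFrom E (j + 1) (E.U j) + 1 ≤ degFrom E (j + 1) (E.V j) + 1
    · exact ⟨E.V j, by rw [update_self]; omega⟩
    · by_cases h2 : S.v 3 ≤ degFrom E (j + 1) (E.U j) + 1
      · exact ⟨E.U j, by rw [update_of_ne hUV, update_self]; omega⟩
      · refine ⟨v, ?_⟩
        rw [update_of_ne, update_of_ne]
        · omega
        · rintro rfl; omega
        · rintro rfl
          have := hmax (E.U j)
          have := hmax (E.V j)
          omega
  · rw [hv' i h3 h28, hv i h3 h28]
    simp [h26, hI.frame_v i h3 h26 h28]
  · rw [ha' t h6, ha t h6]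
    simp [HState.setA_a_ne _ _ _ h7, hI.frame_a t h6 h7]

theorem countDigits_spec (hw : 64 < 2 ^ w) {m : ℕ} (h3 : S.v 3 = Δ) (hΔ : Δ < 2 ^ w) (hΔ0 : 0 < Δ) :
    Det w m countDigits (digitsTime Δ) S fun S' => S'.v 7 = Nat.log 2 Δ + 2 ∧
      (∀ i, i ≠ 7 → i ≠ 26 → S'.v i = S.v i) ∧ S'.a = S.a := by
  have hw' : 16 < 2 ^ w := by omega
  have hlog : Nat.log 2 Δ < w := Nat.log_lt_of_lt_pow (by omega) hΔ
  have hlog2 : Nat.log 2 Δ + 3 < 2 ^ w := by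
    have := (Nat.lt_two_pow_self (n := w))
    have h6 : 6 < w := by
      by_contra hc
      have : 2 ^ w ≤ 2 ^ 6 := Nat.pow_le_pow_right (by omega) (by omega)
      omega
    have h7 : w = (w - 3) + 3 := by omega
    rw [h7, pow_add]
    have := (Nat.lt_two_pow_self (n := w - 3))
    omega
  unfold countDigits digitsTime
  refine Det.assign_seq hw' (by omega) (by simp; omega) (v := 1) rfl ?_
  refine Det.assign_seq hw' (by omega) (by simp) (v := Δ) (by simp [h3]) ?_
  refine (Det.of_whileE (m := m) hw' (e := .var 26) (P := (.seq (assign 26 (.div (.var 26) (.lit 2)))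
      (assign 7 (.add (.var 7) (.lit 1))))) (t := (Program.seq (assign 26 (.div (.var 26) (.lit 2)))
      (assign 7 (.add (.var 7) (.lit 1)))).size)
    (fun S' => S'.v 26 = Δ / 2 ^ (S'.v 7 - 1) ∧ 1 ≤ S'.v 7 ∧ S'.v 7 ≤ Nat.log 2 Δ + 2 ∧
      (∀ i, i ≠ 7 → i ≠ 26 → S'.v i = S.v i) ∧ S'.a = S.a) (fun S' => S'.v 26)
    (fun _ _ => by simp) ?_ ?_ ?_).mono (loopTime_mono (by simp)) fun _ => id
  · rintro S' ⟨h1, h2, h3, h4, h5⟩ hne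
    simp only [Expr.eval] at hne
    refine (Det.assign_seq (m := m) (S := S') (e := .div (.var 26) (.lit 2)) hw' (by omega)
      (v := S'.v 26 / 2) ⟨by simp, by simp; omega⟩ (by simp)
      (t := (assign 7 (.add (.var 7) (.lit 1))).size) ?_).mono (by simp only [Program.size]; omega)
      fun _ => id
    have h6 : 2 ^ (S'.v 7 - 1) ≤ Δ := by
      rw [h1] at hne
      by_contra hc
      exact hne (Nat.div_eq_of_lt (by omega))
    have h7 := Nat.le_log_of_pow_le (by omega) h6
    refine Det.of_assign hw' (by omega) ⟨by simp, by simp; omega, by simp; omega⟩ ?_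
    refine ⟨⟨?_, by simp, by simp; omega, fun i h7 h26 => by simp [h7, h26, h4 i h7 h26], h5⟩,
      by simp; omega⟩
    simp only [Expr.eval, HState.setV_v]
    norm_num
    rw [h1, Nat.div_div_eq_div_mul, ← pow_succ, Nat.sub_add_cancel h2]
  · refine ⟨by simp, by simp, by simp, fun i h7 h26 => by simp [h7, h26], rfl⟩
  · rintro S' ⟨h1, h2, h3, h4, h5⟩ h0
    simp only [Expr.eval] at h0
    refine ⟨?_, h4, h5⟩
    rw [h0] at h1
    have h6 : Δ < 2 ^ (S'.v 7 - 1) := by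
      by_contra hc
      have := Nat.div_pos (not_lt.1 hc) (by positivity)
      omega
    have := Nat.log_lt_of_lt_pow (by omega) h6
    omega

/-- The program computes the same parameters as the analysis, and all edges are in the queue. -/
theorem prepare_spec (hs : Setup w E q κ Δ e L ℓ s) (hq : q = Δ + e) (hL : L = Nat.log 2 Δ + 2)
    (hℓ : ℓ = 10 ^ 9 * (L * L) * ((Δ / e + 1) * (Δ / e + 1))) (hmax : ∃ v, E.deg v = Δ) :
    Det w E.m prepare (initTime E.m Δ) (inputState E q) fun S => Phase E q κ Δ e L ℓ S ∧
      S.v 9 = E.m ∧ (∀ k < E.m, S.a 7 k = k) ∧ S.a 2 = fun _ => 0 := by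
  have hw := hs.fits.word
  have hF1 := hs.fits.table
  have hFp := hs.fits.product
  have he := hs.params.e_ge
  have heΔ := hs.params.e_le
  have hΔm := hs.params.le_m
  have hm0 : 0 < E.m := by omega
  have hn0 : 0 < E.n := (Nat.zero_le _).trans_lt (E.U_lt 0 hm0)
  have hqw := hs.fits.color_lt hn0 le_rfl
  have hqw1 : q + 1 < 2 ^ w := by
    have := tableIndex_lt hn0 (le_refl q)
    omega
  have hκ := hs.κ_eq
  have hℓw : ℓ < 2 ^ w := lt_of_le_of_lt (Nat.le_mul_of_pos_left _ hm0) hFp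
  unfold prepare initTime
  refine Det.assign_seq hw (by omega) (by simp) (v := E.m) (by simp [inputState]) ?_
  refine Det.seq (Q := fun S' => Enqueued E q S' ∧ S'.v 26 = 0)
    ((Det.of_whileE hw (e := .var 26) (Enqueued E q) (fun S' => S'.v 26) (fun _ _ => by simp)
      (fun S' hI hne => enqueue_spec hs.fits hI hne) ?_ fun S' hI h0 => ⟨hI, h0⟩).mono
      (loopTime_mono (by simp)) fun _ => id) ?_
  · refine ⟨by simp, fun i hi him => ?_, ?_, fun v => ?_, ⟨0, ?_⟩, fun i h3 h26 h28 => ?_,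
      fun t _ _ => rfl⟩
    · simp at hi; omega
    · funext v
      refine Eq.symm (card_eq_zero.2 (filter_eq_empty_iff.2 fun i hi h => ?_))
      have := mem_range.1 hi
      simp at h
      omega
    · simp [inputState]
    · simp [inputState]
    · simp [h26]
  rintro S₁ ⟨hE, h26⟩
  have hdeg : S₁.a 6 = E.deg := by
    rw [hE.deg, h26]; funext v; exact degFrom_zero v
  have hv3 : S₁.v 3 = Δ := by
    obtain ⟨v, hv⟩ := hmax
    obtain ⟨z, hz⟩ := hE.max_le
    have h1 := hE.max_ge v
    rw [hdeg] at h1 hz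
    have h2 := hs.params.deg_le z
    omega
  have hv1 : S₁.v 1 = E.m := by rw [hE.frame_v 1 (by omega) (by omega) (by omega)]; rfl
  have hv2 : S₁.v 2 = q := by rw [hE.frame_v 2 (by omega) (by omega) (by omega)]; rfl
  refine Det.assign_seq hw (by omega) ⟨by simp, show 1 < 2 ^ w by omega, by simp [hv2]; omega⟩
    (v := q + 1)
    (by simp [hv2]) ?_
  refine Det.assign_seq hw (by omega) ⟨by simp, by simp⟩ (v := e) (by simp [hv2, hv3]; omega) ?_
  refine Det.assign_seq hw (by omega) ⟨by simp, ⟨by simp, by simp; omega⟩, ?_⟩ (v := κ)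
    (by simp [hv3, hκ]) ?_
  · simp [hv3]; omega
  refine Det.seq (countDigits_spec (Δ := Δ) (by omega) (by simp [hv3]) (by omega) (by omega)) ?_
  rintro S₂ ⟨h7, hv, ha⟩
  rw [← hL] at h7
  have hv3' : S₂.v 3 = Δ := by rw [hv 3 (by omega) (by omega)]; simp [hv3]
  have hv4' : S₂.v 4 = e := by rw [hv 4 (by omega) (by omega)]; simp
  have b1 : 10 ^ 9 * (L * L) ≤ ℓ := by
    rw [hℓ]; exact Nat.le_mul_of_pos_right _ (by positivity)
  have b2 : (Δ / e + 1) * (Δ / e + 1) ≤ ℓ := by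
    rw [hℓ]; exact Nat.le_mul_of_pos_left _ (by have : 0 < L := by omega
                                                positivity)
  have b3 : L * L ≤ 10 ^ 9 * (L * L) := Nat.le_mul_of_pos_left _ (by positivity)
  have b4 : 10 ^ 9 ≤ 10 ^ 9 * (L * L) := Nat.le_mul_of_pos_right _ (by
    have : 0 < L := by omega
    positivity)
  have b5 : Δ / e + 1 ≤ (Δ / e + 1) * (Δ / e + 1) := Nat.le_mul_of_pos_left _ (Nat.succ_pos _)
  refine Det.assign_seq hw (by omega) ?_ (v := ℓ) ?_ ?_
  · simp only [pathBudget, Expr.ok, Expr.eval, h7, hv3', hv4']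
    rw [← hℓ]
    omega
  · simp only [pathBudget, Expr.eval, h7, hv3', hv4', hℓ]
  have hv9' : Expr.eval (S₂.setV 8 ℓ) (.var 1) = E.m := by
    simp only [Expr.eval, HState.setV_v]
    norm_num
    rw [hv 1 (by omega) (by omega)]
    simp [hv1]
  refine Det.of_assign hw (by omega) (by simp) ?_
  rw [hv9']
  have hva : ∀ t, t ≠ 6 → t ≠ 7 → S₂.a t = (inputState E q).a t := fun t h6 h7 => by
    rw [ha]; simp [hE.frame_a t h6 h7]
  have h2 : ((S₂.setV 8 ℓ).setV 9 E.m).a 2 = fun _ => 0 := by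
    simp only [HState.setV_a]
    rw [hva 2 (by omega) (by omega)]; rfl
  have hq7 : ∀ k < E.m, S₂.a 7 k = k := fun k hk => by
    rw [ha]; exact hE.queue k (by omega) hk
  have hv7 : ∀ i, i ≠ 7 → i ≠ 26 → i ≠ 4 → i ≠ 5 → i ≠ 6 → S₂.v i = S₁.v i :=
    fun i h1 h2 h3 h4 h5 => by rw [hv i h1 h2]; simp [h3, h4, h5]
  refine ⟨⟨⟨?_, ?_, ?_, rfl, ?_, ?_, ?_, ?_⟩, ?_, ?_, ?_, ?_, ?_, ?_, ?_, ?_, ?_, ?_⟩, by simp,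
    by simpa using hq7, h2⟩
  · simp [hv 6]
  · simp only [HState.setV_a]; rw [hva 0 (by omega) (by omega)]; rfl
  · simp only [HState.setV_a]; rw [hva 1 (by omega) (by omega)]; rfl
  · rw [h2]; intro i _ j _ v _ _ _ h; exact absurd rfl h
  · intro v _ c hc _
    rw [h2]
    simp only [HState.setV_a]
    rw [hva 8 (by omega) (by omega)]
    exact (nbr_eq_zero.2 fun i _ _ => by omega).symm
  · intro i _; rw [h2]; exact Nat.zero_le _
  · omega
  · simp [hv7, hv1]
  · simp [hv7, hv2]
  · simp [hv3']
  · simp [hv4']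
  · simp [hv 5]
  · simp [h7]
  · simp
  · refine ⟨fun k hk => ?_, fun k hk k' hk' hkk => ?_, fun k _ => by rw [h2]⟩
    · simp at hk ⊢; rw [hq7 k hk]; exact hk
    · simp at hk hk' hkk; rwa [hq7 k hk, hq7 k' hk'] at hkk
  · simp
  · simp only [HState.setV_v, if_true]
    have : E.m * e ≤ 100 * Δ * E.m := by
      rw [mul_comm]; exact Nat.mul_le_mul_right _ (by omega)
    have h3 : 100 * Δ * (E.m + 1) = 100 * Δ * E.m + 100 * Δ := by ring
    omega

end

end WordRAM

/-! ### The failure probability -/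

namespace WordRAM

open Function EdgeList Finset

open scoped ENNReal

/-- The algorithm, on the state described by the input. -/
def colorEdges : Program := .seq prepare (.seq randomPhase finalPhase)

/-- A bound for the time of `colorEdges`. -/
def colorTime (m Δ s ℓ : ℕ) : ℕ :=
  initTime m Δ + (loopTime queueLong (roundTime s ℓ) m + finalTime m + 1) + 1

section

variable {w : ℕ} {E : EdgeList} {q κ Δ e L ℓ s : ℕ} {S : HState} {h : HState → ℝ≥0∞}

theorem Phase.fewLeft (hs : Setup w E q κ Δ e L ℓ s) (hI : Phase E q κ Δ e L ℓ S)
    (hr : 100 * Δ * S.v 9 ≤ E.m * e) (hc : E.core Δ e (S.v 9) (S.a 7) (S.a 2) < 1)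
    (ht : E.tail Δ e (S.v 9) (S.a 7) < 1) : FewLeft E κ (e / 8) (S.a 2) := by
  have h3 := hI.two_le hs
  have hge := hI.ge
  have hle := hI.le
  have hQ := hI.queue
  have hm : 0 < E.m := by omega
  have he := hs.params.e_ge
  have heΔ := hs.params.e_le
  intro v
  have h1 : #{i ∈ range E.m | E.Inc i v ∧ (S.a 2 i = 0 ∨ κ < S.a 2 i)} = E.holes (S.a 2) v := by
    unfold holes
    congr 1
    refine filter_congr fun i hi => ?_
    have := hI.holds.le i (mem_range.1 hi)
    exact and_congr_right fun _ => ⟨fun h => by omega, Or.inl⟩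
  rw [h1]
  by_cases hv : v < E.n
  swap
  · refine le_of_eq_of_le ?_ (Nat.zero_le _)
    rw [holes, card_eq_zero, filter_eq_empty_iff]
    exact fun i hi h0 => hv (h0.1.lt (mem_range.1 hi))
  generalize S.v 9 = r at *
  have h2 := hQ.load_le_holes (v := v)
  have h4 : E.m * e ≤ 200 * Δ * r := by
    have h5 : 100 * Δ * (r + 1) ≤ 100 * Δ * (2 * r) := Nat.mul_le_mul_left _ (by omega)
    have h6 : 100 * Δ * (2 * r) = 200 * Δ * r := by ring
    omega
  have h5 := excess_le_of_core_lt (by omega) (by omega) hm h4 hc hv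
  have h6 := (load_bounds_of_tail_lt hm (by omega) ht hv).1
  have hm0 : (0 : ℝ) < E.m := by exact_mod_cast hm
  have h7 : 100 * (Δ : ℝ) * r ≤ E.m * e := by exact_mod_cast hr
  have h8 : 4 * ((r : ℝ) / E.m) * Δ ≤ e / 25 := by
    rw [mul_div_assoc', div_mul_eq_mul_div, div_le_div_iff₀ hm0 (by norm_num)]
    linarith
  have h9 : (E.holes (S.a 2) v : ℝ) = E.excess r (S.a 7) (S.a 2) v + E.load r (S.a 7) v := by
    unfold excess
    rw [Nat.cast_sub h2]; ring
  have he0 : (0 : ℝ) ≤ e := Nat.cast_nonneg _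
  have h10 : 8 * (E.holes (S.a 2) v : ℝ) ≤ e := by linarith
  have h11 : 8 * E.holes (S.a 2) v ≤ e := by exact_mod_cast h10
  omega

/-- The failure probability of the final phase, if the random coloring phase was successful. -/
noncomputable def finalRisk (m : ℕ) : ℝ := 4 ^ m * (5 / 8) ^ (8 * m)

theorem initial_potential_le (hm : 0 < E.m) (hΔ : ∀ v, E.deg v ≤ Δ) {perm col : ℕ → ℕ}
    (hperm : ∀ k < E.m, perm k = k) (p : ℝ) :
    E.core Δ e E.m perm col + E.tail Δ e E.m perm + p ≤ E.n * Real.exp (-(e / 64)) +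
      E.n * E.m * (Real.exp (-(e / 100)) + Real.exp (-(e / 4))) + p := by
  have hload : ∀ v, E.load E.m perm v = E.deg v := fun v => by
    unfold load EdgeList.deg
    congr 1
    exact filter_congr fun k hk => by rw [hperm k (mem_range.1 hk)]
  have hex : ∀ v, E.excess E.m perm col v = 0 := fun v => by
    unfold excess
    rw [hload]
    have := holes_le_deg (E := E) (col := col) (v := v)
    omega
  have hm0 : (0 : ℝ) < E.m := by exact_mod_cast hm
  refine add_le_add_left (add_le_add ?_ ?_) _
  · unfold core
    simp only [hex, pow_zero, sum_const, card_range, nsmul_eq_mul, mul_one]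
    refine mul_le_mul_of_nonneg_left (Real.exp_le_exp.2 ?_) (Nat.cast_nonneg _)
    have : 0 ≤ E.rate Δ e / E.m := by unfold rate; positivity
    linarith
  · unfold tail
    refine (sum_le_sum (g := fun _ => E.m * (Real.exp (-(e / 100)) + Real.exp (-(e / 4))))
      fun v _ => (sum_le_sum (g := fun _ => Real.exp (-(e / 100)) + Real.exp (-(e / 4)))
      fun r' hr' => ?_).trans_eq (by simp; ring)).trans_eq (by simp [mul_assoc])
    rw [hload]
    have hx := half_le_one_sub (mem_Icc.1 hr').2
    have hr0 : (0 : ℝ) ≤ r' := Nat.cast_nonneg _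
    have hd : (E.deg v : ℝ) ≤ Δ := by exact_mod_cast hΔ v
    refine add_le_add ?_ ?_
    · have h1 : 1 + (r' : ℝ) / E.m ≤ Real.exp (r' / E.m) := by
        linarith [Real.add_one_le_exp ((r' : ℝ) / E.m)]
      refine (mul_le_mul_of_nonneg_right (pow_le_pow_left₀ (by positivity) h1 _)
        (Real.exp_pos _).le).trans ?_
      rw [← Real.exp_nat_mul, ← Real.exp_add, Real.exp_le_exp]
      have h2 : (E.deg v : ℝ) * (r' / E.m) ≤ 2 * r' * Δ / E.m := by
        rw [mul_div_assoc', div_le_div_iff_of_pos_right hm0]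
        nlinarith
      linarith
    · have h1 : 1 - (r' : ℝ) / (2 * E.m) ≤ Real.exp (-(r' / (2 * E.m))) := by
        linarith [Real.add_one_le_exp (-((r' : ℝ) / (2 * E.m)))]
      refine (mul_le_mul_of_nonneg_right (pow_le_pow_left₀ (by linarith) h1 _)
        (Real.exp_pos _).le).trans ?_
      rw [← Real.exp_nat_mul, ← Real.exp_add, Real.exp_le_exp]
      have h2 : (r' : ℝ) * E.deg v / (4 * E.m) ≤ E.deg v * (r' / (2 * E.m)) := by
        rw [mul_div_assoc', div_le_div_iff₀ (by positivity) (by positivity)]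
        have : (0 : ℝ) ≤ r' * E.deg v * E.m := by positivity
        nlinarith
      linarith

/-- The mean of any loss that vanishes on complete colorings is at most the initial potential. -/
theorem colorEdges_expect (hs : Setup w E q κ Δ e L ℓ s) (hq : q = Δ + e)
    (hL : L = Nat.log 2 Δ + 2) (hℓ : ℓ = 10 ^ 9 * (L * L) * ((Δ / e + 1) * (Δ / e + 1)))
    (hmax : ∃ v, E.deg v = Δ) (hh1 : ∀ S', h S' ≤ 1)
    (hh0 : ∀ S', Holds E q q (S'.a 2) S' → (∀ i < E.m, S'.a 2 i ≠ 0) → h S' = 0) :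
    Expect w E.m colorEdges (colorTime E.m Δ s ℓ) (inputState E q) h
      (ENNReal.ofReal (E.n * Real.exp (-(e / 64)) +
        E.n * E.m * (Real.exp (-(e / 100)) + Real.exp (-(e / 4))) + finalRisk E.m)) := by
  classical
  have hw := hs.fits.word
  have he := hs.params.e_ge
  have heΔ := hs.params.e_le
  have hΔm := hs.params.le_m
  have hκ := hs.κ_eq
  have hp : 0 ≤ finalRisk E.m := by unfold finalRisk; positivity
  refine Det.seq_expect (prepare_spec hs hq hL hℓ hmax) ?_
  rintro S ⟨hI, h9, h7, h2⟩
  refine Expect.mono (x := ENNReal.ofReal (potential E Δ e (finalRisk E.m) S)) ?_ le_rfl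
    (fun _ => le_rfl) (ENNReal.ofReal_le_ofReal ((min_le_right _ _).trans (by
      rw [h9]; exact initial_potential_le (by omega) hs.params.deg_le h7 _)))
  refine Expect.seq (h := fun S' => if Phase E q κ Δ e L ℓ S' ∧ 100 * Δ * S'.v 9 ≤ E.m * e then
    ENNReal.ofReal (potential E Δ e (finalRisk E.m) S') else ⊤) ?_ fun S' hS' => ?_
  · have := randomPhase_expect hs hI hp (h := fun S' => if Phase E q κ Δ e L ℓ S' ∧
      100 * Δ * S'.v 9 ≤ E.m * e then ENNReal.ofReal (potential E Δ e (finalRisk E.m) S') else ⊤)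
      fun S' h1 h2 => by rw [if_pos ⟨h1, h2⟩]
    rwa [h9] at this
  · have hc : Phase E q κ Δ e L ℓ S' ∧ 100 * Δ * S'.v 9 ≤ E.m * e := by
      by_contra hc
      exact hS' (if_neg hc)
    rw [if_pos hc]
    obtain ⟨hI', hr⟩ := hc
    have hH : Holds E q q (S'.a 2) S' := { hI'.holds with
      le := fun i hi => (hI'.holds.le i hi).trans hI'.holds.le'
      le' := le_rfl }
    by_cases hlt : E.core Δ e (S'.v 9) (S'.a 7) (S'.a 2) + E.tail Δ e (S'.v 9) (S'.a 7) +
        finalRisk E.m < 1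
    · refine (finalPhase_expect hs.fits (κ := κ) (B := e / 8) (by omega) (by omega) hH hI'.v1
        hI'.v2 hI'.v5 (G := True) (fun _ => hI'.fewLeft hs hr ?_ ?_) hh1 hh0).mono le_rfl
        (fun _ => le_rfl) (ENNReal.ofReal_le_ofReal ?_)
      · have := tail_nonneg (E := E) (Δ := Δ) (e := e) (r := S'.v 9) (perm := S'.a 7)
        linarith
      · have := core_nonneg (E := E) (Δ := Δ) (e := e) (r := S'.v 9) (perm := S'.a 7)
          (col := S'.a 2)
        linarith
      · rw [finalPotential, if_pos trivial, if_neg (by omega), potential, min_eq_right hlt.le]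
        have h1 := tail_nonneg (E := E) (Δ := Δ) (e := e) (r := S'.v 9) (perm := S'.a 7)
        have h2 := core_nonneg (E := E) (Δ := Δ) (e := e) (r := S'.v 9) (perm := S'.a 7)
          (col := S'.a 2)
        unfold finalRisk
        linarith
    · refine (finalPhase_expect hs.fits (κ := κ) (B := e / 8) (by omega) (by omega) hH hI'.v1
        hI'.v2 hI'.v5 (G := False) (fun h => h.elim) hh1 hh0).mono le_rfl
        (fun _ => le_rfl) (ENNReal.ofReal_le_ofReal ?_)
      rw [finalPotential, if_neg not_false, potential, min_eq_left (not_lt.1 hlt)]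

end

end WordRAM

/-! ### The order of the running time -/

namespace WordRAM

/-- `f` is at most a constant multiple of `g`. -/
def Dominated {ι : Type*} (f g : ι → ℕ) : Prop := ∃ A, ∀ a, f a ≤ A * g a

namespace Dominated

variable {ι : Type*} {f f' g g' k : ι → ℕ}

theorem const (c : ℕ) (hg : ∀ a, 1 ≤ g a) : Dominated (fun _ => c) g :=
  ⟨c, fun a => Nat.le_mul_of_pos_right _ (hg a)⟩

theorem add (hf : Dominated f g) (hf' : Dominated f' g) : Dominated (fun a => f a + f' a) g := by
  obtain ⟨A, hA⟩ := hf
  obtain ⟨A', hA'⟩ := hf'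
  exact ⟨A + A', fun a => by rw [add_mul]; exact add_le_add (hA a) (hA' a)⟩

theorem mono (hf : Dominated f g) (c : ℕ) (h : ∀ a, g a ≤ c * g' a) : Dominated f g' := by
  obtain ⟨A, hA⟩ := hf
  exact ⟨A * c, fun a => (hA a).trans (by rw [mul_assoc]; exact Nat.mul_le_mul_left _ (h a))⟩

theorem comp (hf : Dominated f g) {κ : Type*} (π : κ → ι) :
    Dominated (fun a => f (π a)) fun a => g (π a) := by
  obtain ⟨A, hA⟩ := hf
  exact ⟨A, fun a => hA (π a)⟩

theorem loop (hf : Dominated f g) (hg : ∀ a, 1 ≤ g a) (e : Expr) :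
    Dominated (fun a => loopTime e (f a) (k a)) fun a => (k a + 1) * g a := by
  have h : ∀ a, 1 ≤ (k a + 1) * g a := fun a => Nat.mul_pos (by omega) (hg a)
  refine Dominated.add ?_ (.const _ h)
  obtain ⟨A, hA⟩ := (hf.add (.const (e.comp 100).size hg)).add (.const 2 hg)
  exact ⟨A, fun a => (Nat.mul_le_mul_left _ (hA a)).trans_eq (by ring)⟩

theorem loop_const (c : ℕ) (e : Expr) : Dominated (fun a => loopTime e c (k a)) fun a => k a + 1 :=
  (loop (g := fun _ => 1) (.const c fun _ => le_rfl) (fun _ => le_rfl) e).mono 1 fun a => by simp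

end Dominated

theorem findTime_dominated (x y : ℕ) : Dominated (findTime x y) fun s => s + 1 := by
  have h1 : ∀ s : ℕ, 1 ≤ s + 1 := by omega
  refine .add (.add (.const _ h1) (.add (.add (.const _ h1) ?_) (.const _ h1))) (.const _ h1)
  exact .loop_const _ _

theorem searchTime_dominated : Dominated searchTime fun s => s + 1 := by
  have h1 : ∀ s : ℕ, 1 ≤ s + 1 := by omega
  refine .add (.add (.const _ h1) (.add (.add (.const _ h1) ?_) (.const _ h1))) (.const _ h1)
  exact .loop_const _ _

theorem fanStepTime_dominated : Dominated fanStepTime fun s => s + 1 := by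
  have h1 : ∀ s : ℕ, 1 ≤ s + 1 := by omega
  exact .add (.add (findTime_dominated _ _) (.add (.add (.const _ h1)
    (.add (.add searchTime_dominated (.const _ h1)) (.const _ h1))) (.const _ h1))) (.const _ h1)

theorem buildTime_dominated : Dominated buildTime fun s => (s + 1) ^ 2 := by
  have h1 : ∀ s : ℕ, 1 ≤ (s + 1) ^ 2 := fun s => Nat.one_le_pow _ _ (by omega)
  refine .add (.add (.const _ h1) (.add (.add (.const _ h1) (.add (.add (.const _ h1)
    (.add (.add (.const _ h1) ?_) (.const _ h1))) (.const _ h1))) (.const _ h1))) (.const _ h1)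
  exact (Dominated.loop (k := fun s => s + 1) fanStepTime_dominated (by omega) _).mono 2
    fun s => by nlinarith

theorem flipTime_dominated : Dominated flipTime fun k => k + 1 := by
  have h1 : ∀ s : ℕ, 1 ≤ s + 1 := by omega
  refine .add (.add (.const _ h1) (.add (.add (.const _ h1) (.add (.add (.const _ h1)
    (.add (.add (.const _ h1) (.add (.add (.const _ h1) ?_) (.const _ h1))) (.const _ h1)))
    (.const _ h1))) (.const _ h1))) (.const _ h1)
  exact .loop_const _ _

theorem shiftTime_dominated : Dominated shiftTime fun k => k + 1 := by
  have h1 : ∀ s : ℕ, 1 ≤ s + 1 := by omega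
  refine .add (.add (.const _ h1) (.add (.add (.const _ h1) (.add (.add (.const _ h1)
    (.add (.add (.const _ h1) (.add (.add (.const _ h1) (.add (.add ?_
    (.const _ h1)) (.const _ h1))) (.const _ h1))) (.const _ h1)))
    (.const _ h1))) (.const _ h1))) (.const _ h1)
  exact .loop_const _ _

theorem processTime_dominated : Dominated (fun a : ℕ × ℕ => processTime a.1 a.2)
    fun a => (a.1 + 1) ^ 2 + a.2 := by
  have h1 : ∀ a : ℕ × ℕ, 1 ≤ (a.1 + 1) ^ 2 + a.2 := fun a =>
    (Nat.one_le_pow _ _ (by omega)).trans (Nat.le_add_right _ _)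
  have hsq : ∀ a : ℕ × ℕ, a.1 + 1 ≤ 1 * ((a.1 + 1) ^ 2 + a.2) := fun a => by nlinarith
  have hf := ((findTime_dominated 14 15).comp (Prod.fst : ℕ × ℕ → ℕ)).mono 1 hsq
  have hb := (buildTime_dominated.comp (Prod.fst : ℕ × ℕ → ℕ)).mono
    (g' := fun a => (a.1 + 1) ^ 2 + a.2) 1 fun a => by omega
  have hl := (flipTime_dominated.comp (Prod.snd : ℕ × ℕ → ℕ)).mono
    (g' := fun a => (a.1 + 1) ^ 2 + a.2) 1 fun a => by
      have := Nat.one_le_pow 2 (a.1 + 1) (by omega)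
      omega
  have hs := (shiftTime_dominated.comp (Prod.fst : ℕ × ℕ → ℕ)).mono 1 hsq
  have c := fun x : ℕ => Dominated.const x h1
  exact (((c _).add ((hf.add (((c _).add ((hb.add (((c _).add
    (((hl.add hs).add (c _)).add (c _))).add (c _))).add (c _) |>.add (c _))).add (c _))).add
    (c _))).add (c _))

theorem drawTime_dominated : Dominated drawTime fun s => s + 1 := by
  have h1 : ∀ s : ℕ, 1 ≤ s + 1 := by omega
  refine .add (.add (.const _ h1) ?_) (.const _ h1)
  exact .loop_const _ _

theorem roundTime_dominated : Dominated (fun a : ℕ × ℕ => roundTime a.1 a.2)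
    fun a => (a.1 + 1) ^ 2 + a.2 := by
  have h1 : ∀ a : ℕ × ℕ, 1 ≤ (a.1 + 1) ^ 2 + a.2 := fun a =>
    (Nat.one_le_pow _ _ (by omega)).trans (Nat.le_add_right _ _)
  have hd := (drawTime_dominated.comp (Prod.fst : ℕ × ℕ → ℕ)).mono
    (g' := fun a => (a.1 + 1) ^ 2 + a.2) 1 fun a => by nlinarith
  have c := fun x : ℕ => Dominated.const x h1
  exact (((c _).add ((hd.add (((c _).add (((c _).add ((((c _).add (((c _).add
    ((((c _).add processTime_dominated).add (c _)))).add (c _)))).add (c _))).add (c _)))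
    |>.add (c _))).add (c _))).add (c _))

theorem finalTime_dominated : Dominated finalTime fun m => m + 1 := by
  have h1 : ∀ s : ℕ, 1 ≤ s + 1 := by omega
  refine .add (.add (.const _ h1) (.add (.add (.const _ h1) ?_) (.const _ h1))) (.const _ h1)
  exact (Dominated.loop_const (k := fun m => 8 * m) _ _).mono 8 fun a => by omega

theorem initTime_dominated : Dominated (fun a : ℕ × ℕ => initTime a.1 a.2)
    fun a => a.1 + a.2 + 1 := by
  have h1 : ∀ a : ℕ × ℕ, 1 ≤ a.1 + a.2 + 1 := by omega
  have c := fun x : ℕ => Dominated.const x h1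
  have hl := fun e t => (Dominated.loop_const (k := (Prod.fst : ℕ × ℕ → ℕ)) t e).mono
    (g' := fun a => a.1 + a.2 + 1) 1
    fun a => by omega
  have hd := fun e t => (Dominated.loop_const (k := (Prod.snd : ℕ × ℕ → ℕ)) t e).mono
    (g' := fun a => a.1 + a.2 + 1) 1
    fun a => by omega
  exact .add (.add (c _) (.add (.add (hl _ _) (.add (.add (c _) (.add (.add (c _) (.add (.add (c _)
    (.add (.add (.add (.add (c _) (.add (.add (c _) (hd _ _)) (c _))) (c _))
    (.add (.add (c _) (c _)) (c _))) (c _))) (c _))) (c _))) (c _))) (c _))) (c _)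

theorem colorTime_dominated : ∃ A, ∀ m Δ s ℓ : ℕ, 1 ≤ m → Δ ≤ m →
    colorTime m Δ s ℓ + 4 ≤ A * (m * ((s + 1) ^ 2 + ℓ)) := by
  obtain ⟨A, hA⟩ := initTime_dominated
  obtain ⟨B, hB⟩ := Dominated.loop (k := fun a : ℕ × ℕ × ℕ => a.1)
    (roundTime_dominated.comp Prod.snd)
    (fun a => (Nat.one_le_pow _ _ (by omega)).trans (Nat.le_add_right _ _)) queueLong
  obtain ⟨D, hD⟩ := finalTime_dominated
  refine ⟨3 * A + 2 * B + 2 * D + 6, fun m Δ s ℓ hm hΔ => ?_⟩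
  have h1 := hA (m, Δ)
  have h2 := hB (m, s, ℓ)
  have h3 := hD m
  have hx : 1 ≤ (s + 1) ^ 2 + ℓ := (Nat.one_le_pow _ _ (by omega)).trans (Nat.le_add_right _ _)
  dsimp only at h1 h2 h3
  unfold colorTime
  generalize (s + 1) ^ 2 + ℓ = x at *
  have hmx : m ≤ m * x := Nat.le_mul_of_pos_right _ hx
  have h4 : A * (m + Δ + 1) ≤ A * (3 * (m * x)) := Nat.mul_le_mul_left _ (by omega)
  have h5 : B * ((m + 1) * x) ≤ B * (2 * (m * x)) := Nat.mul_le_mul_left _ (by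
    rw [← mul_assoc]; exact Nat.mul_le_mul_right _ (by omega))
  have h6 : D * (m + 1) ≤ D * (2 * (m * x)) := Nat.mul_le_mul_left _ (by omega)
  have h7 : (3 * A + 2 * B + 2 * D + 6) * (m * x) = A * (3 * (m * x)) + B * (2 * (m * x)) +
    D * (2 * (m * x)) + 6 * (m * x) := by ring
  omega

end WordRAM

/-! ### From the input to the output -/

namespace WordRAM

open Function EdgeList Finset

open scoped ENNReal

/-- The edge list of the input, with vertices as numbers. -/
def listed {n m : ℕ} {G : SimpleGraph (Fin n)} {ends : Fin m → Fin n × Fin n}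
    (h : IsEdgeListing G ends) : EdgeList where
  n := n
  m := m
  U i := if hi : i < m then (ends ⟨i, hi⟩).1 else 0
  V i := if hi : i < m then (ends ⟨i, hi⟩).2 else 0
  U_lt i hi := by simp [hi]
  V_lt i hi := by simp [hi]
  loopless i hi := by
    have h1 : s((ends ⟨i, hi⟩).1, (ends ⟨i, hi⟩).2) ∈ G.edgeSet := h.2 ▸ ⟨_, rfl⟩
    rw [SimpleGraph.mem_edgeSet] at h1
    simpa [hi, Fin.val_inj] using h1.ne
  simple i hi j hj hij := by
    simp only [hi, hj, dif_pos, Fin.val_inj] at hij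
    have := @h.1 ⟨i, hi⟩ ⟨j, hj⟩ (Sym2.eq_iff.2 hij)
    simpa using this

section

variable {n m q w : ℕ} {G : SimpleGraph (Fin n)} {ends : Fin m → Fin n × Fin n}

theorem listed_inc (h : IsEdgeListing G ends) (i : Fin m) (v : Fin n) :
    (listed h).Inc i v ↔ v ∈ s((ends i).1, (ends i).2) := by
  simp [EdgeList.Inc, listed, Fin.val_inj, eq_comm]

theorem listed_deg (h : IsEdgeListing G ends) [DecidableRel G.Adj] (v : Fin n) :
    (listed h).deg v = G.degree v := by
  classical
  rw [← SimpleGraph.card_incidenceFinset_eq_degree, EdgeList.deg]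
  have hlt : ∀ i ∈ ({i ∈ range (listed h).m | (listed h).Inc i v} : Finset ℕ), i < m :=
    fun i hi => mem_range.1 (mem_filter.1 hi).1
  refine card_bij (fun i hi => s((ends ⟨i, hlt i hi⟩).1, (ends ⟨i, hlt i hi⟩).2)) ?_ ?_ ?_
  · intro i hi
    rw [SimpleGraph.mem_incidenceFinset]
    exact ⟨h.2 ▸ ⟨_, rfl⟩, (listed_inc h ⟨i, hlt i hi⟩ v).1 (mem_filter.1 hi).2⟩
  · intro i hi j hj hij
    simpa using h.1 hij
  · intro e he
    rw [SimpleGraph.mem_incidenceFinset] at he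
    obtain ⟨he, hv⟩ := he
    rw [← h.2] at he
    obtain ⟨i, rfl⟩ := he
    exact ⟨i, mem_filter.2 ⟨mem_range.2 i.2, (listed_inc h i v).2 hv⟩, rfl⟩

/-- The whole program: two address constants are computed before the edges are colored. -/
def main : Program := .seq (.add 93 1 1) (.seq (.add 92 93 1) colorEdges)

theorem inputStore_repr (h : IsEdgeListing G ends) (hn : n < 2 ^ w) (hm : 3 * m < 2 ^ w)
    (hq : q < 2 ^ w) :
    Repr w m (((inputStore q ends).setReg w 93 (2 * m)).setReg w 92 (3 * m))
      (inputState (listed h) q) where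
  reg i hi := by
    simp [Store.setReg, inputStore, inputState, listed,
      show i ≠ 92 by omega, show i ≠ 93 by omega]
  zero := by simp [Store.setReg, inputStore]
  base := by simp [Store.setReg, Nat.mod_eq_of_lt hm]
  out := by
    simp [Store.setReg, Nat.mod_eq_of_lt (show 2 * m < 2 ^ w by omega)]
  mem t ht i hi := by
    simp only [Store.setReg, inputStore, inputState, addr]
    by_cases h0 : t = 0
    · have := hi (by omega)
      simp [h0, listed, this]
    by_cases h1 : t = 1
    · have := hi (by omega)
      have h2 : (2 * i + 1) / 2 = i := by omega
      simp [h1, h2, listed, this]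
    rw [if_neg h0, if_neg h1, if_neg h0, if_neg h1, dif_neg]
    split_ifs <;> omega
  word_v i hi := by
    simp only [inputState, listed]
    split_ifs <;> omega
  word_a t ht i hi := by
    simp only [inputState]
    split_ifs with h0 h1
    · exact ((listed h).U_lt i (hi (by omega))).trans hn
    · exact ((listed h).V_lt i (hi (by omega))).trans hn
    · exact (Nat.zero_le _).trans_lt hn

theorem risk_main_le (h : IsEdgeListing G ends) (hn : n < 2 ^ w) (hm : 3 * m < 2 ^ w)
    (hq : q < 2 ^ w) {t : ℕ} {g : HState → ℝ≥0∞} {x : ℝ≥0∞}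
    (H : Expect w m colorEdges t (inputState (listed h) q) g x) {F : Store → ℝ≥0∞}
    (hF : ∀ S σ, Repr w m σ S → F σ ≤ g S) :
    risk w F (t + 4) (initConfig main q ends) ≤ x := by
  have hR := inputStore_repr (q := q) h hn hm hq
  have h1 : (inputStore q ends).reg 1 = m := by simp [inputStore]
  rw [initConfig, main, risk_succ_of_pure rfl, risk_succ_of_pure rfl, risk_succ_of_pure rfl,
    risk_succ_of_pure rfl, h1]
  have h2 : ((inputStore q ends).setReg w 93 (m + m)).reg 93 +
      ((inputStore q ends).setReg w 93 (m + m)).reg 1 = 3 * m := by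
    simp [Store.setReg, h1, Nat.mod_eq_of_lt (show m + m < 2 ^ w by omega)]
    omega
  rw [h2, ← two_mul]
  exact H F [] 0 (fun S σ hσ => by rw [risk_zero]; exact hF S σ hσ) _ hR

/-- A complete proper coloring in the output array is correct output. -/
theorem outputsColoring_of_proper (h : IsEdgeListing G ends) {s : Config} {S : HState}
    (hR : Repr w m s.store S) (hp : (listed h).Proper (S.a 2))
    (hc : ∀ i < m, 1 ≤ S.a 2 i ∧ S.a 2 i ≤ q) : OutputsColoring G q ends s := by
  have hval : ∀ i : Fin m, extend (fun i : Fin m => s((ends i).1, (ends i).2))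
      (fun i : Fin m => S.a 2 i) 0 s((ends i).1, (ends i).2) = S.a 2 i := fun i => h.1.extend_apply _ _ i
  refine ⟨extend (fun i : Fin m => s((ends i).1, (ends i).2)) (fun i : Fin m => S.a 2 i) 0,
    ⟨?_, ?_⟩, fun i => ?_⟩
  · rw [← h.2]
    rintro _ ⟨i, rfl⟩
    exact (hval i).symm ▸ hc i i.2
  · rw [← h.2]
    rintro _ ⟨i, rfl⟩ _ ⟨j, rfl⟩ hne ⟨v, hi, hj⟩ heq
    dsimp only at heq hne
    rw [hval, hval] at heq
    have := hp i i.2 j j.2 v ((listed_inc h i v).2 hi) ((listed_inc h j v).2 hj) heq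
      (by have := hc i i.2; omega)
    exact hne (by rw [Fin.ext this])
  · rw [hval]
    simpa [addr] using hR.mem 2 (by omega) i fun _ => i.2

end

/-- A configuration that has not halted has infinite loss, so it cannot have positive probability. -/
theorem halted_of_risk_lt_top {w t : ℕ} {F : Store → ℝ≥0∞} {s₀ : Config} (h : risk w F t s₀ < ⊤) :
    ∀ s ∈ (run w t s₀).support, s.Halted := by
  rintro ⟨k, σ⟩ hs
  cases k with
  | nil => rfl
  | cons P k =>
    refine absurd ((ENNReal.le_tsum (f := fun s' => run w t s₀ s' * loss F s') ⟨P :: k, σ⟩).trans_lt h)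
      ?_
    simp only [loss]
    rw [ENNReal.mul_top ((PMF.mem_support_iff _ _).1 hs)]
    simp

theorem one_sub_risk_le {w t : ℕ} {F : Store → ℝ≥0∞} {s₀ : Config} {X : Set Config}
    (hX : ∀ s ∉ X, 1 ≤ F s.store) : 1 - risk w F t s₀ ≤ (run w t s₀).toOuterMeasure X := by
  rw [tsub_le_iff_right, PMF.toOuterMeasure_apply, risk, ← ENNReal.tsum_add,
    ← (run w t s₀).tsum_coe]
  refine ENNReal.tsum_le_tsum fun s => ?_
  by_cases hs : s ∈ X
  · rw [Set.indicator_of_mem hs]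
    exact le_self_add
  · refine le_trans ?_ le_add_self
    obtain ⟨k, σ⟩ := s
    cases k with
    | nil => exact le_mul_of_one_le_right' (hX _ hs)
    | cons P k => exact le_mul_of_one_le_right' le_top

end WordRAM

/-! ### The choice of the parameters -/

namespace WordRAM

open EdgeList Finset

theorem log_le_four_mul_log {Δ : ℕ} (hΔ : 400 ≤ Δ) :
    ((Nat.log 2 Δ + 2 : ℕ) : ℝ) ≤ 4 * Real.log Δ := by
  have h0 : (400 : ℝ) ≤ Δ := by exact_mod_cast hΔ
  have h1 : ((Nat.log 2 Δ : ℕ) : ℝ) ≤ Real.logb 2 Δ := Real.natLog_le_logb _ _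
  have h2 : 1 ≤ Real.log Δ := by
    rw [Real.le_log_iff_exp_le (by linarith)]
    linarith [Real.exp_one_lt_d9]
  have h3 : Real.logb 2 Δ ≤ 2 * Real.log Δ := by
    have := Real.log_two_gt_d9
    rw [Real.logb, div_le_iff₀ (by linarith)]
    nlinarith
  push_cast
  linarith

/-- All numbers that occur are less than `10 ^ 12 * n ^ 6`, and this fits into a word. -/
theorem word_bound {n w : ℕ} (hn : 2 ≤ n) (hw : 100 * Nat.log 2 n ≤ w) :
    10 ^ 12 * n ^ 6 < 2 ^ w := by
  have h1 : n < 2 ^ (Nat.log 2 n + 1) := Nat.lt_pow_succ_log_self (by omega) n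
  have h2 : 1 ≤ Nat.log 2 n := Nat.log_pos (by omega) hn
  calc 10 ^ 12 * n ^ 6 < 10 ^ 12 * (2 ^ (Nat.log 2 n + 1)) ^ 6 := by gcongr
    _ ≤ 2 ^ 40 * (2 ^ (Nat.log 2 n + 1)) ^ 6 :=
      Nat.mul_le_mul_right _ (by norm_num)
    _ = 2 ^ (40 + (Nat.log 2 n + 1) * 6) := by rw [← pow_mul, ← pow_add]
    _ ≤ 2 ^ w := Nat.pow_le_pow_right (by omega) (by omega)

/-- The parameters computed by the program, with `L ≈ log₂ Δ` and `D ≈ Δ / e ≈ 1 / ε`, meet all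
requirements of the analysis. -/
theorem setup_of_large {E : EdgeList} {n m Δ e L D w : ℕ} (hn : E.n = n) (hm : E.m = m)
    (hd : ∀ v, E.deg v ≤ Δ) (he : 400 ≤ e) (heΔ : e ≤ Δ) (hΔm : Δ ≤ m) (hΔn : Δ ≤ n)
    (hmn : m ≤ n * n) (hL : L = Nat.log 2 Δ + 2) (hD : D = Δ / e + 1) (hw : 10 ^ 12 * n ^ 6 < 2 ^ w) :
    Setup w E (Δ + e) (Δ + e / 2) Δ e L (10 ^ 9 * (L * L) * (D * D)) (3300 * (L * D)) := by
  have hlog : Nat.log 2 Δ < Δ := Nat.log_lt_self _ (by omega)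
  have hLn : L ≤ 2 * n := by omega
  have hD1 : 1 ≤ D := hD ▸ Nat.succ_pos _
  have hDe : Δ < D * e := by
    have := Nat.lt_div_mul_add (a := Δ) (b := e) (by omega)
    rw [hD, add_mul, one_mul]; exact this
  have hDn : D ≤ 2 * n := by
    have := Nat.div_le_self Δ e
    omega
  have hLD : L * D ≤ 4 * (n * n) := (Nat.mul_le_mul hLn hDn).trans_eq (by ring)
  have hn1 : 1 ≤ n := by omega
  have p0 : 1 ≤ n ^ 6 := Nat.one_le_pow _ _ hn1
  have p2 : n * n ≤ n ^ 6 := by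
    rw [← sq]; exact Nat.pow_le_pow_right hn1 (by omega)
  have p3 : n * (n * n) ≤ n ^ 6 := by
    rw [← sq, ← pow_succ']; exact Nat.pow_le_pow_right hn1 (by omega)
  refine ⟨⟨hd, he, heΔ, by omega, by omega, ?_, ?_⟩, ⟨?_, ?_, ?_⟩, rfl, ?_, ?_, ?_⟩
  · exact (Nat.lt_pow_succ_log_self (by omega) Δ).le.trans (Nat.pow_le_pow_right (by omega) (by omega))
  · calc 10 ^ 9 * L ^ 2 * Δ ^ 2 ≤ 10 ^ 9 * L ^ 2 * (D * e) ^ 2 := by gcongr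
      _ = _ := by ring
  · omega
  · rw [hn, hm]
    have : n * (Δ + e + 1) ≤ n * (3 * n) := Nat.mul_le_mul_left _ (by omega)
    have h2 : n * (3 * n) = 3 * (n * n) := by ring
    omega
  · rw [hm]
    calc m * (10 ^ 9 * (L * L) * (D * D)) = 10 ^ 9 * (m * ((L * D) * (L * D))) := by ring
      _ ≤ 10 ^ 9 * ((n * n) * ((4 * (n * n)) * (4 * (n * n)))) := by gcongr
      _ = 16 * 10 ^ 9 * n ^ 6 := by ring
      _ < 2 ^ w := by omega
  · rw [hm]
    have : Δ * m ≤ n * (n * n) := Nat.mul_le_mul hΔn hmn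
    rw [mul_assoc]
    omega
  · rw [hm]
    have : L * m ≤ 2 * n * (n * n) := Nat.mul_le_mul hLn hmn
    have h2 : 2 * n * (n * n) = 2 * (n * (n * n)) := by ring
    rw [mul_assoc]
    omega
  · intro r hr h
    rw [hm] at h ⊢
    have h1 : m * e < 100 * D * r * e := h.trans_le (by
      calc 100 * Δ * r ≤ 100 * (D * e) * r := by gcongr
        _ = _ := by ring)
    have h2 : m < 100 * D * r := lt_of_mul_lt_mul_right h1 (Nat.zero_le _)
    have hr0 : 0 < r := by
      by_contra hc
      simp [show r = 0 by omega] at h2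
    have h3 : 32 * L * m / r ≤ 3200 * (L * D) := by
      refine Nat.div_le_of_le_mul ?_
      calc 32 * L * m ≤ 32 * L * (100 * D * r) := by gcongr
        _ = _ := by ring
    have h4 : 0 < L * D := Nat.mul_pos (by omega) (by omega)
    omega

/-- The failure probability is at most the inverse of any given power of `n`, if `e` is a large enough
multiple of `log n`. -/
theorem failure_le {n m e c : ℕ} (hn : 2 ≤ n) (hmn : m ≤ n * n)
    (he : 100 * (c + 5) * Real.log n ≤ e) (hem : e ≤ m) :
    n * Real.exp (-(e / 64 : ℝ)) + n * m * (Real.exp (-(e / 100 : ℝ)) + Real.exp (-(e / 4 : ℝ))) +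
      finalRisk m ≤ 1 / (n : ℝ) ^ c := by
  have hn0 : (2 : ℝ) ≤ n := by exact_mod_cast hn
  have hnpos : (0 : ℝ) < n := by linarith
  have hlog : 0 ≤ Real.log n := Real.log_nonneg (by linarith)
  have hc0 : (0 : ℝ) ≤ c := Nat.cast_nonneg _
  have he0 : (0 : ℝ) ≤ e := Nat.cast_nonneg _
  have hem' : (e : ℝ) ≤ m := by exact_mod_cast hem
  have hmn' : (m : ℝ) ≤ n * n := by exact_mod_cast hmn
  -- With `e / 100 ≥ (c + 5) log n`, each exponential is at most `n ^ (-(c + 5))`, which leaves a factor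
  -- of `n ^ 5` for the number of terms.
  have hexp : ∀ x : ℝ, x ≤ -(e / 100 : ℝ) → Real.exp x ≤ 1 / ((n : ℝ) ^ c * n ^ 5) := by
    intro x hx
    rw [← pow_add, le_div_iff₀ (by positivity), ← Real.exp_log (pow_pos hnpos (c + 5)), ← Real.exp_add,
      ← Real.exp_zero, Real.exp_le_exp, Real.log_pow]
    push_cast
    linarith
  have h1 := hexp (-(e / 64)) (by linarith)
  have h2 := hexp (-(e / 100)) le_rfl
  have h3 := hexp (-(e / 4)) (by linarith)
  have h4 : finalRisk m ≤ 1 / ((n : ℝ) ^ c * n ^ 5) := by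
    refine le_trans ?_ (hexp (-(m / 100)) (by linarith))
    have h5 : (4 : ℝ) * (5 / 8) ^ 8 ≤ 1 - 1 / 100 := by norm_num
    have h6 : (1 : ℝ) - 1 / 100 ≤ Real.exp (-(1 / 100)) := by
      linarith [Real.add_one_le_exp (-(1 / 100 : ℝ))]
    calc finalRisk m = (4 * (5 / 8) ^ 8 : ℝ) ^ m := by rw [finalRisk, pow_mul, mul_pow]
      _ ≤ (Real.exp (-(1 / 100))) ^ m := pow_le_pow_left₀ (by norm_num) (h5.trans h6) _
      _ = _ := by rw [← Real.exp_nat_mul]; congr 1; ring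
  have hx0 : 0 ≤ 1 / ((n : ℝ) ^ c * n ^ 5) := by positivity
  have hx : 1 / (n : ℝ) ^ c = n ^ 5 * (1 / ((n : ℝ) ^ c * n ^ 5)) := by
    field_simp
  rw [hx]
  generalize 1 / ((n : ℝ) ^ c * n ^ 5) = x at *
  have h7 : n * (m : ℝ) * (Real.exp (-(e / 100 : ℝ)) + Real.exp (-(e / 4 : ℝ))) ≤
      n * (n * n) * (x + x) := by gcongr
  have h8 : n * Real.exp (-(e / 64 : ℝ)) ≤ n * x := by gcongr
  have h9 : (n + n * (n * n) * 2 + 1 : ℝ) ≤ n ^ 5 := by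
    have q2 : (4 : ℝ) ≤ n ^ 2 := by nlinarith
    have q3 : (n : ℝ) * 4 ≤ n ^ 3 := by nlinarith
    have q5 : (n : ℝ) ^ 3 * 4 ≤ n ^ 5 := by
      have : (n : ℝ) ^ 5 = n ^ 3 * n ^ 2 := by ring
      rw [this]; gcongr
    nlinarith
  nlinarith [mul_le_mul_of_nonneg_right h9 hx0]

end WordRAM

open WordRAM in
theorem theorem1p2 :
    -- one program, running time constant and word length constant for all inputs
    ∃ (P : WordRAM.Program) (K : ℝ) (W : ℕ),
      -- for each exponent in the failure probability, a constant in the lower bound on the degree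
      ∀ c : ℕ, ∃ C : ℝ, 0 < C ∧
        ∀ (ε : ℝ) (n m Δ : ℕ) (G : SimpleGraph (Fin n)) [DecidableRel G.Adj]
          (ends : Fin m → Fin n × Fin n) (w : ℕ),
          0 < ε → ε < 1 →
          G.maxDegree = Δ →
          C * max (Real.log n / ε) ((1 / ε * Real.log (1 / ε)) ^ 2) ≤ (Δ : ℝ) →
          IsEdgeListing G ends →
          W * Nat.log 2 n ≤ w →
          ∃ T : ℕ, (T : ℝ) ≤ K * (m * Real.log Δ ^ 3 / ε ^ 2) ∧
            -- every run halts within `T` steps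
            (∀ s ∈ (WordRAM.run w T (WordRAM.initConfig P ⌊(1 + ε) * Δ⌋₊ ends)).support,
              s.Halted) ∧
            -- the output is correct with high probability
            ENNReal.ofReal (1 - 1 / (n : ℝ) ^ c) ≤
              (WordRAM.run w T (WordRAM.initConfig P ⌊(1 + ε) * Δ⌋₊ ends)).toOuterMeasure
                {s | WordRAM.OutputsColoring G ⌊(1 + ε) * Δ⌋₊ ends s} := by
  classical
  obtain ⟨A, hA⟩ := colorTime_dominated
  refine ⟨main, A * 10 ^ 12, 100, fun c => ⟨1000 * (c + 5), by positivity, ?_⟩⟩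
  intro ε n m Δ G _ ends w hε hε1 hG hC hends hw
  -- The lower bound on the degree excludes graphs without edges.
  have hlogε : 0 < Real.log (1 / ε) := Real.log_pos (by rw [lt_div_iff₀ hε]; linarith)
  have hΔ0 : 0 < (Δ : ℝ) := by
    refine lt_of_lt_of_le (mul_pos (by positivity) (lt_of_lt_of_le ?_ (le_max_right _ _))) hC
    positivity
  have hΔpos : 0 < Δ := by exact_mod_cast hΔ0
  have hn0 : 0 < n := by
    rcases Nat.eq_zero_or_pos n with rfl | h
    · simp [SimpleGraph.maxDegree] at hG
      omega
    · exact h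
  have : Nonempty (Fin n) := ⟨⟨0, hn0⟩⟩
  obtain ⟨v₀, hv₀⟩ := G.exists_maximal_degree_vertex
  rw [hG] at hv₀
  have hΔn : Δ < n := by
    have := G.degree_lt_card_verts v₀
    rw [Fintype.card_fin] at this
    omega
  have hn : 2 ≤ n := by omega
  have hlogn : 0.69 ≤ Real.log n := by
    have h1 : Real.log 2 ≤ Real.log n := Real.log_le_log (by norm_num) (by exact_mod_cast hn)
    linarith [Real.log_two_gt_d9]
  have hεΔ : 1000 * (c + 5) * Real.log n ≤ ε * Δ := by
    have h1 : 1000 * (c + 5) * (Real.log n / ε) ≤ (Δ : ℝ) :=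
      (mul_le_mul_of_nonneg_left (le_max_left _ _) (by positivity)).trans hC
    rw [mul_div_assoc', div_le_iff₀ hε] at h1
    linarith
  have hc0 : (0 : ℝ) ≤ c := Nat.cast_nonneg _
  -- The number of colors exceeds the degree by `e`, and `ε Δ / 2 ≤ e ≤ ε Δ`.
  have hΔq : Δ ≤ ⌊(1 + ε) * Δ⌋₊ := Nat.le_floor (by nlinarith)
  obtain ⟨e, he⟩ := Nat.exists_eq_add_of_le hΔq
  have hq1 : ((Δ + e : ℕ) : ℝ) ≤ (1 + ε) * Δ := he ▸ Nat.floor_le (by positivity)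
  have hq2 : (1 + ε) * Δ < ((Δ + e : ℕ) : ℝ) + 1 := he ▸ Nat.lt_floor_add_one _
  push_cast at hq1 hq2
  rw [he]
  have hclog : 0 ≤ c * Real.log n := by positivity
  have heb : ε * Δ / 2 ≤ e := by linarith
  have he400 : 400 ≤ e := by
    have : (400 : ℝ) ≤ e := by linarith
    exact_mod_cast this
  have heΔ : e ≤ Δ := by
    have : (e : ℝ) ≤ Δ := by nlinarith
    exact_mod_cast this
  have hdeg : ∀ v, (listed hends).deg v ≤ Δ := by
    intro v
    by_cases hv : v < n
    · have := listed_deg hends ⟨v, hv⟩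
      simp only at this
      rw [this, ← hG]
      exact G.degree_le_maxDegree _
    · refine le_of_eq_of_le ?_ (Nat.zero_le _)
      rw [EdgeList.deg, Finset.card_eq_zero, Finset.filter_eq_empty_iff]
      exact fun i hi h => hv (h.lt (Finset.mem_range.1 hi))
  have hmax : ∃ v, (listed hends).deg v = Δ := ⟨v₀, by rw [listed_deg, hv₀]⟩
  have hΔm : Δ ≤ m := by
    obtain ⟨v, hv⟩ := hmax
    rw [← hv]
    exact (Finset.card_filter_le _ _).trans_eq (Finset.card_range _)
  have hmn : m ≤ n * n := by
    have hinj : Function.Injective ends := fun i j hij => hends.1 (by simp only [hij])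
    simpa using Fintype.card_le_of_injective _ hinj
  set L := Nat.log 2 Δ + 2 with hL
  set D := Δ / e + 1 with hD
  have hword := word_bound hn hw
  have hs := setup_of_large (E := listed hends) rfl rfl hdeg he400 heΔ hΔm hΔn.le hmn hL hD hword
  have hp2 : n * n ≤ n ^ 6 := by rw [← sq]; exact Nat.pow_le_pow_right hn0 (by omega)
  have hp1 : n ≤ n * n := Nat.le_mul_of_pos_right _ hn0
  have hH := colorEdges_expect hs rfl hL (by rw [hD]) hmax
    (h := fun S => if (listed hends).Proper (S.a 2) ∧ ∀ i < m, 1 ≤ S.a 2 i ∧ S.a 2 i ≤ Δ + e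
      then 0 else 1)
    (fun S => by split_ifs <;> simp)
    (fun S hS h0 => if_pos ⟨hS.proper, fun i hi => ⟨Nat.pos_of_ne_zero (h0 i hi), hS.le i hi⟩⟩)
  have hfail := failure_le hn hmn (c := c) (e := e) (by linarith) (heΔ.trans hΔm)
  have hrisk := risk_main_le hends (by omega) (by omega) (by omega) hH
    (F := fun σ => if OutputsColoring G (Δ + e) ends ⟨[], σ⟩ then 0 else 1) (fun S σ hR => by
      by_cases h1 : (listed hends).Proper (S.a 2) ∧ ∀ i < m, 1 ≤ S.a 2 i ∧ S.a 2 i ≤ Δ + e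
      · rw [if_pos h1, if_pos (outputsColoring_of_proper hends (s := ⟨[], σ⟩) hR h1.1 h1.2)]
      · rw [if_neg h1]
        split_ifs <;> simp)
  replace hrisk := hrisk.trans (ENNReal.ofReal_le_ofReal hfail)
  refine ⟨_, ?_, halted_of_risk_lt_top (hrisk.trans_lt ENNReal.ofReal_lt_top), ?_⟩
  · have hlogΔ := log_le_four_mul_log (he400.trans heΔ)
    rw [← hL] at hlogΔ
    have hDε : (D : ℝ) ≤ 3 / ε := by
      have h1 : ((Δ / e : ℕ) : ℝ) ≤ Δ / e := Nat.cast_div_le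
      have he0 : (0 : ℝ) < e := by exact_mod_cast (show 0 < e by omega)
      have h2 : (Δ : ℝ) / e ≤ 2 / ε := by
        rw [div_le_div_iff₀ he0 hε]
        linarith
      have h3 : 1 ≤ 1 / ε := by rw [le_div_iff₀ hε]; linarith
      have h4 : 3 / ε = 2 / ε + 1 / ε := by ring
      rw [hD]
      push_cast
      linarith
    have hl1 : 1 ≤ Real.log Δ := by
      have : (400 : ℝ) ≤ Δ := by exact_mod_cast he400.trans heΔ
      rw [Real.le_log_iff_exp_le hΔ0]
      linarith [Real.exp_one_lt_d9]
    have hLD : ((L * D : ℕ) : ℝ) ≤ 12 * (Real.log Δ / ε) := by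
      push_cast
      calc (L : ℝ) * D ≤ (4 * Real.log Δ) * (3 / ε) := by gcongr
        _ = _ := by ring
    have hLD1 : 1 ≤ L * D := Nat.mul_pos (by omega) (Nat.succ_pos _)
    -- Both `s ^ 2` and `ℓ` are of order `(L D) ^ 2`, and `L D` is of order `log Δ / ε`.
    have hnat : (3300 * (L * D) + 1) ^ 2 + 10 ^ 9 * (L * L) * (D * D) ≤ 2 * 10 ^ 9 * (L * D) ^ 2 := by
      have : (3300 * (L * D) + 1) ^ 2 ≤ (3301 * (L * D)) ^ 2 := Nat.pow_le_pow_left (by omega) 2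
      have h2 : 10 ^ 9 * (L * L) * (D * D) = 10 ^ 9 * (L * D) ^ 2 := by ring
      rw [h2]
      rw [mul_pow] at this
      linarith [Nat.zero_le ((L * D) ^ 2)]
    have hT := (hA m Δ (3300 * (L * D)) (10 ^ 9 * (L * L) * (D * D)) (by omega) hΔm).trans
      (Nat.mul_le_mul_left A (Nat.mul_le_mul_left m hnat))
    have hsq : (((L * D : ℕ) : ℝ)) ^ 2 ≤ 144 * (Real.log Δ ^ 3 / ε ^ 2) := by
      calc (((L * D : ℕ) : ℝ)) ^ 2 ≤ (12 * (Real.log Δ / ε)) ^ 2 := by gcongr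
        _ = 144 * (Real.log Δ ^ 2 / ε ^ 2) := by ring
        _ ≤ 144 * (Real.log Δ ^ 3 / ε ^ 2) := by
          gcongr
          omega
    have hT' : ((colorTime m Δ (3300 * (L * D)) (10 ^ 9 * (L * L) * (D * D)) + 4 : ℕ) : ℝ) ≤
        A * (m * (2 * 10 ^ 9 * ((L * D : ℕ) : ℝ) ^ 2)) := by exact_mod_cast hT
    refine hT'.trans ?_
    calc (A : ℝ) * (m * (2 * 10 ^ 9 * ((L * D : ℕ) : ℝ) ^ 2)) ≤
        A * (m * (2 * 10 ^ 9 * (144 * (Real.log Δ ^ 3 / ε ^ 2)))) := by gcongr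
      _ = 2 * 10 ^ 9 * 144 * (A * (m * (Real.log Δ ^ 3 / ε ^ 2))) := by ring
      _ ≤ 10 ^ 12 * (A * (m * (Real.log Δ ^ 3 / ε ^ 2))) := by gcongr; norm_num
      _ = _ := by ring
  · refine le_trans ?_ (one_sub_risk_le (F := fun σ => if OutputsColoring G (Δ + e) ends ⟨[], σ⟩
      then 0 else 1) fun s hs => ?_)
    · rw [ENNReal.ofReal_sub _ (by positivity), ENNReal.ofReal_one]
      exact tsub_le_tsub_left hrisk _
    · rw [if_neg]
      exact hs
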